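/- **Definitions.** For a small category $\mathcal C$, $B\mathcal C$ denotes its classifying space (the geometric realization of its nerve); for a poset $P$, viewed as a category, $|P|=BP$, which is the geometric realization of the order complex of $P$ (the simplicial complex of finite nonempty chains of $P$). For a group $G$, $BG$ is the classifying space of the one-object category with endomorphism group $G$. A *freely oriented matroid* $(\widetilde E,\widetilde M)$ is a finite set $\widetilde E$ with a fixed-point-free involution $e\mapsto\overline e$ and a collection $\widetilde M$ of nonempty subsets of $\widetilde E$ (the *circuits*) such that, for all $C,C_1,C_2\in\widetilde M$: (1) $C\cap\overline C=\emptyset$; (2) $\overline C\in\widetilde M$; (3) if $C_1\subseteq C_2\cup\overline{C_2}$ then $C_1=C_2$ or $C_1=\overline{C_2}$; (4) if $C_1\ne C_2$ and $e\in C_1\cap C_2$, there is $C_3\in\widetilde M$ with $C_3\subseteq (C_1\setminus e)\cup\overline{C_2\setminus e}$. A subset $A\subseteq\widetilde E$ is *independent* if $A\cap\overline A=\emptyset$ and $A\cup\overline A$ contains no circuit; *bases* are the maximal independent sets, and the *rank* is the number of elements of a basis. A *morphism* is an injective map commuting with the involutions under which a subset is a circuit if and only if its image is a circuit. A *unipotent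 representation over $\mathbb R$* is a map $\rho$ from $\widetilde E$ to a real vector space $V$ such that $\rho(e)+\rho(\overline e)=0$ for all $e$; every circuit $C$ has positive reals $a_e$ with $\sum_{e\in C}a_e\rho(e)=0$; $\rho$ maps every independent set injectively onto a linearly independent set; $\rho(\widetilde E)$ spans $V$; and the images of any two bases have the same volume in $V$. A freely oriented matroid is *regular* if it has a unipotent representation over $\mathbb R$. Let $\mathcal R(r,\mathbb Z)$ be the category of regular freely oriented matroids of rank $r$ with the above morphisms. (The class of objects may be replaced by any small skeleton, or by the matroids whose underlying set lies in a fixed universe.) Let $IR(r,\mathbb Z)$ be the poset, ordered by inclusion, of all subsets $\widetilde E\subseteq\mathbb Z^r$ such that $0\notin\widetilde E$, $\widetilde E=-\widetilde E$, $\widetilde E$ generates $\mathbb Z^r$ additively, and any $r$ linearly independent elements of $\widetilde E$ generate $\mathbb Z^r$. **Theorem.** The space $|IR(2,\mathbb Z)|$ is contractible. More precisely, it is an infinite tree: $IR(2,\mathbb Z)$ is infinite and has no chain of three elements, so that its order complex is a graph, and this graph (the comparability graph of the poset) is a tree. Moreover, there is a homotopy equivalence $$B\mathcal R(2,\mathbb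 Z)\simeq BGL(2,\mathbb Z).$$ -/

import Mathlib

open CategoryTheory
open scoped ContinuousMap MatrixGroups

universe u v

/-- The classifying space `BC` of a category `C`: the geometric realization of its nerve.
For a poset `P`, regarded as a category, this is the geometric realization `|P|`. -/
noncomputable def classifyingSpace (C : Type u) [Category.{v} C] : TopCat.{max u v} :=
  SSet.toTop.obj (nerve C)

/-- A freely oriented matroid: a finite set `carrier` with a free involution `bar` (a two-fold
covering of the set of orbits of `bar`), together with a family of signed circuits. -/
structure FreelyOrientedMatroid where
  /-- the two-fold covering of the ground set -/
  carrier : Type u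
  finite : Finite carrier
  /-- the free involution exchanging the two points of each fibre -/
  bar : carrier → carrier
  bar_bar : ∀ e, bar (bar e) = e
  bar_ne : ∀ e, bar e ≠ e
  /-- the signed circuits -/
  circuits : Set (Set carrier)
  nonempty_of_circuit : ∀ C ∈ circuits, C.Nonempty
  disjoint_bar : ∀ C ∈ circuits, Disjoint C (bar '' C)
  bar_mem_circuits : ∀ C ∈ circuits, bar '' C ∈ circuits
  eq_or_eq_bar : ∀ C₁ ∈ circuits, ∀ C₂ ∈ circuits, C₁ ⊆ C₂ ∪ bar '' C₂ →
    C₁ = C₂ ∨ C₁ = bar '' C₂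
  elimination : ∀ C₁ ∈ circuits, ∀ C₂ ∈ circuits, C₁ ≠ C₂ → ∀ e ∈ C₁ ∩ C₂,
    ∃ C₃ ∈ circuits, C₃ ⊆ (C₁ \ {e}) ∪ bar '' (C₂ \ {e})

namespace FreelyOrientedMatroid

/-- `A` is independent: it maps injectively to the set of orbits of `bar`, and its image there
contains the image of no signed circuit. -/
def Indep (M : FreelyOrientedMatroid.{u}) (A : Set M.carrier) : Prop :=
  Disjoint A (M.bar '' A) ∧ ∀ C ∈ M.circuits, ¬ C ⊆ A ∪ M.bar '' A

/-- Bases are the maximal independent sets. -/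
def IsBasis (M : FreelyOrientedMatroid.{u}) (B : Set M.carrier) : Prop :=
  Maximal M.Indep B

/-- The rank is the common number of elements of the bases. -/
def HasRank (M : FreelyOrientedMatroid.{u}) (r : ℕ) : Prop :=
  ∃ B, M.IsBasis B ∧ B.ncard = r

/-- A representation over `ℝ`. -/
structure IsRepresentation (M : FreelyOrientedMatroid.{u}) {V : Type v} [AddCommGroup V]
    [Module ℝ V] (ρ : M.carrier → V) : Prop where
  add_bar : ∀ e, ρ e + ρ (M.bar e) = 0
  circuit : ∀ C ∈ M.circuits, ∃ a : M.carrier → ℝ,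
    (∀ e ∈ C, 0 < a e) ∧ ∑ᶠ e ∈ C, a e • ρ e = 0
  indep : ∀ A, M.Indep A → LinearIndepOn ℝ ρ A
  span : Submodule.span ℝ (Set.range ρ) = ⊤

/-- A representation is unipotent if the images of any two bases have the same volume. The volume
is measured by an alternating form `ω` in as many variables as a basis has elements; as the images
of the bases of the matroid are bases of the vector space, such an `ω` is a top form, unique up to
a scalar. -/
def IsUnipotent (M : FreelyOrientedMatroid.{u}) {V : Type v} [AddCommGroup V]
    [Module ℝ V] (ρ : M.carrier → V) : Prop :=
  M.IsRepresentation ρ ∧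
    ∀ (n : ℕ) (ω : V [⋀^Fin n]→ₗ[ℝ] ℝ) (b b' : Fin n → M.carrier),
      Function.Injective b → Function.Injective b' →
      M.IsBasis (Set.range b) → M.IsBasis (Set.range b') →
      |ω (fun i => ρ (b i))| = |ω (fun i => ρ (b' i))|

/-- A freely oriented matroid is regular if it has a unipotent representation over `ℝ`. (The
vector space is spanned by a finite set, so nothing is lost by taking it in `Type`.) -/
def IsRegular (M : FreelyOrientedMatroid.{u}) : Prop :=
  ∃ (V : Type) (_ : AddCommGroup V) (_ : Module ℝ V) (ρ : M.carrier → V), M.IsUnipotent ρ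

/-- A morphism is an equivariant injection under which a set is a circuit if and only if its image
is one. -/
@[ext]
structure Hom (M N : FreelyOrientedMatroid.{u}) where
  /-- the underlying map -/
  toFun : M.carrier → N.carrier
  injective : Function.Injective toFun
  map_bar : ∀ e, toFun (M.bar e) = N.bar (toFun e)
  image_mem_circuits_iff : ∀ C : Set M.carrier, toFun '' C ∈ N.circuits ↔ C ∈ M.circuits

instance : Category.{u} FreelyOrientedMatroid.{u} where
  Hom M N := Hom M N
  id M := ⟨id, Function.injective_id, fun _ => rfl, fun C => by simp⟩
  comp f g := ⟨g.toFun ∘ f.toFun, g.injective.comp f.injective,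
    fun e => by simp [f.map_bar, g.map_bar],
    fun C => by rw [Set.image_comp, g.image_mem_circuits_iff, f.image_mem_circuits_iff]⟩

end FreelyOrientedMatroid

/-- The category `R(r,ℤ)` of regular freely oriented matroids of rank `r`, a full subcategory of
the category of freely oriented matroids. -/
abbrev RegularMatroidCat (r : ℕ) : Type (u + 1) :=
  ObjectProperty.FullSubcategory
    (fun M : FreelyOrientedMatroid.{u} => M.HasRank r ∧ M.IsRegular)

/-- The poset `IR(r,ℤ)`, ordered by inclusion: the subsets of `ℤ^r` that do not contain `0`, are
symmetric, generate `ℤ^r`, and in which any `r` linearly independent elements generate `ℤ^r`. -/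
abbrev IR (r : ℕ) : Type :=
  {E : Set (Fin r → ℤ) //
    0 ∉ E ∧
    (∀ x, x ∈ E ↔ -x ∈ E) ∧
    AddSubgroup.closure E = ⊤ ∧
    ∀ b : Fin r → (Fin r → ℤ), (∀ i, b i ∈ E) → LinearIndependent ℤ b →
      AddSubgroup.closure (Set.range b) = ⊤}

/-- The comparability graph of a poset, i.e. the 1-skeleton of its order complex. -/
def comparabilityGraph (P : Type u) [PartialOrder P] : SimpleGraph P where
  Adj x y := x < y ∨ y < x
  symm := ⟨fun _ _ h => h.symm⟩
  loopless := ⟨fun x h => h.elim (lt_irrefl x) (lt_irrefl x)⟩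

universe w w'

open Simplicial Opposite MonoidalCategory

namespace stdSimplex

lemma map_apply_of_injective {X Y : Type*} [Fintype X] [Fintype Y] {f : X → Y}
    (hf : Function.Injective f) (s : stdSimplex ℝ X) (x : X) : stdSimplex.map f s (f x) = s x := by
  classical
  rw [stdSimplex.map_coe, FunOnFinite.linearMap_apply_apply]
  rw [Finset.sum_eq_single x] <;> simp +contextual [hf.eq_iff]

lemma map_apply_eq_zero {X Y : Type*} [Fintype X] [Fintype Y] {f : X → Y}
    (s : stdSimplex ℝ X) (y : Y) (hy : y ∉ Set.range f) : stdSimplex.map f s y = 0 := by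
  classical
  rw [stdSimplex.map_coe, FunOnFinite.linearMap_apply_apply]
  apply Finset.sum_eq_zero
  intro x hx
  exact (hy ⟨x, (Finset.mem_filter.1 hx).2⟩).elim

lemma map_injective {X Y : Type*} [Fintype X] [Fintype Y] {f : X → Y}
    (hf : Function.Injective f) : Function.Injective (stdSimplex.map (S := ℝ) f) := by
  intro s t h
  ext x
  rw [← map_apply_of_injective hf s, ← map_apply_of_injective hf t, h]

lemma exists_map_succAbove {n : ℕ} (j : Fin (n + 2)) (x : stdSimplex ℝ (Fin (n + 2)))
    (hx : x j = 0) : ∃ y : stdSimplex ℝ (Fin (n + 1)), stdSimplex.map j.succAbove y = x := by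
  refine ⟨⟨fun k => x (j.succAbove k), fun k => stdSimplex.zero_le x _, ?_⟩, ?_⟩
  · have := stdSimplex.sum_eq_one x
    rw [Fin.sum_univ_succAbove _ j, hx, zero_add] at this
    exact this
  · ext k
    obtain rfl | ⟨k, rfl⟩ := Fin.eq_self_or_eq_succAbove j k
    · rw [map_apply_eq_zero _ _ (by simp), hx]
    · rw [map_apply_of_injective Fin.succAbove_right_injective]
      rfl

lemma exists_of_map_succAbove_eq {n : ℕ} {j l : Fin (n + 3)} (hjl : j < l)
    {y y' : stdSimplex ℝ (Fin (n + 2))}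
    (h : stdSimplex.map j.succAbove y = stdSimplex.map l.succAbove y') :
    ∃ z : stdSimplex ℝ (Fin (n + 1)),
      stdSimplex.map (l.pred (Fin.ne_zero_of_lt hjl)).succAbove z = y ∧
      stdSimplex.map (j.castPred (Fin.ne_last_of_lt hjl)).succAbove z = y' := by
  have hl : j.succAbove (l.pred (Fin.ne_zero_of_lt hjl)) = l := Fin.succAbove_pred_of_lt _ _ hjl
  obtain ⟨z, rfl⟩ := exists_map_succAbove (l.pred (Fin.ne_zero_of_lt hjl)) y (by
    rw [← map_apply_of_injective (Fin.succAbove_right_injective (p := j)) y, hl, h,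
      map_apply_eq_zero _ _ (by simp)])
  refine ⟨z, rfl, map_injective (Fin.succAbove_right_injective (p := l)) ?_⟩
  rw [← h, map_comp_apply, map_comp_apply]
  congr 1
  funext k
  obtain ⟨j, rfl⟩ := j.eq_castSucc_of_ne_last (Fin.ne_last_of_lt hjl)
  obtain ⟨l, rfl⟩ := l.eq_succ_of_ne_zero (Fin.ne_zero_of_lt hjl)
  have := congr_arg (fun f => f.toOrderHom k)
    (SimplexCategory.δ_comp_δ (i := j) (j := l) (Fin.castSucc_lt_succ_iff.1 hjl))
  simpa [SimplexCategory.δ] using this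

/-- The least of the barycentric coordinates of index different from `i`. -/
noncomputable def minCoord {n : ℕ} (i : Fin (n + 2)) (x : stdSimplex ℝ (Fin (n + 2))) : ℝ :=
  Finset.univ.inf' Finset.univ_nonempty (fun k : Fin (n + 1) => x (i.succAbove k))

variable {n : ℕ} (i : Fin (n + 2))

lemma continuous_minCoord : Continuous (minCoord i) := by
  unfold minCoord
  apply Continuous.finset_inf'_apply
  intro k _
  exact (continuous_apply _).comp continuous_subtype_val

lemma minCoord_le (x : stdSimplex ℝ (Fin (n + 2))) (k : Fin (n + 1)) :
    minCoord i x ≤ x (i.succAbove k) := Finset.inf'_le _ (Finset.mem_univ k)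

lemma minCoord_nonneg (x : stdSimplex ℝ (Fin (n + 2))) : 0 ≤ minCoord i x :=
  Finset.le_inf' _ _ (fun _ _ => stdSimplex.zero_le x _)

lemma minCoord_le_one (x : stdSimplex ℝ (Fin (n + 2))) : minCoord i x ≤ 1 :=
  (minCoord_le i x 0).trans (stdSimplex.le_one x _)

lemma exists_eq_minCoord (x : stdSimplex ℝ (Fin (n + 2))) :
    ∃ k : Fin (n + 1), x (i.succAbove k) = minCoord i x := by
  obtain ⟨k, -, hk⟩ := Finset.exists_mem_eq_inf' (Finset.univ_nonempty (α := Fin (n + 1)))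
    (fun k : Fin (n + 1) => x (i.succAbove k))
  exact ⟨k, hk.symm⟩

/-- Move the point `x` parallel to the line from the barycenter of the face opposite to `i`
to the vertex `i`. -/
noncomputable def shift (x : stdSimplex ℝ (Fin (n + 2))) (s : ℝ) (h0 : 0 ≤ s)
    (hs : s ≤ minCoord i x) : stdSimplex ℝ (Fin (n + 2)) :=
  ⟨fun k => if k = i then x i + (n + 1) * s else x k - s, fun k => by
    dsimp only
    split_ifs with h
    · have := stdSimplex.zero_le x i
      positivity
    · obtain ⟨k, rfl⟩ := Fin.exists_succAbove_eq h
      have := minCoord_le i x k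
      linarith, by
    have := stdSimplex.sum_eq_one x
    rw [Fin.sum_univ_succAbove _ i] at this ⊢
    simp [Finset.sum_sub_distrib] at this ⊢
    linarith⟩

lemma shift_self_apply (x : stdSimplex ℝ (Fin (n + 2))) (s : ℝ) (h0 hs) :
    shift i x s h0 hs i = x i + (n + 1) * s := if_pos rfl

lemma shift_succAbove_apply (x : stdSimplex ℝ (Fin (n + 2))) (s : ℝ) (h0 hs) (k) :
    shift i x s h0 hs (i.succAbove k) = x (i.succAbove k) - s := if_neg (Fin.succAbove_ne _ _)

lemma shift_zero (x : stdSimplex ℝ (Fin (n + 2))) (s : ℝ) (h0 hs) (h : s = 0) :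
    shift i x s h0 hs = x := by
  subst h
  ext k
  obtain rfl | ⟨k, rfl⟩ := Fin.eq_self_or_eq_succAbove i k
  · simp [shift_self_apply]
  · simp [shift_succAbove_apply]

lemma continuous_shift {X : Type*} [TopologicalSpace X] (x : X → stdSimplex ℝ (Fin (n + 2)))
    (s : X → ℝ) (h0 : ∀ t, 0 ≤ s t) (hs : ∀ t, s t ≤ minCoord i (x t)) (hx : Continuous x) (hs' : Continuous s) :
    Continuous (fun t => shift i (x t) (s t) (h0 t) (hs t)) := by
  have hk : ∀ k, Continuous (fun t => x t k) := fun k =>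
    (continuous_apply k).comp (continuous_subtype_val.comp hx)
  refine Continuous.subtype_mk (continuous_pi fun k => ?_) _
  by_cases h : k = i
  · simp only [h, if_true]
    exact (hk i).add (continuous_const.mul hs')
  · simp only [h, if_false]
    exact (hk k).sub hs'

end stdSimplex

lemma exists_extension_of_retraction {D W Z : Type*} [TopologicalSpace D] [T2Space D]
    [TopologicalSpace W] [CompactSpace W] [TopologicalSpace Z] (a : W → D) (ha : Continuous a)
    (r : D → D) (hr : Continuous r) (hra : ∀ d, r d ∈ Set.range a) (har : ∀ w, r (a w) = a w)
    (g : C(W, Z)) (hg : ∀ w w', a w = a w' → g w = g w') :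
    ∃ F : C(D, Z), ∀ w, F (a w) = g w := by
  have hq : Topology.IsQuotientMap (Set.rangeFactorization a) := by
    have hc : Continuous (Set.rangeFactorization a) := ha.subtype_mk _
    exact hc.isClosedMap.isQuotientMap hc Set.rangeFactorization_surjective
  let q : C(W, Set.range a) := ⟨_, hq.continuous⟩
  have hq' : Topology.IsQuotientMap q := hq
  have hfac : Function.FactorsThrough g q := fun w w' h => hg w w' (congr_arg Subtype.val h)
  refine ⟨(hq'.lift g hfac).comp ⟨fun d => ⟨r d, hra d⟩, hr.subtype_mk _⟩, fun w => ?_⟩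
  have : (⟨r (a w), hra _⟩ : Set.range a) = q w := Subtype.ext (har w)
  simp only [ContinuousMap.comp_apply, ContinuousMap.coe_mk, this]
  exact DFunLike.congr_fun (hq'.lift_comp g hfac) w

/-- `L ⊆ K` is such that the strip `[0, 1] × K` can be pushed downwards onto the union of its
bottom and of `[0, 1] × L`. -/
def HasStripRetraction (K : Type) [TopologicalSpace K] (L : Set K) : Prop :=
  ∃ (M : ℝ × K → ℝ) (T : ℝ × K → K), Continuous M ∧ Continuous T ∧
    (∀ m k, 0 ≤ m → m ≤ 1 → 0 ≤ M (m, k) ∧ M (m, k) ≤ m ∧ (M (m, k) = 0 ∨ T (m, k) ∈ L)) ∧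
    (∀ k, T (0, k) = k) ∧ (∀ m, ∀ k ∈ L, 0 ≤ m → M (m, k) = m ∧ T (m, k) = k)

lemma hasStripRetraction_empty : HasStripRetraction Unit ∅ :=
  ⟨fun _ => 0, Prod.snd, continuous_const, continuous_snd, by simp +contextual, by simp, by simp⟩

lemma hasStripRetraction_unitInterval : HasStripRetraction unitInterval {0, 1} := by
  let T : ℝ × unitInterval → ℝ := fun p =>
    1 / 2 + ((p.2 : ℝ) - 1 / 2) / (max (1 / 2) (1 - p.1 / 2))
  have hT : Continuous T := by
    refine continuous_const.add (Continuous.div (by fun_prop) (by fun_prop) fun p => ?_)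
    have := le_max_left (1 / 2 : ℝ) (1 - p.1 / 2)
    linarith
  refine ⟨fun p => 4 * max 0 (p.1 / 4 - min (p.2 : ℝ) (1 - p.2)),
    fun p => Set.projIcc 0 1 zero_le_one (T p), by fun_prop, continuous_projIcc.comp hT, ?_, ?_, ?_⟩
  · rintro m ⟨t, ht0, ht1⟩ hm0 hm1
    have h1 : 0 ≤ min t (1 - t) := le_min ht0 (by linarith)
    have hden : max (1 / 2 : ℝ) (1 - m / 2) = 1 - m / 2 := max_eq_right (by linarith)
    have hpos : 0 < 1 - m / 2 := by linarith
    refine ⟨by positivity, ?_, ?_⟩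
    · have : max 0 (m / 4 - min t (1 - t)) ≤ m / 4 := max_le (by linarith) (by linarith)
      dsimp only
      linarith
    · by_cases h : m / 4 ≤ min t (1 - t)
      · left
        dsimp only
        rw [max_eq_left (by linarith), mul_zero]
      · right
        rw [not_le] at h
        obtain h | h := min_lt_iff.1 h
        · left
          refine Set.projIcc_of_le_left _ ?_
          simp only [T, hden]
          have : (t - 1 / 2) / (1 - m / 2) ≤ - (1 / 2) := by
            rw [div_le_iff₀ hpos]
            linarith
          linarith
        · right
          refine Set.projIcc_of_right_le _ ?_
          simp only [T, hden]
          have : 1 / 2 ≤ (t - 1 / 2) / (1 - m / 2) := by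
            rw [le_div_iff₀ hpos]
            linarith
          linarith
  · intro k
    have : T (0, k) = k := by norm_num [T]
    simp [this]
  · rintro m k (rfl | rfl) hm
    · refine ⟨?_, Set.projIcc_of_le_left _ ?_⟩
      · have : 0 ≤ m / 4 := by positivity
        simp [this]
        ring
      · have h2 : T (m, 0) ≤ 0 := by
          simp only [T]
          have h := le_max_left (1 / 2 : ℝ) (1 - m / 2)
          have hle : max (1 / 2 : ℝ) (1 - m / 2) ≤ 1 := max_le (by norm_num) (by linarith)
          have : ((0 : unitInterval) - 1 / 2 : ℝ) / max (1 / 2) (1 - m / 2) ≤ - (1 / 2) := by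
            rw [div_le_iff₀ (by linarith)]
            norm_num
            linarith
          linarith
        exact h2
    · refine ⟨?_, Set.projIcc_of_right_le _ ?_⟩
      · have : 0 ≤ m / 4 := by positivity
        simp [this]
        ring
      · have h2 : 1 ≤ T (m, 1) := by
          simp only [T]
          have h := le_max_left (1 / 2 : ℝ) (1 - m / 2)
          have hle : max (1 / 2 : ℝ) (1 - m / 2) ≤ 1 := max_le (by norm_num) (by linarith)
          have : (1 / 2) ≤ ((1 : unitInterval) - 1 / 2 : ℝ) / max (1 / 2) (1 - m / 2) := by
            rw [le_div_iff₀ (by linarith)]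
            norm_num
            linarith
          linarith
        exact h2

open stdSimplex in
lemma exists_hornRetraction {n : ℕ} (i : Fin (n + 2)) {K : Type} [TopologicalSpace K]
    {L : Set K} (hKL : HasStripRetraction K L) :
    ∃ r : stdSimplex ℝ (Fin (n + 2)) × K → stdSimplex ℝ (Fin (n + 2)) × K, Continuous r ∧
      (∀ d, (∃ j ≠ i, ∃ y, stdSimplex.map j.succAbove y = (r d).1) ∨ (r d).2 ∈ L) ∧
      (∀ j ≠ i, ∀ y k, r (stdSimplex.map j.succAbove y, k) = (stdSimplex.map j.succAbove y, k)) ∧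
      ∀ x, ∀ k ∈ L, r (x, k) = (x, k) := by
  obtain ⟨M, T, hM, hT, hMT, hT0, hMTL⟩ := hKL
  let D := stdSimplex ℝ (Fin (n + 2)) × K
  have hm : ∀ p : D, 0 ≤ minCoord i p.1 - M (minCoord i p.1, p.2) := fun p => by
    have := (hMT (minCoord i p.1) p.2 (minCoord_nonneg i _) (minCoord_le_one i _)).2.1
    linarith
  have hm' : ∀ p : D, minCoord i p.1 - M (minCoord i p.1, p.2) ≤ minCoord i p.1 := fun p => by
    have := (hMT (minCoord i p.1) p.2 (minCoord_nonneg i _) (minCoord_le_one i _)).1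
    linarith
  have hpc : Continuous (Prod.map (minCoord i) (id : K → K)) :=
    (continuous_minCoord i).prodMap continuous_id
  refine ⟨fun p => (shift i p.1 _ (hm p) (hm' p), T (minCoord i p.1, p.2)), ?_, ?_, ?_, ?_⟩
  · refine Continuous.prodMk (continuous_shift i _ _ _ _ continuous_fst ?_) (hT.comp hpc)
    exact ((continuous_minCoord i).comp continuous_fst).sub (hM.comp hpc)
  · intro d
    obtain h0 | hTL := (hMT (minCoord i d.1) d.2 (minCoord_nonneg i _) (minCoord_le_one i _)).2.2
    · obtain ⟨k, hk⟩ := exists_eq_minCoord i d.1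
      refine Or.inl ⟨i.succAbove k, Fin.succAbove_ne _ _, exists_map_succAbove _ _ ?_⟩
      rw [shift_succAbove_apply, hk, h0]
      ring
    · exact Or.inr hTL
  · intro j hj y k
    have h0 : minCoord i (stdSimplex.map j.succAbove y) = 0 := by
      refine le_antisymm ?_ (minCoord_nonneg i _)
      obtain ⟨k, rfl⟩ := Fin.exists_succAbove_eq hj
      refine (minCoord_le i _ k).trans ?_
      rw [map_apply_eq_zero _ _ (by simp)]
    have h1 := hMT 0 k le_rfl zero_le_one
    refine Prod.ext (shift_zero _ _ _ (hm _) (hm' _) ?_) ?_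
    · simp only [h0]
      linarith [h1.1, h1.2.1]
    · simp only [h0, hT0]
  · intro x k hk
    have := hMTL (minCoord i x) k hk (minCoord_nonneg i _)
    refine Prod.ext (shift_zero _ _ _ (hm _) (hm' _) ?_) ?_
    · simp only [this.1, sub_self]
    · simp only [this.2]

open stdSimplex in
lemma exists_extension_horn {n : ℕ} (i : Fin (n + 2)) {K : Type} [TopologicalSpace K]
    [CompactSpace K] [T2Space K] {L : Set K} (hL : IsClosed L) (hKL : HasStripRetraction K L)
    {Z : Type u} [TopologicalSpace Z]
    (g : ∀ j : Fin (n + 2), j ≠ i → C(stdSimplex ℝ (Fin (n + 1)), C(K, Z)))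
    (h : C(stdSimplex ℝ (Fin (n + 2)), C(L, Z)))
    (hg : ∀ j l hj hl y y', j < l → stdSimplex.map j.succAbove y = stdSimplex.map l.succAbove y' →
      g j hj y = g l hl y')
    (hgh : ∀ j hj y (k : L), g j hj y k = h (stdSimplex.map j.succAbove y) k) :
    ∃ F : C(stdSimplex ℝ (Fin (n + 2)), C(K, Z)),
      (∀ j hj y, F (stdSimplex.map j.succAbove y) = g j hj y) ∧
      ∀ x (k : L), F x k = h x k := by
  have hg' : ∀ j l hj hl y y', stdSimplex.map j.succAbove y = stdSimplex.map l.succAbove y' →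
      g j hj y = g l hl y' := by
    intro j l hj hl y y' e
    obtain hjl | rfl | hjl := lt_trichotomy j l
    · exact hg j l hj hl y y' hjl e
    · rw [map_injective Fin.succAbove_right_injective e]
    · exact (hg l j hl hj y' y hjl e.symm).symm
  obtain ⟨r, hr, hra, har, har'⟩ := exists_hornRetraction i hKL
  have : CompactSpace (stdSimplex ℝ (Fin (n + 1))) := isCompact_iff_compactSpace.1 (isCompact_stdSimplex ..)
  have : CompactSpace (stdSimplex ℝ (Fin (n + 2))) := isCompact_iff_compactSpace.1 (isCompact_stdSimplex ..)
  have : CompactSpace L := isCompact_iff_compactSpace.1 hL.isCompact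
  let W := (Σ _ : {j : Fin (n + 2) // j ≠ i}, stdSimplex ℝ (Fin (n + 1)) × K) ⊕
    (stdSimplex ℝ (Fin (n + 2)) × L)
  let a : W → stdSimplex ℝ (Fin (n + 2)) × K :=
    Sum.elim (fun w => (stdSimplex.map w.1.1.succAbove w.2.1, w.2.2)) (fun w => (w.1, w.2))
  have ha : Continuous a := by
    refine Continuous.sumElim (continuous_sigma fun j => ?_) ?_
    · change Continuous (Prod.map (stdSimplex.map j.1.succAbove) (id : K → K))
      exact (stdSimplex.continuous_map _).prodMap continuous_id
    · exact continuous_id.prodMap continuous_subtype_val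
  have hra' : ∀ d, r d ∈ Set.range a := by
    intro d
    obtain ⟨j, hj, y, hy⟩ | hL := hra d
    · exact ⟨Sum.inl ⟨⟨j, hj⟩, (y, (r d).2)⟩, Prod.ext hy rfl⟩
    · exact ⟨Sum.inr ((r d).1, ⟨_, hL⟩), rfl⟩
  let G : C(W, Z) := ⟨Sum.elim (fun w => g w.1.1 w.1.2 w.2.1 w.2.2) (fun w => h w.1 w.2), by
    refine Continuous.sumElim (continuous_sigma fun j => ?_) ?_
    · exact ContinuousEval.continuous_eval.comp ((g j.1 j.2).continuous.prodMap continuous_id)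
    · exact ContinuousEval.continuous_eval.comp (h.continuous.prodMap continuous_id)⟩
  obtain ⟨F, hF⟩ := exists_extension_of_retraction a ha r hr hra' (by
    rintro (⟨⟨j, hj⟩, y, k⟩ | ⟨x, k, hk⟩)
    · exact har j hj y k
    · exact har' x k hk) G (by
    rintro (⟨⟨j, hj⟩, y, k⟩ | ⟨x, k, hk⟩) (⟨⟨j', hj'⟩, y', k'⟩ | ⟨x', k', hk'⟩) e
    · obtain ⟨e1, rfl⟩ := Prod.ext_iff.1 e
      exact DFunLike.congr_fun (hg' _ _ hj hj' _ _ e1) k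
    · obtain ⟨rfl, rfl⟩ := Prod.ext_iff.1 e
      exact hgh j hj y ⟨_, hk'⟩
    · obtain ⟨e1, e2⟩ : x = stdSimplex.map j'.succAbove y' ∧ k = k' := Prod.ext_iff.1 e
      subst e1 e2
      exact (hgh j' hj' y' ⟨_, hk⟩).symm
    · obtain ⟨rfl, rfl⟩ := Prod.ext_iff.1 e
      rfl)
  refine ⟨F.curry, fun j hj y => ?_, fun x k => ?_⟩
  · ext k
    exact hF (Sum.inl ⟨⟨j, hj⟩, y, k⟩)
  · exact hF (Sum.inr ⟨x, k⟩)

/-- The restriction of maps from `K` to a subspace `L`. -/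
def restrictionMap {K : Type} [TopologicalSpace K] (L : Set K) (Z : Type u) [TopologicalSpace Z] :
    TopCat.of C(K, Z) ⟶ TopCat.of C(L, Z) :=
  TopCat.ofHom ⟨fun f => f.comp ⟨Subtype.val, continuous_subtype_val⟩,
    ContinuousMap.continuous_precomp _⟩

lemma toSSetObjEquiv_map_apply {X Y : TopCat.{u}} (p : X ⟶ Y) {n : ℕ}
    (x : TopCat.toSSet.obj X _⦋n⦌) (y : stdSimplex ℝ (Fin (n + 1))) :
    Y.toSSetObjEquiv (op ⦋n⦌) ((TopCat.toSSet.map p).app _ x) y =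
      p (X.toSSetObjEquiv (op ⦋n⦌) x y) := rfl

lemma toSSetObjEquiv_yonedaEquiv_δ_comp {X : TopCat.{u}} {n : ℕ} (j : Fin (n + 2))
    (f : Δ[n + 1] ⟶ TopCat.toSSet.obj X) (y : stdSimplex ℝ (Fin (n + 1))) :
    X.toSSetObjEquiv (op ⦋n⦌) (SSet.yonedaEquiv (SSet.stdSimplex.δ j ≫ f)) y =
      X.toSSetObjEquiv (op ⦋n + 1⦌) (SSet.yonedaEquiv f) (stdSimplex.map j.succAbove y) := by
  obtain ⟨f, rfl⟩ := SSet.yonedaEquiv.symm.surjective f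
  have : SSet.yonedaEquiv (SSet.stdSimplex.δ j ≫ SSet.yonedaEquiv.symm f) =
      (TopCat.toSSet.obj X).δ j f := by
    rw [SSet.stdSimplex.δ_comp_yonedaEquiv_symm, Equiv.apply_symm_apply]
  rw [this, Equiv.apply_symm_apply]
  exact TopCat.toSSetObjEquiv_δ_apply _ _ _

lemma hasLiftingProperty_horn_restrictionMap {n : ℕ} (i : Fin (n + 2)) {K : Type}
    [TopologicalSpace K] [CompactSpace K] [T2Space K] {L : Set K} (hL : IsClosed L)
    (hKL : HasStripRetraction K L) (Z : Type u) [TopologicalSpace Z] :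
    HasLiftingProperty Λ[n + 1, i].ι (TopCat.toSSet.map (restrictionMap L Z)) where
  sq_hasLift {t b} sq := by
    let f : ∀ j : Fin (n + 2), j ≠ i → (Δ[n] ⟶ _) := fun j hj ↦ SSet.horn.ι i j hj ≫ t
    have hf : SSet.horn.IsCompatible f := .of_hom t
    obtain ⟨F, hF, hF'⟩ := exists_extension_horn i hL hKL
      (fun j hj => TopCat.toSSetObjEquiv _ (op ⦋n⦌) (SSet.yonedaEquiv (f j hj)))
      (TopCat.toSSetObjEquiv _ (op ⦋n + 1⦌) (SSet.yonedaEquiv b))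
      (fun j l hj hl y y' hjl e => by
        obtain _ | n := n
        · omega
        · obtain ⟨z, rfl, rfl⟩ := stdSimplex.exists_of_map_succAbove_eq hjl e
          rw [← toSSetObjEquiv_yonedaEquiv_δ_comp, ← toSSetObjEquiv_yonedaEquiv_δ_comp,
            hf.δ_pred_comp j l hj hl hjl])
      (fun j hj y k => by
        have : f j hj ≫ TopCat.toSSet.map (restrictionMap L Z) = SSet.stdSimplex.δ j ≫ b := by
          simp only [f, Category.assoc, sq.w, SSet.horn.ι_ι_assoc]
        rw [← toSSetObjEquiv_yonedaEquiv_δ_comp, ← this]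
        exact congr_arg (fun z : C(L, Z) => z k) (toSSetObjEquiv_map_apply (restrictionMap L Z)
          (SSet.yonedaEquiv (f j hj)) y).symm)
    refine ⟨⟨⟨SSet.yonedaEquiv.symm ((TopCat.toSSetObjEquiv (TopCat.of C(K, Z)) (op ⦋n + 1⦌)).symm F), ?_, ?_⟩⟩⟩
    · refine SSet.horn.hom_ext' fun j hj => ?_
      rw [SSet.horn.ι_ι_assoc]
      apply SSet.yonedaEquiv.injective
      apply (TopCat.toSSetObjEquiv (TopCat.of C(K, Z)) (op ⦋n⦌)).injective
      ext1 y
      rw [toSSetObjEquiv_yonedaEquiv_δ_comp, Equiv.apply_symm_apply, Equiv.apply_symm_apply]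
      exact hF j hj y
    · apply SSet.yonedaEquiv.injective
      apply (TopCat.toSSetObjEquiv (TopCat.of C(L, Z)) (op ⦋n + 1⦌)).injective
      ext1 x
      rw [SSet.yonedaEquiv_comp, toSSetObjEquiv_map_apply, Equiv.apply_symm_apply,
        Equiv.apply_symm_apply]
      ext1 k
      exact hF' x k

namespace SSet

/-- The realization of a morphism of simplicial sets, as a continuous map. -/
noncomputable def realizationMap {X Y : SSet.{u}} (f : X ⟶ Y) : C(toTop.obj X, toTop.obj Y) :=
  (toTop.map f).hom

@[simp]
lemma realizationMap_id (X : SSet.{u}) : realizationMap (𝟙 X) = ContinuousMap.id _ := by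
  simp [realizationMap]

@[simp]
lemma realizationMap_comp {X Y Z : SSet.{u}} (f : X ⟶ Y) (g : Y ⟶ Z) :
    realizationMap (f ≫ g) = (realizationMap g).comp (realizationMap f) := by
  simp [realizationMap]

lemma hasLiftingProperty_toTop_map {X Y : SSet.{u}} {f : X ⟶ Y} (hf : anodyneExtensions f)
    {K : Type} [TopologicalSpace K] [CompactSpace K] [T2Space K] {L : Set K} (hL : IsClosed L)
    (hKL : HasStripRetraction K L) (Z : Type u) [TopologicalSpace Z] :
    HasLiftingProperty (toTop.map f) (restrictionMap L Z) := by
  rw [sSetTopAdj.hasLiftingProperty_iff]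
  refine hf _ ?_
  rw [modelCategoryQuillen.fibrations_eq]
  intro _ _ _ hj
  simp only [modelCategoryQuillen.J, MorphismProperty.iSup_iff] at hj
  obtain ⟨n, ⟨i⟩⟩ := hj
  exact hasLiftingProperty_horn_restrictionMap i hL hKL Z

/-- The realization of an anodyne extension admits a retraction. -/
lemma exists_retraction_of_anodyne {X Y : SSet.{u}} {f : X ⟶ Y} (hf : anodyneExtensions f) :
    ∃ r : C(toTop.obj Y, toTop.obj X), r.comp (realizationMap f) = ContinuousMap.id _ := by
  have := hasLiftingProperty_toTop_map hf isClosed_empty hasStripRetraction_empty (toTop.obj X)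
  let t : toTop.obj X ⟶ TopCat.of C(Unit, toTop.obj X) :=
    TopCat.ofHom ⟨ContinuousMap.const Unit, ContinuousMap.continuous_const'⟩
  let b : toTop.obj Y ⟶ TopCat.of C((∅ : Set Unit), toTop.obj X) :=
    TopCat.ofHom (ContinuousMap.const _ ⟨fun k => k.2.elim, by
      rw [continuous_iff_continuousAt]
      exact fun k => k.2.elim⟩)
  have sq : CommSq t (toTop.map f) (restrictionMap ∅ (toTop.obj X)) b := ⟨by
    ext x k
    exact k.2.elim⟩
  refine ⟨⟨fun y => sq.lift y (), ?_⟩, ?_⟩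
  · exact (ContinuousEvalConst.continuous_eval_const ()).comp sq.lift.hom.continuous
  · ext x
    exact congr_arg (fun g : C(Unit, toTop.obj X) => g ()) (ConcreteCategory.congr_hom sq.fac_left x)

/-- A retraction of the realization of an anodyne extension is a deformation retraction. -/
lemma homotopic_of_anodyne {X Y : SSet.{u}} {f : X ⟶ Y} (hf : anodyneExtensions f) {Z : Type u}
    [TopologicalSpace Z] (g h : C(toTop.obj Y, Z))
    (hgh : g.comp (realizationMap f) = h.comp (realizationMap f)) : g.Homotopic h := by
  have hL : IsClosed ({0, 1} : Set unitInterval) := (Set.toFinite _).isClosed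
  have := hasLiftingProperty_toTop_map hf hL hasStripRetraction_unitInterval Z
  let t : toTop.obj X ⟶ TopCat.of C(unitInterval, Z) :=
    TopCat.ofHom (ContinuousMap.comp ⟨ContinuousMap.const unitInterval, ContinuousMap.continuous_const'⟩
      (g.comp (realizationMap f)))
  let c : C(toTop.obj Y × ({0, 1} : Set unitInterval), Z) :=
    ⟨fun p => if p.2.1 = 0 then g p.1 else h p.1, by
      have hd : DiscreteTopology ({0, 1} : Set unitInterval) := inferInstance
      refine continuous_prod_of_discrete_right.2 fun k => ?_
      dsimp only
      split_ifs
      · exact g.continuous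
      · exact h.continuous⟩
  let b : toTop.obj Y ⟶ TopCat.of C(({0, 1} : Set unitInterval), Z) := TopCat.ofHom c.curry
  have sq : CommSq t (toTop.map f) (restrictionMap _ Z) b := ⟨by
    ext x k
    change g (realizationMap f x) =
      if k.1 = 0 then g (realizationMap f x) else h (realizationMap f x)
    split_ifs
    · rfl
    · exact DFunLike.congr_fun hgh x⟩
  have hl : ∀ y (k : ({0, 1} : Set unitInterval)), sq.lift y k.1 = c (y, k) := fun y k =>
    congr_arg (fun m : C(({0, 1} : Set unitInterval), Z) => m k)
      (ConcreteCategory.congr_hom sq.fac_right y)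
  refine ⟨⟨⟨fun p => sq.lift p.2 p.1, ?_⟩, fun y => ?_, fun y => ?_⟩⟩
  · exact ContinuousEval.continuous_eval.comp
      ((sq.lift.hom.continuous.comp continuous_snd).prodMk continuous_fst)
  · exact (hl y ⟨0, by simp⟩).trans (if_pos rfl)
  · exact (hl y ⟨1, by simp⟩).trans (if_neg (by simp))

theorem exists_homotopyInverse_of_anodyne {X Y : SSet.{u}} {f : X ⟶ Y}
    (hf : anodyneExtensions f) : ∃ r : C(toTop.obj Y, toTop.obj X),
      r.comp (realizationMap f) = ContinuousMap.id _ ∧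
      ((realizationMap f).comp r).Homotopic (ContinuousMap.id _) := by
  obtain ⟨r, hr⟩ := exists_retraction_of_anodyne hf
  refine ⟨r, hr, homotopic_of_anodyne hf _ _ ?_⟩
  rw [ContinuousMap.comp_assoc, hr, ContinuousMap.comp_id, ContinuousMap.id_comp]

/-- The realization of an anodyne extension is a homotopy equivalence. -/
theorem nonempty_homotopyEquiv_of_anodyne {X Y : SSet.{u}} {f : X ⟶ Y}
    (hf : anodyneExtensions f) : Nonempty (toTop.obj X ≃ₕ toTop.obj Y) := by
  obtain ⟨r, hr, hr'⟩ := exists_homotopyInverse_of_anodyne hf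
  exact ⟨⟨realizationMap f, r, by rw [hr], hr'⟩⟩

open modelCategoryQuillen in
lemma anodyneExtensions_δ_one : anodyneExtensions (stdSimplex.δ (1 : Fin 2) : Δ[0] ⟶ Δ[1]) := by
  intro E B p hp
  have : HomotopicalAlgebra.Fibration p := ⟨hp⟩
  refine ⟨fun {t b} sq => ?_⟩
  obtain ⟨φ, hφ, hφ'⟩ := horn.IsCompatible.exists_lift (i := (0 : Fin 2))
    (f := fun _ _ => t) (by simp) p b (fun j hj => by
      obtain rfl : j = 1 := by fin_cases j <;> simp_all
      exact sq.w)
  exact ⟨⟨φ, hφ 1 (by simp), hφ'⟩⟩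

lemma anodyneExtensions_ι₀ (X : SSet.{u}) : anodyneExtensions (ι₀ : X ⟶ X ⊗ Δ[1]) := by
  let e : X ≅ (X ⊗ Δ[0] : SSet.{u}) :=
    { hom := CartesianMonoidalCategory.lift (𝟙 X) (SSet.const (stdSimplex.obj₀Equiv.symm 0))
      inv := CartesianMonoidalCategory.fst _ _
      hom_inv_id := by simp
      inv_hom_id := by
        apply CartesianMonoidalCategory.hom_ext
        · simp
        · exact stdSimplex.isTerminalObj₀.hom_ext _ _ }
  have : (ι₀ : X ⟶ X ⊗ Δ[1]) = e.hom ≫ X ◁ stdSimplex.δ (1 : Fin 2) := by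
    apply CartesianMonoidalCategory.hom_ext
    · simp [e]
    · simp [e, stdSimplex.δ_one_eq_const]
  rw [this]
  have he : anodyneExtensions e.hom := @anodyneExtensions.of_isIso _ _ e.hom (Iso.isIso_hom e)
  exact anodyneExtensions.comp_mem _ _ he (anodyneExtensions_δ_one.whiskerLeft X)

lemma realizationMap_ι₀_homotopic (X : SSet.{u}) :
    (realizationMap (ι₀ : X ⟶ X ⊗ Δ[1])).Homotopic (realizationMap ι₁) := by
  let q := realizationMap (CartesianMonoidalCategory.fst X Δ[1])
  have h : ((realizationMap (ι₀ : X ⟶ X ⊗ Δ[1])).comp q).Homotopic (ContinuousMap.id _) := by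
    refine homotopic_of_anodyne (anodyneExtensions_ι₀ X) _ _ ?_
    rw [ContinuousMap.comp_assoc, ← realizationMap_comp, ι₀_fst, realizationMap_id]
    rfl
  have h' := h.comp (.refl (realizationMap (ι₁ : X ⟶ X ⊗ Δ[1])))
  rwa [ContinuousMap.comp_assoc, ← realizationMap_comp, ι₁_fst, realizationMap_id,
    ContinuousMap.id_comp, ContinuousMap.comp_id] at h'

lemma realizationMap_homotopic {X Y : SSet.{u}} {f g : X ⟶ Y} (H : X ⊗ Δ[1] ⟶ Y)
    (h₀ : ι₀ ≫ H = f) (h₁ : ι₁ ≫ H = g) :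
    (realizationMap f).Homotopic (realizationMap g) := by
  rw [← h₀, ← h₁, realizationMap_comp, realizationMap_comp]
  exact (ContinuousMap.Homotopic.refl _).comp (realizationMap_ι₀_homotopic X)

end SSet

/-- The map of classifying spaces induced by a functor. -/
noncomputable def classifyingMap {C D : Type u} [Category.{v} C] [Category.{v} D] (F : C ⥤ D) :
    C(classifyingSpace C, classifyingSpace D) :=
  SSet.realizationMap (nerveMap F)

lemma classifyingMap_id (C : Type u) [Category.{v} C] :
    classifyingMap (𝟭 C) = ContinuousMap.id _ :=
  SSet.realizationMap_id _

lemma classifyingMap_comp {C D E : Type u} [Category.{v} C] [Category.{v} D] [Category.{v} E]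
    (F : C ⥤ D) (G : D ⥤ E) :
    classifyingMap (F ⋙ G) = (classifyingMap G).comp (classifyingMap F) :=
  SSet.realizationMap_comp (nerveMap F) (nerveMap G)

/-- The simplicial homotopy between maps of nerves attached to a natural transformation. -/
def nerveHomotopy {C D : Type u} [Category.{v} C] [Category.{v} D] {F G : C ⥤ D} (α : F ⟶ G) :
    nerve C ⊗ Δ[1] ⟶ nerve D where
  app _ := ↾fun x => ((SSet.stdSimplex.objEquiv x.2).toOrderHom.monotone.functor.prod'
    (x.1 : ComposableArrows C _)) ⋙ Functor.uncurry.obj (ComposableArrows.mk₁ α)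
  naturality _ _ _ := rfl

lemma ι₀_nerveHomotopy {C D : Type u} [Category.{v} C] [Category.{v} D] {F G : C ⥤ D}
    (α : F ⟶ G) : SSet.ι₀ ≫ nerveHomotopy α = nerveMap F := by
  ext n x
  refine CategoryTheory.Functor.ext (fun _ => rfl) fun i j f => ?_
  change 𝟙 _ ≫ F.map (x.map f) = 𝟙 _ ≫ F.map (x.map f) ≫ 𝟙 _
  simp

lemma ι₁_nerveHomotopy {C D : Type u} [Category.{v} C] [Category.{v} D] {F G : C ⥤ D}
    (α : F ⟶ G) : SSet.ι₁ ≫ nerveHomotopy α = nerveMap G := by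
  ext n x
  refine CategoryTheory.Functor.ext (fun _ => rfl) fun i j f => ?_
  change 𝟙 _ ≫ G.map (x.map f) = 𝟙 _ ≫ G.map (x.map f) ≫ 𝟙 _
  simp

/-- A natural transformation induces a homotopy between maps of classifying spaces. -/
lemma classifyingMap_homotopic {C D : Type u} [Category.{v} C] [Category.{v} D] {F G : C ⥤ D}
    (α : F ⟶ G) : (classifyingMap F).Homotopic (classifyingMap G) :=
  SSet.realizationMap_homotopic (nerveHomotopy α) (ι₀_nerveHomotopy α) (ι₁_nerveHomotopy α)

/-- Functors that are inverse to each other up to homotopy induce a homotopy equivalence. -/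
noncomputable def classifyingHomotopyEquiv {C D : Type u} [Category.{v} C] [Category.{v} D]
    (F : C ⥤ D) (G : D ⥤ C)
    (h : (classifyingMap (F ⋙ G)).Homotopic (classifyingMap (𝟭 C)))
    (h' : (classifyingMap (G ⋙ F)).Homotopic (classifyingMap (𝟭 D))) :
    classifyingSpace C ≃ₕ classifyingSpace D where
  toFun := classifyingMap F
  invFun := classifyingMap G
  left_inv := by rwa [classifyingMap_comp, classifyingMap_id] at h
  right_inv := by rwa [classifyingMap_comp, classifyingMap_id] at h'

namespace SSet

/-- The point of the realization of `X` with barycentric coordinates `t` in the simplex `s`. -/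
noncomputable def point {X : SSet.{u}} {n : SimplexCategoryᵒᵖ} (s : X.obj n)
    (t : _root_.stdSimplex ℝ (Fin (n.unop.len + 1))) : toTop.obj X :=
  (toTop.obj X).toSSetObjEquiv n ((sSetTopAdj.unit.app X).app n s) t

lemma continuous_point {X : SSet.{u}} {n : SimplexCategoryᵒᵖ} (s : X.obj n) :
    Continuous (point s) :=
  ContinuousMap.continuous _

lemma point_map {X : SSet.{u}} {n m : SimplexCategory} (f : n ⟶ m) (s : X.obj (op m))
    (t : _root_.stdSimplex ℝ (Fin (n.len + 1))) :
    point (X.map f.op s) t = point s (_root_.stdSimplex.map f t) := by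
  have := ConcreteCategory.congr_hom ((sSetTopAdj.unit.app X).naturality f.op) s
  unfold point
  rw [← TopCat.toSSetObjEquiv_naturality_apply]
  exact congr_arg (fun z => (toTop.obj X).toSSetObjEquiv (op n) z t) this

lemma toTop_hom_ext {X : SSet.{u}} {Z : TopCat.{u}} {f g : toTop.obj X ⟶ Z}
    (h : ∀ (n : SimplexCategoryᵒᵖ) (s : X.obj n) t, f (point s t) = g (point s t)) : f = g := by
  apply (sSetTopAdj.homEquiv _ _).injective
  ext n s
  apply (Z.toSSetObjEquiv n).injective
  ext t
  exact h n s t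

lemma exists_toTop_hom {X : SSet.{u}} {Z : TopCat.{u}} (φ : X ⟶ TopCat.toSSet.obj Z) :
    ∃ f : toTop.obj X ⟶ Z, ∀ (n : SimplexCategoryᵒᵖ) (s : X.obj n) t,
      f (point s t) = Z.toSSetObjEquiv n (φ.app n s) t := by
  obtain ⟨f, rfl⟩ := (sSetTopAdj.homEquiv _ _).surjective φ
  exact ⟨f, fun _ _ _ => rfl⟩

lemma exists_eq_point {X : SSet.{u}} (x : toTop.obj X) :
    ∃ (n : SimplexCategoryᵒᵖ) (s : X.obj n) (t : _), point s t = x := by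
  let U : Set (toTop.obj X) := {x | ∃ (n : SimplexCategoryᵒᵖ) (s : X.obj n) (t : _), point s t = x}
  let T : TopCat.{u} := @TopCat.of (ULift Prop) ⊤
  let a : toTop.obj X ⟶ T :=
    @TopCat.ofHom _ _ _ ⊤ (@ContinuousMap.mk _ _ _ ⊤ (fun x => ⟨x ∈ U⟩) continuous_top)
  let b : toTop.obj X ⟶ T :=
    @TopCat.ofHom _ _ _ ⊤ (@ContinuousMap.mk _ _ _ ⊤ (fun _ => ⟨True⟩) continuous_top)
  have hab : a = b := toTop_hom_ext fun n s t => by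
    have : point s t ∈ U := ⟨n, s, t, rfl⟩
    exact congr_arg ULift.up (eq_true this)
  have : (ULift.up (x ∈ U) : ULift.{u} Prop) = ⟨True⟩ := ConcreteCategory.congr_hom hab x
  exact of_eq_true (congr_arg ULift.down this)

lemma exists_continuousMap_of_equiv {X : SSet.{u}} {Y : SSet.{w}} (e : ∀ n, X.obj n ≃ Y.obj n)
    (he : ∀ {n m : SimplexCategoryᵒᵖ} (f : n ⟶ m) (s : X.obj n),
      e m (X.map f s) = Y.map f (e n s)) :
    ∃ F : C(toTop.obj X, toTop.obj Y), ∀ (n : SimplexCategoryᵒᵖ) (s : X.obj n) t,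
      F (point s t) = point (e n s) t := by
  have hs : Small.{u} (toTop.obj Y) := by
    refine small_of_surjective (α := Σ n : SimplexCategoryᵒᵖ, X.obj n ×
      _root_.stdSimplex ℝ (Fin (n.unop.len + 1))) (f := fun p => point (e _ p.2.1) p.2.2) fun y => ?_
    obtain ⟨n, s, t, rfl⟩ := exists_eq_point y
    exact ⟨⟨n, (e n).symm s, t⟩, by simp⟩
  let Z : TopCat.{u} := @TopCat.of (Shrink.{u} (toTop.obj Y))
    (TopologicalSpace.induced (equivShrink _).symm inferInstance)
  let h : Z ≃ₜ toTop.obj Y := (equivShrink (toTop.obj Y)).symm.toHomeomorphOfIsInducing ⟨rfl⟩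
  let φ : X ⟶ TopCat.toSSet.obj Z :=
    { app n := ↾fun s => (Z.toSSetObjEquiv n).symm
        ⟨fun t => h.symm (point (e n s) t), h.symm.continuous.comp (continuous_point _)⟩
      naturality n m f := by
        ext s
        apply (Z.toSSetObjEquiv m).injective
        refine ContinuousMap.ext fun t => ?_
        obtain ⟨f, rfl⟩ : ∃ g, f = Quiver.Hom.op g := ⟨f.unop, rfl⟩
        change h.symm (point (e m (X.map f.op s)) t) = h.symm (point (e n s) (_root_.stdSimplex.map f t))
        rw [he]
        exact congr_arg h.symm (point_map f _ t) }
  obtain ⟨f, hf⟩ := exists_toTop_hom φ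
  refine ⟨⟨fun x => h (f x), h.continuous.comp f.hom.continuous⟩, fun n s t => ?_⟩
  change h (f (point s t)) = _
  rw [hf]
  exact h.apply_symm_apply _

/-- The realization does not depend on the universe. -/
theorem nonempty_homeomorph_of_equiv {X : SSet.{u}} {Y : SSet.{w}} (e : ∀ n, X.obj n ≃ Y.obj n)
    (he : ∀ {n m : SimplexCategoryᵒᵖ} (f : n ⟶ m) (s : X.obj n),
      e m (X.map f s) = Y.map f (e n s)) :
    Nonempty (toTop.obj X ≃ₜ toTop.obj Y) := by
  obtain ⟨F, hF⟩ := exists_continuousMap_of_equiv e he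
  obtain ⟨G, hG⟩ := exists_continuousMap_of_equiv (fun n => (e n).symm) (fun {n m} f s => by
    rw [Equiv.symm_apply_eq, he, Equiv.apply_symm_apply])
  refine ⟨⟨⟨F, G, fun x => ?_, fun y => ?_⟩, F.continuous, G.continuous⟩⟩
  · obtain ⟨n, s, t, rfl⟩ := exists_eq_point x
    rw [hF, hG, Equiv.symm_apply_apply]
  · obtain ⟨n, s, t, rfl⟩ := exists_eq_point y
    rw [hG, hF, Equiv.apply_symm_apply]

end SSet

lemma contractibleSpace_classifyingSpace_punit :
    ContractibleSpace (classifyingSpace (Discrete PUnit.{u + 1})) := by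
  have hu : ∀ n : SimplexCategoryᵒᵖ, Nonempty (Unique ((nerve (Discrete PUnit.{u + 1})).obj n)) :=
    fun n => ⟨⟨(Functor.const _).obj ⟨⟨⟩⟩⟩, fun _ => Functor.punit_ext' _ _⟩
  have hu' : ∀ n : SimplexCategoryᵒᵖ, Nonempty (Unique ((Δ[0] : SSet.{0}).obj n)) := fun n =>
    ⟨⟨SSet.stdSimplex.objEquiv.symm default⟩, fun _ =>
      SSet.stdSimplex.objEquiv.injective (SimplexCategory.isTerminalZero.hom_ext _ _)⟩
  have e := fun n => @Equiv.ofUnique _ _ (hu n).some (hu' n).some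
  obtain ⟨h⟩ := SSet.nonempty_homeomorph_of_equiv e (fun {n m} f s =>
    @Subsingleton.elim _ (hu' m).some.instSubsingleton _ _)
  exact (h.toHomotopyEquiv.trans
    (Homeomorph.homeomorphOfUnique _ Unit).toHomotopyEquiv).contractibleSpace

lemma contractibleSpace_classifyingSpace_of_isTerminal {C : Type u} [Category.{u} C] {X : C}
    (hX : Limits.IsTerminal X) : ContractibleSpace (classifyingSpace C) := by
  have := contractibleSpace_classifyingSpace_punit.{u}
  refine (classifyingHomotopyEquiv (D := Discrete PUnit.{u + 1}) ((Functor.const _).obj ⟨⟨⟩⟩)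
    ((Functor.const _).obj X) ?_ ?_).contractibleSpace
  · exact (classifyingMap_homotopic { app := fun Y => hX.from Y, naturality := fun _ _ _ => hX.hom_ext _ _ }).symm
  · exact classifyingMap_homotopic (𝟙 _)

namespace SSet

variable {X S E F : SSet.{u}} (q : X ⟶ S) {A : X.Subcomplex} (φ : (A : SSet.{u}) ⟶ E)
  (p : E ⟶ F) (b : X ⟶ F)

/-- A simplex `base` of `S` together with a partial lift of `b`, defined over this simplex, which
extends `φ`. -/
structure RelativeLift (n : SimplexCategoryᵒᵖ) where
  /-- the simplex of the base -/
  base : S.obj n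
  /-- the partial lift -/
  lift : ∀ (m : SimplexCategoryᵒᵖ) (θ : n ⟶ m) (x : X.obj m), q.app m x = S.map θ base → E.obj m
  naturality : ∀ {m m' : SimplexCategoryᵒᵖ} (θ : n ⟶ m) (f : m ⟶ m') (x : X.obj m) h h',
    lift m' (θ ≫ f) (X.map f x) h' = E.map f (lift m θ x h)
  extends_left : ∀ (m : SimplexCategoryᵒᵖ) (θ : n ⟶ m) (x : X.obj m) h (hx : x ∈ A.obj m),
    lift m θ x h = φ.app m ⟨x, hx⟩
  fac_right : ∀ (m : SimplexCategoryᵒᵖ) (θ : n ⟶ m) (x : X.obj m) h,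
    p.app m (lift m θ x h) = b.app m x

namespace RelativeLift

variable {q φ p b}

lemma hext {n : SimplexCategoryᵒᵖ} {L L' : RelativeLift q φ p b n} (h : L.base = L'.base)
    (h' : ∀ m θ x h₁ h₂, L.lift m θ x h₁ = L'.lift m θ x h₂) : L = L' := by
  obtain ⟨s, l, _, _, _⟩ := L
  obtain ⟨s', l', _, _, _⟩ := L'
  obtain rfl : s = s' := h
  obtain rfl : l = l' := by
    funext m θ x h
    exact h' m θ x h h
  rfl

lemma lift_congr {n m : SimplexCategoryᵒᵖ} {L L' : RelativeLift q φ p b n} (hL : L = L')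
    {θ θ' : n ⟶ m} (hθ : θ = θ') {x x' : X.obj m} (hx : x = x') (h h') :
    L.lift m θ x h = L'.lift m θ' x' h' := by
  subst hL hθ hx
  rfl

/-- The action of the simplicial operators on relative lifts. -/
def map {n n' : SimplexCategoryᵒᵖ} (f : n ⟶ n') (L : RelativeLift q φ p b n) :
    RelativeLift q φ p b n' where
  base := S.map f L.base
  lift m θ x h := L.lift m (f ≫ θ) x (by rw [h, Functor.map_comp_apply])
  naturality θ g x h h' := by
    rw [lift_congr rfl (Category.assoc f θ g).symm rfl _ _]
    · exact L.naturality (f ≫ θ) g x _ _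
    · rw [h', Functor.map_comp_apply, Functor.map_comp_apply,
        Functor.map_comp_apply]
  extends_left m θ x h hx := L.extends_left _ _ _ _ _
  fac_right m θ x h := L.fac_right _ _ _ _

/-- The value of a relative lift on the simplices over its base. -/
def diag {n : SimplexCategoryᵒᵖ} (L : RelativeLift q φ p b n) (x : X.obj n)
    (h : q.app n x = L.base) : E.obj n :=
  L.lift n (𝟙 n) x (by rw [h, Functor.map_id_apply])

lemma map_diag {n m : SimplexCategoryᵒᵖ} (f : n ⟶ m) (L : RelativeLift q φ p b n) (x : X.obj n)
    (h : q.app n x = L.base) (h' : q.app m (X.map f x) = (L.map f).base) :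
    (L.map f).diag (X.map f x) h' = E.map f (L.diag x h) := by
  have e1 : q.app m (X.map f x) = S.map f L.base := h'
  calc _ = L.lift m (f ≫ 𝟙 m) (X.map f x) (by rw [Category.comp_id, e1]) := rfl
    _ = L.lift m (𝟙 n ≫ f) (X.map f x) (by rw [Category.id_comp, e1]) :=
      lift_congr rfl (by simp) rfl _ _
    _ = _ := L.naturality (𝟙 n) f x _ _

lemma diag_congr {n : SimplexCategoryᵒᵖ} {L L' : RelativeLift q φ p b n} (hL : L = L')
    {x x' : X.obj n} (hx : x = x') (h h') : L.diag x h = L'.diag x' h' :=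
  lift_congr hL rfl hx _ _

lemma map_diag_eq_lift {n m : SimplexCategoryᵒᵖ} (f : n ⟶ m) (L : RelativeLift q φ p b n)
    (x : X.obj m) (h : q.app m x = (L.map f).base) : (L.map f).diag x h = L.lift m f x h :=
  lift_congr (L := L) rfl (Category.comp_id f) rfl _ _

end RelativeLift

/-- The simplicial set of relative lifts. -/
def relativeLifts : SSet.{u} where
  obj n := RelativeLift q φ p b n
  map f := ↾(RelativeLift.map f)
  map_id n := by
    ext L
    refine RelativeLift.hext ?_ fun m θ x h₁ h₂ => ?_
    · change S.map (𝟙 n) L.base = L.base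
      rw [Functor.map_id_apply]
    · exact RelativeLift.lift_congr rfl (Category.id_comp θ) rfl _ _
  map_comp f g := by
    ext L
    refine RelativeLift.hext ?_ fun m θ x h₁ h₂ => ?_
    · change S.map (f ≫ g) L.base = S.map g (S.map f L.base)
      rw [Functor.map_comp_apply]
    · exact RelativeLift.lift_congr rfl (Category.assoc f g θ) rfl _ _

/-- The projection from relative lifts to the base. -/
def relativeLiftsπ : relativeLifts q φ p b ⟶ S where
  app n := ↾(fun L : RelativeLift q φ p b n => L.base)
  naturality _ _ _ := rfl

variable {q φ p b}

lemma exists_lift_of_section (s : S ⟶ relativeLifts q φ p b)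
    (hs : s ≫ relativeLiftsπ q φ p b = 𝟙 S) :
    ∃ l : X ⟶ E, A.ι ≫ l = φ ∧ l ≫ p = b := by
  let σ : ∀ n, S.obj n → RelativeLift q φ p b n := fun n y => s.app n y
  have hbase : ∀ (n : SimplexCategoryᵒᵖ) (y : S.obj n), (σ n y).base = y := fun n y => by
    have := ConcreteCategory.congr_hom (congr_app hs n) y
    exact this
  have hσ : ∀ {n m : SimplexCategoryᵒᵖ} (f : n ⟶ m) y, σ m (S.map f y) = (σ n y).map f :=
    fun f y => NatTrans.naturality_apply s f y
  let l : X ⟶ E :=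
    { app n := ↾fun x => (σ n (q.app n x)).diag x (hbase _ _).symm
      naturality n m f := by
        ext x
        have h1 : σ m (q.app m (X.map f x)) = (σ n (q.app n x)).map f := by
          rw [NatTrans.naturality_apply, hσ]
        have h2 : q.app m (X.map f x) = ((σ n (q.app n x)).map f).base := by rw [← h1, hbase]
        exact (RelativeLift.diag_congr h1 rfl (hbase _ _).symm h2).trans
          (RelativeLift.map_diag f (σ n (q.app n x)) x (hbase _ _).symm h2) }
  refine ⟨l, ?_, ?_⟩
  · ext n x
    exact RelativeLift.extends_left _ _ _ _ _ x.2
  · ext n x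
    exact RelativeLift.fac_right _ _ _ _ _

/-- The data exhibiting `Y` as the pullback of `q` along the simplex `τ`. -/
structure IsFiber {n : SimplexCategory} (q : X ⟶ S) (τ : S.obj (op n)) {Y : SSet.{u}} (c : Y ⟶ X)
    (d : Y ⟶ stdSimplex.obj n) : Prop where
  fac : ∀ {m : SimplexCategoryᵒᵖ} (y : Y.obj m),
    q.app m (c.app m y) = S.map (stdSimplex.objEquiv (d.app m y)).op τ
  existsUnique : ∀ {m : SimplexCategoryᵒᵖ} (x : X.obj m) (θ : op n ⟶ m),
    q.app m x = S.map θ τ → ∃! y : Y.obj m, c.app m y = x ∧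
      (stdSimplex.objEquiv (d.app m y)).op = θ

lemma exists_boundary_lift {n : ℕ} (hφ : φ ≫ p = A.ι ≫ b)
    (hq : ∀ τ : S _⦋n⦌, ∃ (Y : SSet.{u}) (c : Y ⟶ X) (d : Y ⟶ Δ[n]), IsFiber q τ c d ∧
      ∀ (g : ((A.preimage c ⊔ (boundary n).preimage d : Y.Subcomplex) : SSet.{u}) ⟶ E)
        (b' : Y ⟶ F), g ≫ p = Subcomplex.ι _ ≫ b' →
        ∃ ℓ : Y ⟶ E, Subcomplex.ι _ ≫ ℓ = g ∧ ℓ ≫ p = b')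
    (t : (boundary n : SSet.{u}) ⟶ relativeLifts q φ p b) (v : Δ[n] ⟶ S)
    (htv : t ≫ relativeLiftsπ q φ p b = (boundary n).ι ≫ v) :
    ∃ L : Δ[n] ⟶ relativeLifts q φ p b, (boundary n).ι ≫ L = t ∧ L ≫ relativeLiftsπ q φ p b = v := by
  obtain ⟨τ, rfl⟩ := yonedaEquiv.symm.surjective v
  obtain ⟨Y, c, d, hcd, hlift⟩ := hq τ
  let T : ∀ m (z : Δ[n].obj m), z ∈ (boundary n).obj m → RelativeLift q φ p b m :=
    fun m z hz => t.app m ⟨z, hz⟩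
  have hTbase : ∀ m (z : Δ[n].obj m) hz,
      (T m z hz).base = S.map (stdSimplex.objEquiv z).op τ := fun m z hz => by
    have := ConcreteCategory.congr_hom (congr_app htv m) ⟨z, hz⟩
    exact this
  have hTmap : ∀ {m m'} (f : m ⟶ m') z hz hz', T m' (Δ[n].map f z) hz' = (T m z hz).map f :=
    fun f z hz _ => NatTrans.naturality_apply t f ⟨z, hz⟩
  have hTdiag : ∀ m y (hy : d.app m y ∈ (boundary n).obj m),
      q.app m (c.app m y) = (T m _ hy).base := fun m y hy => by rw [hTbase, hcd.fac]
  classical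
  let g : ((A.preimage c ⊔ (boundary n).preimage d : Y.Subcomplex) : SSet.{u}) ⟶ E :=
    { app m := ↾fun y => if h : c.app m y.1 ∈ A.obj m then φ.app m ⟨_, h⟩ else
        (T m _ (y.2.resolve_left h)).diag (c.app m y.1) (hTdiag _ _ _)
      naturality m m' f := by
        ext ⟨y, hy⟩
        by_cases h : c.app m y ∈ A.obj m
        · have h' : c.app m' (Y.map f y) ∈ A.obj m' := by
            rw [NatTrans.naturality_apply]
            exact A.map f h
          refine (dif_pos h').trans (Eq.trans ?_ (congr_arg (E.map f) (dif_pos h).symm))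
          refine Eq.trans ?_ (NatTrans.naturality_apply φ f ⟨_, h⟩)
          exact congr_arg (φ.app m') (Subtype.ext (NatTrans.naturality_apply c f y))
        · have hd := hy.resolve_left h
          refine Eq.trans ?_ (congr_arg (E.map f) (dif_neg h).symm)
          have h₀ := hTdiag m y hd
          have hd' : Δ[n].map f (d.app m y) ∈ (boundary n).obj m' := (boundary n).map f hd
          have h₁ : q.app m' (X.map f (c.app m y)) = ((T m _ hd).map f).base := by
            rw [NatTrans.naturality_apply, h₀]
            rfl
          refine Eq.trans ?_ (RelativeLift.map_diag f _ _ h₀ h₁)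
          have hd'' : d.app m' (Y.map f y) ∈ (boundary n).obj m' := by
            rwa [NatTrans.naturality_apply]
          have h₂ : T m' (d.app m' (Y.map f y)) hd'' = (T m _ hd).map f := by
            rw [← hTmap f _ hd hd']
            congr 1
            exact NatTrans.naturality_apply d f y
          have h₃ := hTdiag m' (Y.map f y) hd''
          refine Eq.trans ?_ (RelativeLift.diag_congr h₂ (NatTrans.naturality_apply c f y) h₃ h₁)
          by_cases h' : c.app m' (Y.map f y) ∈ A.obj m'
          · refine (dif_pos h').trans ?_
            exact ((T m' _ hd'').extends_left _ _ _ _ h').symm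
          · exact dif_neg h' }
  have hg₁ : ∀ m y hy (h : c.app m y ∈ A.obj m), g.app m ⟨y, hy⟩ = φ.app m ⟨_, h⟩ :=
    fun m y hy h => dif_pos h
  have hg₂ : ∀ m y hy (h : d.app m y ∈ (boundary n).obj m),
      g.app m ⟨y, hy⟩ = (T m _ h).diag (c.app m y) (hTdiag _ _ _) := fun m y hy h => by
    by_cases h' : c.app m y ∈ A.obj m
    · rw [hg₁ m y hy h']
      exact ((T m _ h).extends_left _ _ _ _ h').symm
    · exact dif_neg h'
  obtain ⟨ℓ, hℓ, hℓ'⟩ := hlift g (c ≫ b) (by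
    ext m ⟨y, hy⟩
    by_cases h : c.app m y ∈ A.obj m
    · refine (congr_arg (p.app m) (hg₁ m y hy h)).trans ?_
      have := ConcreteCategory.congr_hom (congr_app hφ m) ⟨_, h⟩
      exact this
    · refine (congr_arg (p.app m) (hg₂ m y hy (hy.resolve_left h))).trans ?_
      exact RelativeLift.fac_right _ _ _ _ _)
  have hℓg : ∀ m y hy, ℓ.app m y = g.app m ⟨y, hy⟩ := fun m y hy => by
    rw [← hℓ]
    rfl
  have hℓ₁ : ∀ m y (h : c.app m y ∈ A.obj m), ℓ.app m y = φ.app m ⟨_, h⟩ :=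
    fun m y h => (hℓg m y (Or.inl h)).trans (hg₁ m y _ h)
  have hℓ₂ : ∀ m y (h : d.app m y ∈ (boundary n).obj m),
      ℓ.app m y = (T m _ h).diag (c.app m y) (hTdiag _ _ _) :=
    fun m y h => (hℓg m y (Or.inr h)).trans (hg₂ m y _ h)
  have hℓp : ∀ m y, p.app m (ℓ.app m y) = b.app m (c.app m y) := fun m y =>
    ConcreteCategory.congr_hom (congr_app hℓ' m) y
  choose Φ hΦ hΦ' using fun m (θ : op ⦋n⦌ ⟶ m) (x : X.obj m) h => hcd.existsUnique x θ h
  let L₀ : RelativeLift q φ p b (op ⦋n⦌) :=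
    { base := τ
      lift m θ x h := ℓ.app m (Φ m θ x h)
      naturality {m m'} θ f x h h' := by
        rw [← NatTrans.naturality_apply]
        congr 1
        refine (hΦ' _ _ _ _ _ ⟨?_, ?_⟩).symm
        · rw [NatTrans.naturality_apply, (hΦ m θ x h).1]
        · rw [NatTrans.naturality_apply]
          exact congr_arg (· ≫ f) (hΦ m θ x h).2
      extends_left m θ x h hx := by
        have hA : c.app m (Φ m θ x h) ∈ A.obj m := by rwa [(hΦ m θ x h).1]
        rw [hℓ₁ _ _ hA]
        exact congr_arg (φ.app m) (Subtype.ext (hΦ m θ x h).1)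
      fac_right m θ x h := by rw [hℓp, (hΦ m θ x h).1] }
  refine ⟨yonedaEquiv.symm (L₀ : (relativeLifts q φ p b).obj (op ⦋n⦌)), ?_, ?_⟩
  · ext m ⟨z, hz⟩
    change RelativeLift.map (stdSimplex.objEquiv z).op L₀ = T m z hz
    refine RelativeLift.hext (hTbase m z hz).symm fun k θ x h₁ h₂ => ?_
    change ℓ.app k (Φ k _ x _) = _
    generalize_proofs h₃
    obtain ⟨e₁, e₂⟩ := hΦ k _ x h₃
    generalize Φ k _ x h₃ = y at e₁ e₂
    have e₃ : d.app k y = Δ[n].map θ z := by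
      apply stdSimplex.objEquiv.injective
      apply Quiver.Hom.op_inj
      rw [e₂]
      rfl
    have hz' : Δ[n].map θ z ∈ (boundary n).obj k := (boundary n).map θ hz
    have hy : d.app k y ∈ (boundary n).obj k := by rwa [e₃]
    rw [hℓ₂ k y hy]
    have h₄ : T k (d.app k y) hy = (T m z hz).map θ := by
      rw [← hTmap θ z hz hz']
      congr 1
    refine (RelativeLift.diag_congr h₄ e₁ _ ?_).trans (RelativeLift.map_diag_eq_lift θ _ x ?_)
    all_goals exact h₂
  · apply yonedaEquiv.injective
    change S.map (𝟙 _) τ = _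
    rw [Equiv.apply_symm_apply, Functor.map_id_apply]

/-- A subcomplex inclusion is anodyne as soon as it is so, relatively to the boundary, over each
simplex of a base. -/
theorem anodyneExtensions_of_isFiber (q : X ⟶ S) (A : X.Subcomplex)
    (hq : ∀ (n : ℕ) (τ : S _⦋n⦌), ∃ (Y : SSet.{u}) (c : Y ⟶ X) (d : Y ⟶ Δ[n]), IsFiber q τ c d ∧
      anodyneExtensions (A.preimage c ⊔ (boundary n).preimage d : Y.Subcomplex).ι) :
    anodyneExtensions A.ι := by
  intro E F p hp
  refine ⟨fun {φ b} sq => ?_⟩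
  have hπ : (modelCategoryQuillen.I : MorphismProperty SSet.{u}).rlp
      (relativeLiftsπ q φ p b) := by
    rintro _ _ _ ⟨n⟩
    refine ⟨fun {t v} sq' => ?_⟩
    obtain ⟨L, h₁, h₂⟩ := exists_boundary_lift sq.w (fun τ => by
      obtain ⟨Y, c, d, hcd, hY⟩ := hq n τ
      refine ⟨Y, c, d, hcd, fun g b' h => ?_⟩
      have := hY _ hp
      have sq'' : CommSq g (Subcomplex.ι _) p b' := ⟨h⟩
      exact ⟨sq''.lift, sq''.fac_left, sq''.fac_right⟩) t v sq'.w
    exact ⟨⟨⟨L, h₁, h₂⟩⟩⟩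
  rw [← rlp_monomorphisms] at hπ
  have := hπ (Limits.initial.to S) (inferInstanceAs (Mono _))
  have sq' : CommSq (Limits.initial.to _) (Limits.initial.to S) (relativeLiftsπ q φ p b) (𝟙 S) :=
    ⟨Limits.initialIsInitial.hom_ext _ _⟩
  obtain ⟨l, h₁, h₂⟩ := exists_lift_of_section sq'.lift sq'.fac_right
  exact ⟨⟨⟨l, h₁, h₂⟩⟩⟩

end SSet

/-- The simplices of the nerve all of whose vertices have a given property. -/
def nerveSubcomplex {C : Type u} [Category.{v} C] (U : ObjectProperty C) :
    (nerve C).Subcomplex where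
  obj _ := {x | ∀ k, U ((x : ComposableArrows C _).obj k)}
  map _ _ hx _ := hx _

lemma nonempty_homeomorph_nerveSubcomplex {C : Type u} [Category.{v} C] (U : ObjectProperty C) :
    Nonempty (classifyingSpace U.FullSubcategory ≃ₜ
      SSet.toTop.obj (nerveSubcomplex U : SSet.{max u v})) :=
  SSet.nonempty_homeomorph_of_equiv (fun _ =>
    { toFun := fun x => ⟨(x : ComposableArrows U.FullSubcategory _) ⋙ U.ι,
        fun k => ((x : ComposableArrows U.FullSubcategory _).obj k).property⟩
      invFun := fun x => U.lift x.1 x.2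
      left_inv := fun _ => rfl
      right_inv := fun _ => rfl }) fun _ _ => rfl

/-- An equivalence of categories induces a homotopy equivalence of classifying spaces. -/
noncomputable def CategoryTheory.Equivalence.classifyingHomotopyEquiv {C D : Type u}
    [Category.{v} C] [Category.{v} D] (e : C ≌ D) : classifyingSpace C ≃ₕ classifyingSpace D :=
  _root_.classifyingHomotopyEquiv e.functor e.inverse
    (classifyingMap_homotopic e.unitIso.inv) (classifyingMap_homotopic e.counitIso.hom)

section Orb

variable {G : Type} [Group G] {P : Type} [PartialOrder P]

/-- The homotopy orbit category of a group acting on a poset: the objects are the points of the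
poset, and a morphism from `x` to `y` is an element of the group moving `x` below `y`. -/
structure Orb (ρ : G →* (P ≃o P)) : Type where
  /-- the point of the poset -/
  pt : P

namespace Orb

variable {ρ : G →* (P ≃o P)}

instance : Category.{0} (Orb ρ) where
  Hom x y := {g : G // ρ g x.pt ≤ y.pt}
  id x := ⟨1, by simp⟩
  comp f g := ⟨g.1 * f.1, by
    rw [map_mul]
    exact ((ρ g.1).monotone f.2).trans g.2⟩
  id_comp f := Subtype.ext (mul_one _)
  comp_id f := Subtype.ext (one_mul _)
  assoc f g h := Subtype.ext (mul_assoc _ _ _).symm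

@[simp] lemma comp_val {x y z : Orb ρ} (f : x ⟶ y) (g : y ⟶ z) : (f ≫ g).1 = g.1 * f.1 := rfl

@[simp] lemma id_val (x : Orb ρ) : Subtype.val (𝟙 x) = 1 := rfl

lemma eqToHom_val {x y : Orb ρ} (h : x = y) : Subtype.val (eqToHom h) = 1 := by
  subst h
  rfl

lemma functor_ext {C : Type w} [Category.{w'} C] {F F' : C ⥤ Orb ρ}
    (h : ∀ x, (F.obj x).pt = (F'.obj x).pt) (h' : ∀ {x y} (f : x ⟶ y), (F.map f).1 = (F'.map f).1) :
    F = F' := by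
  refine CategoryTheory.Functor.ext (fun x => ?_) fun x y f => Subtype.ext ?_
  · have := h x
    cases hx : F.obj x
    cases hy : F'.obj x
    rw [hx, hy] at this
    congr
  · simp [eqToHom_val, h']

variable (ρ)

/-- The functor remembering the element of the group only. -/
def proj : Orb ρ ⥤ SingleObj G where
  obj _ := SingleObj.star G
  map f := f.1

variable {ρ}

/-- The simplex of the nerve of the homotopy orbit category attached to a simplex of the nerve of
the group and to a simplex of the nerve of the poset. -/
def twist {n : ℕ} (τ : ComposableArrows (SingleObj G) n) {m : ℕ} (y : ComposableArrows P m)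
    (θ : Fin (m + 1) →o Fin (n + 1)) : ComposableArrows (Orb ρ) m where
  obj k := ⟨ρ (τ.map (homOfLE (Fin.zero_le (θ k)))) (y.obj k)⟩
  map {k l} f := ⟨τ.map (homOfLE (θ.monotone (leOfHom f))), by
    have h : (τ.map (homOfLE (θ.monotone (leOfHom f))) : G) *
        τ.map (homOfLE (Fin.zero_le (θ k))) = τ.map (homOfLE (Fin.zero_le (θ l))) :=
      (τ.map_comp _ _).symm
    change (ρ _ * ρ _) _ ≤ _
    rw [← map_mul, h]
    exact (ρ _).monotone (leOfHom (y.map f))⟩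
  map_id k := Subtype.ext (τ.map_id _)
  map_comp f g := Subtype.ext (τ.map_comp _ _)

lemma map_val_of_proj_eq {n m : ℕ} {τ : ComposableArrows (SingleObj G) n}
    {x : ComposableArrows (Orb ρ) m} {θ : Fin (m + 1) →o Fin (n + 1)}
    (h : x ⋙ proj ρ = θ.monotone.functor ⋙ τ) {k l : Fin (m + 1)} (f : k ⟶ l) :
    (x.map f).1 = τ.map (homOfLE (θ.monotone (leOfHom f))) := by
  have := Functor.congr_hom h f
  have h2 : ∀ (e₁ e₂ : SingleObj.star G = SingleObj.star G)
      (g : SingleObj.star G ⟶ SingleObj.star G), eqToHom e₁ ≫ g ≫ eqToHom e₂ = g := by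
    intros
    simp
  exact this.trans (h2 _ _ _)

/-- The map from the pullback. -/
def twistMap {n : ℕ} (τ : ComposableArrows (SingleObj G) n) :
    nerve P ⊗ Δ[n] ⟶ nerve (Orb ρ) where
  app _ := ↾fun z => twist τ z.1 (SSet.stdSimplex.objEquiv z.2).toOrderHom
  naturality _ _ _ := rfl

lemma isFiber_twistMap {n : ℕ} (τ : ComposableArrows (SingleObj G) n) :
    SSet.IsFiber (S := nerve (SingleObj G)) (nerveMap (proj ρ)) (n := ⦋n⦌) τ (twistMap τ)
      (CartesianMonoidalCategory.snd (nerve P) Δ[n]) where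
  fac y := rfl
  existsUnique {m} x θ hx := by
    let θ' := (SimplexCategory.Hom.toOrderHom θ.unop)
    let x' : ComposableArrows (Orb ρ) m.unop.len := x
    have hx' : ∀ {k l : Fin (m.unop.len + 1)} (f : k ⟶ l),
        (x'.map f).1 = τ.map (homOfLE (θ'.monotone (leOfHom f))) :=
      fun f => map_val_of_proj_eq (θ := θ') hx f
    let γ : Fin (m.unop.len + 1) → G := fun k => τ.map (homOfLE (Fin.zero_le (θ' k)))
    have hγ : ∀ {k l} (f : k ⟶ l), (x'.map f).1 * γ k = γ l := fun {k l} f => by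
      refine Eq.trans ?_ (τ.map_comp (homOfLE (Fin.zero_le (θ' k)))
        (homOfLE (θ'.monotone (leOfHom f)))).symm
      exact congr_arg (· * γ k) (hx' f)
    let y : ComposableArrows P m.unop.len :=
      { obj := fun k => (ρ (γ k)).symm (x'.obj k).pt
        map := fun {k l} f => homOfLE (by
          rw [OrderIso.le_symm_apply, ← hγ f, map_mul]
          change ρ _ (ρ _ ((ρ _).symm _)) ≤ _
          rw [OrderIso.apply_symm_apply]
          exact (x'.map f).2) }
    refine ⟨(y, SSet.stdSimplex.objEquiv.symm θ.unop), ⟨?_, rfl⟩, ?_⟩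
    · refine functor_ext (fun k => (ρ (γ k)).apply_symm_apply _) fun f => (hx' f).symm
    · rintro ⟨z, θ₁⟩ ⟨h₁, h₂⟩
      obtain rfl : θ₁ = SSet.stdSimplex.objEquiv.symm θ.unop := by
        apply SSet.stdSimplex.objEquiv.injective
        exact Quiver.Hom.op_inj h₂
      have : z = y := by
        refine CategoryTheory.Functor.ext (fun k => ?_) fun _ _ _ => Subsingleton.elim _ _
        have := congr_arg Orb.pt (Functor.congr_obj h₁ k)
        exact ((ρ (γ k)).symm_apply_eq.2 this.symm).symm
      rw [this]

/-- If the inclusion of an invariant full subposet is anodyne, then so is the inclusion of the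
corresponding homotopy orbit categories. -/
lemma anodyneExtensions_nerveSubcomplex {U : ObjectProperty P} (hU : ∀ g x, U (ρ g x) ↔ U x)
    (h : SSet.anodyneExtensions (nerveSubcomplex U).ι) :
    SSet.anodyneExtensions (nerveSubcomplex fun x : Orb ρ => U x.pt).ι := by
  refine SSet.anodyneExtensions_of_isFiber (nerveMap (proj ρ)) _ fun n τ =>
    ⟨_, _, _, isFiber_twistMap τ, ?_⟩
  have h₁ := SSet.anodyneExtensions_unionProd_ι' (nerveSubcomplex U) (SSet.boundary n) h
  have h₂ : (nerveSubcomplex fun x : Orb ρ => U x.pt).preimage (twistMap τ) ⊔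
      (SSet.boundary n).preimage (CartesianMonoidalCategory.snd (nerve P) Δ[n]) =
      (nerveSubcomplex U).unionProd (SSet.boundary n) := by
    ext m x
    exact (or_congr (forall_congr' fun k => hU _ _) Iff.rfl).trans (or_comm.trans
      (SSet.Subcomplex.mem_unionProd_iff (S := nerveSubcomplex U) (T := SSet.boundary n) x).symm)
  rw [h₂]
  exact h₁

variable (ρ) in
/-- If a homotopy orbit category has a greatest element then its classifying space is that of the
group. -/
noncomputable def homotopyEquivOfTop [OrderTop P] :
    classifyingSpace (Orb ρ) ≃ₕ classifyingSpace (SingleObj G) :=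
  let j : SingleObj G ⥤ Orb ρ :=
    { obj := fun _ => ⟨⊤⟩
      map := fun g => ⟨g, le_top⟩
      map_id := fun _ => rfl
      map_comp := fun _ _ => rfl }
  classifyingHomotopyEquiv (proj ρ) j
    (classifyingMap_homotopic (F := 𝟭 _) (G := proj ρ ⋙ j)
      { app := fun x => ⟨1, by simp [j]⟩
        naturality := fun _ _ _ => Subtype.ext ((one_mul _).trans (mul_one _).symm) }).symm
    (classifyingMap_homotopic (𝟙 _))

end Orb

end Orb

/-- The set of vertices of a simplex of the nerve of a partial order. -/
def nerveVertices {Q : Type u} [PartialOrder Q] (s : (nerve Q).S) : Set Q :=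
  Set.range (s.simplex : ComposableArrows Q s.dim).obj

lemma nerve_S_eq_of_vertices_eq {Q : Type u} [PartialOrder Q] {s t : (nerve Q).S}
    (hs : s.simplex ∈ (nerve Q).nonDegenerate _) (ht : t.simplex ∈ (nerve Q).nonDegenerate _)
    (h : nerveVertices s = nerveVertices t) : s = t := by
  obtain @⟨n, s⟩ := s
  obtain @⟨m, t⟩ := t
  replace hs : StrictMono (s : ComposableArrows Q n).obj :=
    (PartialOrder.mem_nerve_nonDegenerate_iff_strictMono _).1 hs
  replace ht : StrictMono (t : ComposableArrows Q m).obj :=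
    (PartialOrder.mem_nerve_nonDegenerate_iff_strictMono _).1 ht
  replace h : Set.range (s : ComposableArrows Q n).obj = Set.range (t : ComposableArrows Q m).obj := h
  obtain rfl : n = m := by
    have := congr_arg Set.ncard h
    rw [← Set.image_univ, ← Set.image_univ, Set.ncard_image_of_injective _ hs.injective,
      Set.ncard_image_of_injective _ ht.injective] at this
    simpa using this
  have h' := (hs.range_inj ht).1 h
  congr 1
  exact CategoryTheory.Functor.ext (fun k => congr_fun h' k) fun _ _ _ => Subsingleton.elim _ _

lemma nerveVertices_mono {Q : Type u} [PartialOrder Q] {s t : (nerve Q).N} (h : s ≤ t) :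
    nerveVertices s.toS ⊆ nerveVertices t.toS := by
  obtain ⟨f, _, hf⟩ := SSet.N.le_iff_exists_mono.1 h
  rintro _ ⟨k, rfl⟩
  rw [← hf]
  exact ⟨_, rfl⟩

/-- A poset without chains of three elements, which is a tree, together with a root and a function
attaching to each point the next one on the way to the root. -/
structure RootedTreePoset (P : Type u) [PartialOrder P] where
  /-- the root -/
  root : P
  /-- the parent -/
  parent : P → P
  /-- a measure of the distance to the root -/
  height : P → ℕ
  not_chain : ∀ x y z : P, x < y → ¬ y < z
  parent_lt_or_lt : ∀ x, x ≠ root → parent x < x ∨ x < parent x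
  height_lt : ∀ x, x ≠ root → height (parent x) < height x
  eq_parent : ∀ x y : P, x < y → (x ≠ root ∧ y = parent x) ∨ (y ≠ root ∧ x = parent y)

namespace RootedTreePoset

variable {P : Type u} [PartialOrder P] (T : RootedTreePoset P)

/-- The dimensions of the simplices of the tree, indexed by the points of the tree, the root being
`none`. -/
def pairDim (s : Option {x : P // x ≠ T.root}) : ℕ :=
  match s with
  | none => 0
  | some _ => 1

open Classical in
/-- The simplices in the cone over a rooted tree, which are not simplices of the tree, are matched
in pairs. -/
noncomputable def pairSeq (s : Option {x : P // x ≠ T.root}) :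
    Fin (T.pairDim s + 2) → WithTop P :=
  match s with
  | none => ![(T.root : WithTop P), ⊤]
  | some x => if x.1 < T.parent x then ![(x.1 : WithTop P), T.parent x, ⊤] else
      ![(T.parent x : WithTop P), x.1, ⊤]

open Classical in
/-- The vertex to be removed from a simplex to get the simplex matched with it. -/
noncomputable def pairIndex (s : Option {x : P // x ≠ T.root}) : Fin (T.pairDim s + 2) :=
  match s with
  | none => 0
  | some x => if x.1 < T.parent x then 1 else 0

lemma range_vec₃ {Q : Type u} (a b c : Q) : Set.range ![a, b, c] = {a, b, c} := by
  ext
  simp [eq_comm]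
  tauto

lemma strictMono_vec₃ {Q : Type u} [PartialOrder Q] {a b c : Q} (h : a < b) (h' : b < c) :
    StrictMono ![a, b, c] := by
  rw [Fin.strictMono_iff_lt_succ]
  intro i
  fin_cases i
  exacts [h, h']

lemma strictMono_pairSeq (s) : StrictMono (T.pairSeq s) := by
  rcases s with _ | x
  · change StrictMono ![(T.root : WithTop P), ⊤]
    rw [Fin.strictMono_iff_lt_succ]
    intro i
    fin_cases i
    exact WithTop.coe_lt_top _
  · by_cases h : x.1 < T.parent x
    · have : T.pairSeq (some x) = ![(x.1 : WithTop P), T.parent x, ⊤] := if_pos h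
      rw [this]
      exact strictMono_vec₃ (WithTop.coe_lt_coe.2 h) (WithTop.coe_lt_top _)
    · have : T.pairSeq (some x) = ![(T.parent x : WithTop P), x.1, ⊤] := if_neg h
      rw [this]
      exact strictMono_vec₃ (WithTop.coe_lt_coe.2 ((T.parent_lt_or_lt _ x.2).resolve_right h))
        (WithTop.coe_lt_top _)

lemma range_pairSeq_none : Set.range (T.pairSeq none) = {(T.root : WithTop P), ⊤} :=
  (Matrix.range_cons_cons_empty _ _ _)

lemma range_pairSeq_some (x) :
    Set.range (T.pairSeq (some x)) = {(x.1 : WithTop P), ↑(T.parent x), ⊤} := by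
  by_cases h : x.1 < T.parent x
  · have : T.pairSeq (some x) = ![(x.1 : WithTop P), T.parent x, ⊤] := if_pos h
    rw [this]
    exact range_vec₃ _ _ _
  · have : T.pairSeq (some x) = ![(T.parent x : WithTop P), x.1, ⊤] := if_neg h
    rw [this]
    exact (range_vec₃ _ _ _).trans (Set.insert_comm _ _ _)

lemma range_pairFace_none :
    Set.range (T.pairSeq none ∘ (T.pairIndex none).succAbove) = {⊤} := by
  ext y
  change (∃ k : Fin 1, ![(T.root : WithTop P), ⊤] (Fin.succAbove 0 k) = y) ↔ _
  simp [eq_comm]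

lemma range_pairFace_some (x) :
    Set.range (T.pairSeq (some x) ∘ (T.pairIndex (some x)).succAbove) = {(x.1 : WithTop P), ⊤} := by
  by_cases h : x.1 < T.parent x
  · have h₁ : T.pairSeq (some x) = ![(x.1 : WithTop P), T.parent x, ⊤] := if_pos h
    have h₂ : T.pairIndex (some x) = (1 : Fin 3) := if_pos h
    rw [h₁, h₂]
    ext y
    change (∃ k : Fin 2, ![(x.1 : WithTop P), T.parent x, ⊤] (Fin.succAbove 1 k) = y) ↔ _
    simp [Fin.exists_fin_two, eq_comm, Fin.succAbove]
  · have h₁ : T.pairSeq (some x) = ![(T.parent x : WithTop P), x.1, ⊤] := if_neg h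
    have h₂ : T.pairIndex (some x) = (0 : Fin 3) := if_neg h
    rw [h₁, h₂]
    ext y
    change (∃ k : Fin 2, ![(T.parent x : WithTop P), x.1, ⊤] (Fin.succAbove 0 k) = y) ↔ _
    simp [Fin.exists_fin_two, eq_comm, Fin.succAbove]

/-- The simplex attached to an increasing sequence. -/
def simplexOf {Q : Type u} [PartialOrder Q] {n : ℕ} (f : Fin (n + 1) → Q) (hf : StrictMono f) :
    (nerve Q) _⦋n⦌ :=
  hf.monotone.functor

lemma not_isRoot_parent {x y : P} (hx : x ≠ T.root) (hy : y ≠ T.root) (h : y = T.parent x) :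
    x ≠ T.parent y := by
  rintro h'
  have h₁ := T.height_lt x hx
  have h₂ := T.height_lt y hy
  rw [← h] at h₁
  rw [← h'] at h₂
  exact lt_asymm h₁ h₂

lemma parent_ne (x : P) (hx : x ≠ T.root) : T.parent x ≠ x := fun h => by
  have := T.height_lt x hx
  rw [h] at this
  exact lt_irrefl _ this

lemma range_pairSeq_injective {s t} (h : Set.range (T.pairSeq s) = Set.range (T.pairSeq t)) :
    s = t := by
  rcases s with _ | x <;> rcases t with _ | y
  · rfl
  · rw [range_pairSeq_none, range_pairSeq_some] at h
    have h₁ : (y.1 : WithTop P) ∈ ({(T.root : WithTop P), ⊤} : Set (WithTop P)) := by rw [h]; simp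
    exact absurd (by simpa using h₁) y.2
  · rw [range_pairSeq_none, range_pairSeq_some] at h
    have h₁ : (x.1 : WithTop P) ∈ ({(T.root : WithTop P), ⊤} : Set (WithTop P)) := by rw [← h]; simp
    exact absurd (by simpa using h₁) x.2
  · rw [range_pairSeq_some, range_pairSeq_some] at h
    have h₁ : (x.1 : WithTop P) ∈ ({(y.1 : WithTop P), ↑(T.parent y), ⊤} : Set (WithTop P)) := by
      rw [← h]
      simp
    have h₂ : (y.1 : WithTop P) ∈ ({(x.1 : WithTop P), ↑(T.parent x), ⊤} : Set (WithTop P)) := by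
      rw [h]
      simp
    have h₁ : x.1 = y.1 ∨ x.1 = T.parent y := by simpa using h₁
    have h₂ : y.1 = x.1 ∨ y.1 = T.parent x := by simpa using h₂
    rcases h₁ with h₁ | h₁
    · rw [Subtype.ext h₁]
    · rcases h₂ with h₂ | h₂
      · rw [Subtype.ext h₂]
      · exact absurd h₁ (T.not_isRoot_parent x.2 y.2 h₂)

lemma range_pairFace_injective {s t}
    (h : Set.range (T.pairSeq s ∘ (T.pairIndex s).succAbove) =
      Set.range (T.pairSeq t ∘ (T.pairIndex t).succAbove)) : s = t := by
  rcases s with _ | x <;> rcases t with _ | y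
  · rfl
  · rw [range_pairFace_none, range_pairFace_some] at h
    have h₁ : (y.1 : WithTop P) ∈ ({⊤} : Set (WithTop P)) := by rw [h]; simp
    simp at h₁
  · rw [range_pairFace_none, range_pairFace_some] at h
    have h₁ : (x.1 : WithTop P) ∈ ({⊤} : Set (WithTop P)) := by rw [← h]; simp
    simp at h₁
  · rw [range_pairFace_some, range_pairFace_some] at h
    have h₁ : (x.1 : WithTop P) ∈ ({(y.1 : WithTop P), ⊤} : Set (WithTop P)) := by rw [← h]; simp
    have h₁ : x.1 = y.1 := by simpa using h₁
    rw [Subtype.ext h₁]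

lemma range_pairSeq_ne_pairFace (s t) : Set.range (T.pairSeq s) ≠
    Set.range (T.pairSeq t ∘ (T.pairIndex t).succAbove) := by
  intro h
  rcases s with _ | x <;> rcases t with _ | y
  · rw [range_pairFace_none, range_pairSeq_none] at h
    have h₁ : (T.root : WithTop P) ∈ ({⊤} : Set (WithTop P)) := by rw [← h]; simp
    simp at h₁
  · rw [range_pairFace_some, range_pairSeq_none] at h
    have h₁ : (y.1 : WithTop P) ∈ ({(T.root : WithTop P), ⊤} : Set (WithTop P)) := by rw [h]; simp
    exact absurd (by simpa using h₁) y.2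
  · rw [range_pairFace_none, range_pairSeq_some] at h
    have h₁ : (x.1 : WithTop P) ∈ ({⊤} : Set (WithTop P)) := by rw [← h]; simp
    simp at h₁
  · rw [range_pairFace_some, range_pairSeq_some] at h
    have h₁ : (x.1 : WithTop P) ∈ ({(y.1 : WithTop P), ⊤} : Set (WithTop P)) := by rw [← h]; simp
    have h₂ : (T.parent x : WithTop P) ∈ ({(y.1 : WithTop P), ⊤} : Set (WithTop P)) := by
      rw [← h]
      simp
    have h₁ : x.1 = y.1 := by simpa using h₁
    have h₂ : T.parent x = y.1 := by simpa using h₂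
    exact T.parent_ne _ x.2 (h₂.trans h₁.symm)

/-- Every chain in the cone which contains the cone point is one of those matched. -/
lemma exists_range_eq {n : ℕ} {f : Fin (n + 1) → WithTop P} (hf : StrictMono f)
    (h : ∃ k, f k = ⊤) : ∃ s, Set.range f = Set.range (T.pairSeq s) ∨
      Set.range f = Set.range (T.pairSeq s ∘ (T.pairIndex s).succAbove) := by
  have hlast : f (Fin.last n) = ⊤ := by
    obtain ⟨k, hk⟩ := h
    exact top_le_iff.1 (hk ▸ hf.monotone (Fin.le_last k))
  have hne : ∀ k : Fin n, ∃ x : P, f k.castSucc = x := fun k => by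
    obtain ⟨x, hx⟩ := WithTop.ne_top_iff_exists.1
      (ne_top_of_lt (hf (Fin.castSucc_lt_last k)))
    exact ⟨x, hx.symm⟩
  choose g hg using hne
  have hgm : StrictMono g := fun k l h => by
    have := hf (Fin.castSucc_lt_castSucc_iff.2 h)
    rw [hg, hg] at this
    exact WithTop.coe_lt_coe.1 this
  have hrange : Set.range f = insert ⊤ ((↑) '' Set.range g) := by
    ext y
    constructor
    · rintro ⟨k, rfl⟩
      induction k using Fin.lastCases with
      | last => exact Or.inl hlast
      | cast k => exact Or.inr ⟨_, ⟨k, rfl⟩, (hg k).symm⟩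
    · rintro (rfl | ⟨_, ⟨k, rfl⟩, rfl⟩)
      exacts [⟨_, hlast⟩, ⟨_, hg k⟩]
  rw [hrange]
  match n, g, hgm with
  | 0, g, hgm =>
    refine ⟨none, Or.inr ?_⟩
    rw [range_pairFace_none]
    simp
  | 1, g, hgm =>
    have hr : Set.range g = {g 0} := by
      ext
      simp [eq_comm]
    by_cases h₀ : g 0 = T.root
    · refine ⟨none, Or.inl ?_⟩
      rw [range_pairSeq_none, hr, h₀, Set.image_singleton, Set.pair_comm]
    · refine ⟨some ⟨_, h₀⟩, Or.inr ?_⟩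
      rw [range_pairFace_some, hr, Set.image_singleton, Set.pair_comm]
  | 2, g, hgm =>
    have hr : Set.range g = {g 0, g 1} := by
      ext
      simp [eq_comm, Fin.exists_fin_two]
    rcases T.eq_parent (g 0) (g 1) (hgm (by simp)) with ⟨h₁, h₂⟩ | ⟨h₁, h₂⟩
    · refine ⟨some ⟨_, h₁⟩, Or.inl ?_⟩
      rw [range_pairSeq_some, hr, Set.image_pair, h₂]
      grind
    · refine ⟨some ⟨_, h₁⟩, Or.inl ?_⟩
      rw [range_pairSeq_some, hr, Set.image_pair, h₂]
      grind
  | n + 3, g, hgm =>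
    exact absurd (hgm (show (⟨1, by omega⟩ : Fin (n + 3)) < ⟨2, by omega⟩ from Nat.one_lt_two))
      (T.not_chain _ _ _ (hgm (show (⟨0, by omega⟩ : Fin (n + 3)) < ⟨1, by omega⟩ from Nat.one_pos)))

lemma top_mem_range_pairFace (s) : ∃ k, (T.pairSeq s ∘ (T.pairIndex s).succAbove) k = ⊤ := by
  change ⊤ ∈ Set.range _
  rcases s with _ | x
  · simp [range_pairFace_none]
  · simp [range_pairFace_some]

/-- The simplices in the cone over a rooted tree which are not simplices of the tree, matched
in pairs. -/
noncomputable def pairingCore :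
    (nerveSubcomplex fun x : WithTop P => x ≠ ⊤).PairingCore where
  ι := Option {x : P // x ≠ T.root}
  dim s := T.pairDim s
  simplex s := simplexOf (T.pairSeq s) (T.strictMono_pairSeq s)
  index s := T.pairIndex s
  nonDegenerate₁ s := by
    rw [PartialOrder.mem_nerve_nonDegenerate_iff_strictMono]
    exact T.strictMono_pairSeq s
  nonDegenerate₂ s := by
    rw [PartialOrder.mem_nerve_nonDegenerate_iff_strictMono]
    exact (T.strictMono_pairSeq s).comp (Fin.strictMono_succAbove _)
  notMem₁ s h := by
    obtain ⟨k, hk⟩ := T.top_mem_range_pairFace s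
    exact h _ hk
  notMem₂ s h := by
    obtain ⟨k, hk⟩ := T.top_mem_range_pairFace s
    exact h k hk
  injective_type₁' h := T.range_pairSeq_injective (congr_arg nerveVertices h)
  injective_type₂' h := T.range_pairFace_injective (congr_arg nerveVertices h)
  type₁_ne_type₂' s t h := T.range_pairSeq_ne_pairFace s t (congr_arg nerveVertices h)
  surjective' x := by
    have hx : StrictMono (x.simplex : ComposableArrows (WithTop P) x.dim).obj :=
      (PartialOrder.mem_nerve_nonDegenerate_iff_strictMono _).1 x.nonDegenerate
    have hx' : ∃ k, (x.simplex : ComposableArrows (WithTop P) x.dim).obj k = ⊤ := by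
      by_contra! h
      exact x.notMem h
    obtain ⟨s, h | h⟩ := T.exists_range_eq hx hx'
    · refine ⟨s, Or.inl (nerve_S_eq_of_vertices_eq x.nonDegenerate ?_ h)⟩
      rw [PartialOrder.mem_nerve_nonDegenerate_iff_strictMono]
      exact T.strictMono_pairSeq s
    · refine ⟨s, Or.inr (nerve_S_eq_of_vertices_eq x.nonDegenerate ?_ h)⟩
      rw [PartialOrder.mem_nerve_nonDegenerate_iff_strictMono]
      exact (T.strictMono_pairSeq s).comp (Fin.strictMono_succAbove _)

/-- The height decreases in the order in which the simplices are attached. -/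
noncomputable def rankFunction : T.pairingCore.RankFunction ℕ where
  rank s := (s : Option {x : P // x ≠ T.root}).elim 0 fun x => T.height x + 1
  lt {s t} h := by
    obtain ⟨hne, hlt⟩ := h
    have hsub : Set.range (T.pairSeq s ∘ (T.pairIndex s).succAbove) ⊆ Set.range (T.pairSeq t) :=
      nerveVertices_mono hlt.le
    rcases (s : Option {x : P // x ≠ T.root}) with _ | x <;>
      rcases (t : Option {x : P // x ≠ T.root}) with _ | y
    · exact absurd rfl hne
    · simp
    · rw [range_pairFace_some, range_pairSeq_none] at hsub
      have := hsub (Set.mem_insert _ _)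
      exact absurd (by simpa using this) x.2
    · rw [range_pairFace_some, range_pairSeq_some] at hsub
      have := hsub (Set.mem_insert _ _)
      have h : x.1 = y.1 ∨ x.1 = T.parent y := by simpa using this
      rcases h with h | h
      · exact absurd (congr_arg some (Subtype.ext h)) hne
      · have := T.height_lt _ y.2
        simpa [h] using this

/-- The inclusion of a tree into the cone over it is anodyne. -/
theorem anodyneExtensions_ι (T : RootedTreePoset P) :
    SSet.anodyneExtensions (nerveSubcomplex fun x : WithTop P => x ≠ ⊤).ι := by
  have := T.rankFunction.isRegular
  exact T.pairingCore.pairing.anodyneExtensions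

end RootedTreePoset

lemma nonempty_homotopyEquiv_of_anodyneExtensions_nerveSubcomplex {C : Type u} [Category.{u} C]
    {U : ObjectProperty C} (hU : SSet.anodyneExtensions (nerveSubcomplex U).ι) :
    Nonempty (classifyingSpace U.FullSubcategory ≃ₕ classifyingSpace C) := by
  obtain ⟨h⟩ := nonempty_homeomorph_nerveSubcomplex U
  obtain ⟨h'⟩ := SSet.nonempty_homotopyEquiv_of_anodyne hU
  exact ⟨h.toHomotopyEquiv.trans h'⟩

section WithTop

variable {P : Type} [PartialOrder P]

/-- The inclusion of a poset into the poset with a greatest element adjoined. -/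
def toWithTop (P : Type) [PartialOrder P] :
    P ⥤ (ObjectProperty.FullSubcategory fun x : WithTop P => x ≠ ⊤) :=
  ObjectProperty.lift _ (Monotone.functor (f := ((↑) : P → WithTop P)) fun _ _ h =>
    WithTop.coe_le_coe.2 h) fun _ => WithTop.coe_ne_top

instance : (toWithTop P).Faithful where
  map_injective _ := Subsingleton.elim _ _

instance : (toWithTop P).Full where
  map_surjective f := ⟨homOfLE (WithTop.coe_le_coe.1 (leOfHom f.hom)),
    ObjectProperty.hom_ext _ (Subsingleton.elim _ _)⟩

instance : (toWithTop P).EssSurj where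
  mem_essImage := fun ⟨x, hx⟩ => by
    lift x to P using hx
    exact ⟨x, ⟨Iso.refl _⟩⟩

instance : (toWithTop P).IsEquivalence where

theorem RootedTreePoset.contractibleSpace (T : RootedTreePoset P) :
    ContractibleSpace (classifyingSpace P) := by
  obtain ⟨h⟩ := nonempty_homotopyEquiv_of_anodyneExtensions_nerveSubcomplex T.anodyneExtensions_ι
  have : ContractibleSpace (classifyingSpace (WithTop P)) :=
    contractibleSpace_classifyingSpace_of_isTerminal (Limits.isTerminalTop (α := WithTop P))
  exact ((toWithTop P).asEquivalence.classifyingHomotopyEquiv.trans h).contractibleSpace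

namespace Orb

variable {G : Type} [Group G]

/-- The action of a group on a poset to which a greatest element has been adjoined. -/
def withTop (ρ : G →* (P ≃o P)) : G →* (WithTop P ≃o WithTop P) where
  toFun g := (ρ g).withTopCongr
  map_one' := by
    ext x
    cases x <;> simp
  map_mul' g h := by
    ext x
    cases x <;> simp

variable (ρ : G →* (P ≃o P))

lemma withTop_ne_top_iff (g : G) (x : WithTop P) : withTop ρ g x ≠ ⊤ ↔ x ≠ ⊤ := by
  simp

/-- The inclusion into the homotopy orbit category of the poset to which a greatest element has
been adjoined. -/
def toWithTop : Orb ρ ⥤ (ObjectProperty.FullSubcategory fun x : Orb (withTop ρ) => x.pt ≠ ⊤) :=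
  ObjectProperty.lift _
    { obj := fun x => ⟨x.pt⟩
      map := fun f => ⟨f.1, WithTop.coe_le_coe.2 f.2⟩
      map_id := fun _ => rfl
      map_comp := fun _ _ => rfl } fun _ => WithTop.coe_ne_top

instance : (toWithTop ρ).Faithful where
  map_injective h := Subtype.ext (congr_arg (fun f => Subtype.val (InducedCategory.Hom.hom f)) h)

instance : (toWithTop ρ).Full where
  map_surjective f := ⟨⟨f.hom.1, WithTop.coe_le_coe.1 f.hom.2⟩, rfl⟩

instance : (toWithTop ρ).EssSurj where
  mem_essImage := fun ⟨⟨x⟩, hx⟩ => by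
    lift x to P using hx
    exact ⟨⟨x⟩, ⟨Iso.refl _⟩⟩

instance : (toWithTop ρ).IsEquivalence where

/-- The homotopy orbit category of a group acting on a tree has the classifying space of the
group. -/
theorem nonempty_homotopyEquiv (T : RootedTreePoset P) :
    Nonempty (classifyingSpace (Orb ρ) ≃ₕ classifyingSpace (SingleObj G)) := by
  obtain ⟨h⟩ := nonempty_homotopyEquiv_of_anodyneExtensions_nerveSubcomplex
    (anodyneExtensions_nerveSubcomplex (withTop_ne_top_iff ρ) T.anodyneExtensions_ι)
  exact ⟨(toWithTop ρ).asEquivalence.classifyingHomotopyEquiv.trans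
    (h.trans (homotopyEquivOfTop (withTop ρ)))⟩

end Orb

end WithTop

namespace Farey

/-- The determinant of two vectors in the plane. -/
def det (v w : Fin 2 → ℤ) : ℤ := v 0 * w 1 - v 1 * w 0

/-- The scalar product of two vectors in the plane. -/
def dot (v w : Fin 2 → ℤ) : ℤ := v 0 * w 0 + v 1 * w 1

/-- Two vectors form a basis of the lattice. -/
def Unimodular (v w : Fin 2 → ℤ) : Prop := det v w = 1 ∨ det v w = -1

lemma det_add_left (u v w) : det (u + v) w = det u w + det v w := by
  simp only [det, Pi.add_apply]
  ring

lemma det_neg_left (v w) : det (-v) w = -det v w := by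
  simp only [det, Pi.neg_apply]
  ring

lemma det_neg_right (v w) : det v (-w) = -det v w := by
  simp only [det, Pi.neg_apply]
  ring

lemma det_add_right (u v w) : det u (v + w) = det u v + det u w := by
  simp only [det, Pi.add_apply]
  ring

lemma det_swap (v w) : det w v = -det v w := by
  simp only [det]
  ring

lemma det_self (v) : det v v = 0 := by
  simp only [det]
  ring

lemma det_zero_left (v) : det 0 v = 0 := by simp [det]

lemma det_zero_right (v) : det v 0 = 0 := by simp [det]

lemma det_smul_left (a : ℤ) (v w) : det (a • v) w = a * det v w := by
  simp only [det, Pi.smul_apply, smul_eq_mul]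
  ring

lemma det_smul_right (a : ℤ) (v w) : det v (a • w) = a * det v w := by
  simp only [det, Pi.smul_apply, smul_eq_mul]
  ring

lemma dot_add_left (u v w) : dot (u + v) w = dot u w + dot v w := by
  simp only [dot, Pi.add_apply]
  ring

lemma dot_neg_left (v w) : dot (-v) w = -dot v w := by
  simp only [dot, Pi.neg_apply]
  ring

lemma dot_neg_right (v w) : dot v (-w) = -dot v w := by
  simp only [dot, Pi.neg_apply]
  ring

lemma dot_add_right (u v w) : dot u (v + w) = dot u v + dot u w := by
  simp only [dot, Pi.add_apply]
  ring

lemma dot_comm (v w) : dot v w = dot w v := by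
  simp only [dot]
  ring

lemma dot_self_nonneg (v) : 0 ≤ dot v v := by
  exact add_nonneg (mul_self_nonneg _) (mul_self_nonneg _)

lemma dot_self_pos {v} (hv : v ≠ 0) : 0 < dot v v := by
  refine lt_of_le_of_ne (dot_self_nonneg v) fun h => hv ?_
  simp only [dot] at h
  have h0 : v 0 = 0 := by nlinarith [mul_self_nonneg (v 0), mul_self_nonneg (v 1)]
  have h1 : v 1 = 0 := by nlinarith [mul_self_nonneg (v 0), mul_self_nonneg (v 1)]
  ext i
  fin_cases i
  exacts [h0, h1]

lemma lagrange (v w) : dot v v * dot w w = det v w ^ 2 + dot v w ^ 2 := by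
  simp only [dot, det]
  ring

lemma cramer (v w z) : det v w • z = det z w • v + det v z • w := by
  ext i
  fin_cases i <;> simp [det] <;> ring

lemma Unimodular.neg_right {v w} (h : Unimodular v w) : Unimodular v (-w) := by
  rw [Unimodular, det_neg_right]
  rcases h with h | h <;> simp [h]

lemma Unimodular.symm {v w} (h : Unimodular v w) : Unimodular w v := by
  rw [Unimodular, det_swap]
  rcases h with h | h <;> simp [h]

lemma Unimodular.add_right {v w} (h : Unimodular v w) : Unimodular v (v + w) := by
  rwa [Unimodular, det_add_right, det_self, zero_add]

lemma Unimodular.det_sq {v w} (h : Unimodular v w) : det v w ^ 2 = 1 := by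
  rcases h with h | h <;> simp [h]

lemma Unimodular.det_mul_self {v w} (h : Unimodular v w) : det v w * det v w = 1 := by
  rcases h with h | h <;> simp [h]

lemma Unimodular.left_ne_zero {v w} (h : Unimodular v w) : v ≠ 0 := by
  rintro rfl
  simp [Unimodular, det_zero_left] at h

lemma Unimodular.right_ne_zero {v w} (h : Unimodular v w) : w ≠ 0 := h.symm.left_ne_zero

lemma Unimodular.exists_eq {v w} (h : Unimodular v w) (z) :
    z = (det v w * det z w) • v + (det v w * det v z) • w := by
  have := congr_arg (det v w • ·) (cramer v w z)
  simpa only [smul_smul, h.det_mul_self, one_smul, smul_add] using this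

lemma Unimodular.closure_eq_top {v w} (h : Unimodular v w) {E : Set (Fin 2 → ℤ)} (hv : v ∈ E)
    (hw : w ∈ E) : AddSubgroup.closure E = ⊤ := by
  refine eq_top_iff.2 fun z _ => ?_
  rw [h.exists_eq z]
  exact add_mem (AddSubgroup.zsmul_mem _ (AddSubgroup.subset_closure hv) _)
    (AddSubgroup.zsmul_mem _ (AddSubgroup.subset_closure hw) _)

lemma unimodular_of_closure_eq_top {v w} (h : AddSubgroup.closure {v, w} = ⊤) :
    Unimodular v w := by
  have h₁ : (![1, 0] : Fin 2 → ℤ) ∈ AddSubgroup.closure {v, w} := h ▸ AddSubgroup.mem_top _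
  have h₂ : (![0, 1] : Fin 2 → ℤ) ∈ AddSubgroup.closure {v, w} := h ▸ AddSubgroup.mem_top _
  obtain ⟨a, b, hab⟩ := AddSubgroup.mem_closure_pair.1 h₁
  obtain ⟨c, d, hcd⟩ := AddSubgroup.mem_closure_pair.1 h₂
  have h₃ : det (a • v + b • w) (c • v + d • w) = 1 := by
    rw [hab, hcd]
    simp [det]
  have h₄ : (a * d - b * c) * det v w = 1 := by
    rw [← h₃]
    simp only [det, Pi.add_apply, Pi.smul_apply, smul_eq_mul]
    ring
  exact Int.eq_one_or_neg_one_of_mul_eq_one' h₄ |>.imp And.right And.right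

lemma linearIndependent_iff_det_ne_zero (b : Fin 2 → (Fin 2 → ℤ)) :
    LinearIndependent ℤ b ↔ det (b 0) (b 1) ≠ 0 := by
  have h := LinearIndependent.pair_iff (R := ℤ) (x := b 0) (y := b 1)
  have hb : b = ![b 0, b 1] := by
    ext i
    fin_cases i <;> rfl
  rw [hb, h]
  constructor
  · intro h hd
    have h₁ : det (b 0) (b 1) = 0 := hd
    have h₂ : ∀ z, (det z (b 1)) • b 0 + det (b 0) z • b 1 = 0 := fun z => by
      rw [← cramer, h₁, zero_smul]
    have h₃ := h _ _ (h₂ ![1, 0])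
    have h₄ := h _ _ (h₂ ![0, 1])
    simp [det] at h₃ h₄
    have h₅ : b 0 = 0 := by
      ext i
      fin_cases i
      exacts [h₄.2, h₃.2]
    have := h 1 0 (by simp [h₅])
    simp at this
  · intro h s t hst
    have h₁ := congr_arg (det · (b 1)) hst
    have h₂ := congr_arg (det (b 0)) hst
    simp only [det_add_left, det_add_right, det_smul_left, det_smul_right, det_self, det_zero_left,
      det_zero_right, mul_zero, add_zero, zero_add, mul_eq_zero] at h₁ h₂
    exact ⟨h₁.resolve_right h, h₂.resolve_right h⟩

/-- The sets of vectors in the plane belonging to `IR 2`, in terms of determinants. -/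
structure IsUnimodularSystem (E : Set (Fin 2 → ℤ)) : Prop where
  zero_notMem : 0 ∉ E
  neg_mem_iff : ∀ x, x ∈ E ↔ -x ∈ E
  unimodular : ∀ v ∈ E, ∀ w ∈ E, det v w = 0 ∨ Unimodular v w
  exists_unimodular : ∃ v ∈ E, ∃ w ∈ E, Unimodular v w

lemma isUnimodularSystem_iff (E : Set (Fin 2 → ℤ)) : IsUnimodularSystem E ↔
    (0 ∉ E ∧ (∀ x, x ∈ E ↔ -x ∈ E) ∧ AddSubgroup.closure E = ⊤ ∧
    ∀ b : Fin 2 → (Fin 2 → ℤ), (∀ i, b i ∈ E) → LinearIndependent ℤ b →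
      AddSubgroup.closure (Set.range b) = ⊤) := by
  constructor
  · intro h
    obtain ⟨v, hv, w, hw, hvw⟩ := h.exists_unimodular
    refine ⟨h.zero_notMem, h.neg_mem_iff, hvw.closure_eq_top hv hw, fun b hb hb' => ?_⟩
    rw [linearIndependent_iff_det_ne_zero] at hb'
    exact ((h.unimodular _ (hb 0) _ (hb 1)).resolve_left hb').closure_eq_top ⟨0, rfl⟩ ⟨1, rfl⟩
  · rintro ⟨h₁, h₂, h₃, h₄⟩
    have h₅ : ∀ v ∈ E, ∀ w ∈ E, det v w = 0 ∨ Unimodular v w := fun v hv w hw => by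
      refine or_iff_not_imp_left.2 fun h => unimodular_of_closure_eq_top ?_
      have := h₄ ![v, w] (by simp [Fin.forall_fin_two, hv, hw])
        ((linearIndependent_iff_det_ne_zero _).2 h)
      rwa [Matrix.range_cons_cons_empty] at this
    refine ⟨h₁, h₂, h₅, ?_⟩
    by_contra! h₆
    have h₇ : ∀ v ∈ E, ∀ w ∈ E, det v w = 0 := fun v hv w hw =>
      (h₅ v hv w hw).resolve_right (h₆ v hv w hw)
    have h₈ : ∀ z, ∀ w ∈ E, det z w = 0 := fun z w hw => by
      have hz : z ∈ AddSubgroup.closure E := h₃ ▸ AddSubgroup.mem_top _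
      induction hz using AddSubgroup.closure_induction with
      | mem v hv => exact h₇ v hv w hw
      | zero => exact det_zero_left _
      | add x y _ _ hx hy => rw [det_add_left, hx, hy, add_zero]
      | neg x _ hx => rw [det_neg_left, hx, neg_zero]
    have h₉ : ∀ z w, det z w = 0 := fun z w => by
      have hw : w ∈ AddSubgroup.closure E := h₃ ▸ AddSubgroup.mem_top _
      induction hw using AddSubgroup.closure_induction with
      | mem v hv => exact h₈ z v hv
      | zero => exact det_zero_right _
      | add x y _ _ hx hy => rw [det_add_right, hx, hy, add_zero]
      | neg x _ hx => rw [det_neg_right, hx, neg_zero]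
    have := h₉ ![1, 0] ![0, 1]
    simp [det] at this

lemma isUnimodularSystem (E : IR 2) : IsUnimodularSystem E.1 :=
  (isUnimodularSystem_iff _).2 E.2

/-- The edge of the Farey graph. -/
def edge (v w : Fin 2 → ℤ) : Set (Fin 2 → ℤ) := {v, -v, w, -w}

/-- The triangle of the Farey graph. -/
def triangle (v w : Fin 2 → ℤ) : Set (Fin 2 → ℤ) := {v, -v, w, -w, v + w, -(v + w)}

lemma mem_edge {v w z} : z ∈ edge v w ↔ z = v ∨ z = -v ∨ z = w ∨ z = -w := Iff.rfl

lemma mem_triangle {v w z} : z ∈ triangle v w ↔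
    z = v ∨ z = -v ∨ z = w ∨ z = -w ∨ z = v + w ∨ z = -(v + w) := Iff.rfl

lemma edge_neg_right (v w) : edge v (-w) = edge v w := by
  ext z
  simp only [mem_edge, neg_neg]
  tauto

lemma triangle_swap (v w) : triangle w v = triangle v w := by
  ext z
  simp only [mem_triangle, add_comm w v]
  tauto

lemma triangle_rotate (v w) : triangle v (-(v + w)) = triangle v w := by
  ext z
  have : v + -(v + w) = -w := by abel
  simp only [mem_triangle, this, neg_neg]
  tauto

lemma edge_subset_triangle (v w) : edge v w ⊆ triangle v w := by
  intro z
  simp only [mem_triangle, mem_edge]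
  tauto

lemma isUnimodularSystem_triangle {v w} (h : Unimodular v w) :
    IsUnimodularSystem (triangle v w) where
  zero_notMem := by
    have h₁ := h.left_ne_zero
    have h₂ := h.right_ne_zero
    have h₃ := h.add_right.right_ne_zero
    rw [mem_triangle]
    rintro (h | h | h | h | h | h)
    exacts [h₁ h.symm, h₁ (neg_eq_zero.1 h.symm), h₂ h.symm, h₂ (neg_eq_zero.1 h.symm), h₃ h.symm,
      h₃ (neg_eq_zero.1 h.symm)]
  neg_mem_iff x := by
    simp only [mem_triangle, neg_eq_iff_eq_neg, neg_neg]
    tauto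
  unimodular x hx y hy := by
    unfold Unimodular at *
    have := det_swap v w
    rw [mem_triangle] at hx hy
    rcases hx with rfl | rfl | rfl | rfl | rfl | rfl <;>
      rcases hy with rfl | rfl | rfl | rfl | rfl | rfl <;>
      (try simp only [det_neg_left, det_neg_right, det_add_left, det_add_right, det_self]) <;>
      first | omega | simp
  exists_unimodular := ⟨v, by simp [mem_triangle], w, by simp [mem_triangle], h⟩

lemma isUnimodularSystem_edge {v w} (h : Unimodular v w) : IsUnimodularSystem (edge v w) where
  zero_notMem h' := (isUnimodularSystem_triangle h).zero_notMem (edge_subset_triangle _ _ h')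
  neg_mem_iff x := by
    simp only [mem_edge, neg_eq_iff_eq_neg, neg_neg]
    tauto
  unimodular x hx y hy := (isUnimodularSystem_triangle h).unimodular x (edge_subset_triangle _ _ hx)
    y (edge_subset_triangle _ _ hy)
  exists_unimodular := ⟨v, by simp [mem_edge], w, by simp [mem_edge], h⟩

namespace IsUnimodularSystem

variable {E : Set (Fin 2 → ℤ)} (hE : IsUnimodularSystem E)

lemma edge_subset (hE : IsUnimodularSystem E) {v w} (hv : v ∈ E) (hw : w ∈ E) : edge v w ⊆ E := by
  rintro z (rfl | rfl | rfl | rfl)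
  exacts [hv, (hE.neg_mem_iff _).1 hv, hw, (hE.neg_mem_iff _).1 hw]

lemma triangle_subset (hE : IsUnimodularSystem E) {v w} (hv : v ∈ E) (hw : w ∈ E)
    (hvw : v + w ∈ E) : triangle v w ⊆ E := by
  rintro z (rfl | rfl | rfl | rfl | rfl | rfl)
  exacts [hv, (hE.neg_mem_iff _).1 hv, hw, (hE.neg_mem_iff _).1 hw, hvw,
    (hE.neg_mem_iff _).1 hvw]

lemma mem_cases (hE : IsUnimodularSystem E) {v w z} (h : Unimodular v w) (hv : v ∈ E) (hw : w ∈ E)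
    (hz : z ∈ E) : z ∈ triangle v w ∨ z ∈ triangle v (-w) := by
  have h₀ : z ≠ 0 := fun h => hE.zero_notMem (h ▸ hz)
  have h₁ : ∃ a b : ℤ, (a = 0 ∨ a = 1 ∨ a = -1) ∧ (b = 0 ∨ b = 1 ∨ b = -1) ∧
      z = a • v + b • w := by
    refine ⟨_, _, ?_, ?_, h.exists_eq z⟩
    · have h₂ := hE.unimodular z hz w hw
      unfold Unimodular at *
      rcases h with h | h <;> rcases h₂ with h₂ | h₂ | h₂ <;> rw [h, h₂] <;> simp
    · have h₂ := hE.unimodular v hv z hz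
      unfold Unimodular at *
      rcases h with h | h <;> rcases h₂ with h₂ | h₂ | h₂ <;> rw [h, h₂] <;> simp
  obtain ⟨a, b, ha, hb, rfl⟩ := h₁
  simp only [mem_triangle]
  rcases ha with rfl | rfl | rfl <;> rcases hb with rfl | rfl | rfl <;>
    simp only [zero_smul, one_smul, neg_smul, zero_add, add_zero, neg_add, neg_neg] at h₀ ⊢ <;>
    tauto

/-- A system containing a triangle is the triangle. -/
lemma eq_triangle (hE : IsUnimodularSystem E) {v w} (h : Unimodular v w) (hv : v ∈ E) (hw : w ∈ E)
    (hvw : v + w ∈ E) : E = triangle v w := by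
  refine (hE.triangle_subset hv hw hvw).antisymm' fun z hz => ?_
  refine (hE.mem_cases h hv hw hz).elim id fun h' => ?_
  have h₁ := hE.unimodular _ hvw _ hz
  unfold Unimodular at *
  have := det_swap v w
  simp only [mem_triangle] at h' ⊢
  rcases h' with rfl | rfl | rfl | rfl | rfl | rfl
  any_goals simp
  all_goals
    simp only [det_neg_right, det_add_left, det_add_right, det_self] at h₁
    omega

lemma eq_edge_or_triangle (hE : IsUnimodularSystem E) {v w} (h : Unimodular v w) (hv : v ∈ E)
    (hw : w ∈ E) : E = edge v w ∨ E = triangle v w ∨ E = triangle v (-w) := by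
  by_cases h₁ : v + w ∈ E
  · exact Or.inr (Or.inl (hE.eq_triangle h hv hw h₁))
  · have hw' := (hE.neg_mem_iff _).1 hw
    by_cases h₂ : v + -w ∈ E
    · exact Or.inr (Or.inr (hE.eq_triangle h.neg_right hv hw' h₂))
    · refine Or.inl ((hE.edge_subset hv hw).antisymm' fun z hz => ?_)
      have h₃ := hE.mem_cases h hv hw hz
      have h₄ : z ≠ v + w := fun h => h₁ (h ▸ hz)
      have h₅ : z ≠ -(v + w) := fun h => h₁ (by rwa [hE.neg_mem_iff, ← h])
      have h₆ : z ≠ v + -w := fun h => h₂ (h ▸ hz)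
      have h₇ : z ≠ -(v + -w) := fun h => h₂ (by rwa [hE.neg_mem_iff, ← h])
      rw [mem_edge]
      rw [mem_triangle, mem_triangle, neg_neg] at h₃
      tauto

end IsUnimodularSystem

/-- A system contains a triangle. -/
def HasTriangle (E : Set (Fin 2 → ℤ)) : Prop := ∃ y ∈ E, ∃ z ∈ E, y + z ∈ E

lemma hasTriangle_triangle (v w) : HasTriangle (triangle v w) :=
  ⟨v, by simp [mem_triangle], w, by simp [mem_triangle], by simp [mem_triangle]⟩

lemma odd_det_of_mem_edge {v w z} (h : Unimodular v w) (hz : z ∈ edge v w) :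
    Odd (det v z + det w z) := by
  have h₀ := det_swap v w
  have h₁ : Odd (det v w) := by
    rcases h with h | h <;> rw [h] <;> decide
  rcases hz with rfl | rfl | rfl | rfl <;>
    simp [det_neg_right, det_self, h₀, h₁]

lemma not_hasTriangle_edge {v w} (h : Unimodular v w) : ¬ HasTriangle (edge v w) := by
  rintro ⟨y, hy, z, hz, hyz⟩
  have h₁ := odd_det_of_mem_edge h hy
  have h₂ := odd_det_of_mem_edge h hz
  have h₃ := odd_det_of_mem_edge h hyz
  rw [det_add_right, det_add_right, add_add_add_comm] at h₃
  exact (Int.not_odd_iff_even.2 (h₁.add_odd h₂)) h₃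

lemma IsUnimodularSystem.eq_edge {E : Set (Fin 2 → ℤ)} (hE : IsUnimodularSystem E)
    (hE' : ¬ HasTriangle E) {v w} (h : Unimodular v w) (hv : v ∈ E) (hw : w ∈ E) :
    E = edge v w := by
  rcases hE.eq_edge_or_triangle h hv hw with h | h | h
  · exact h
  · exact absurd (h ▸ hasTriangle_triangle _ _) hE'
  · exact absurd (h ▸ hasTriangle_triangle _ _) hE'

open Classical in
/-- The next system on the way to the system of the vectors of length one. -/
noncomputable def parentSet (E : Set (Fin 2 → ℤ)) : Set (Fin 2 → ℤ) :=
  if HasTriangle E then {z | z ∈ E ∧ ∃ y ∈ E, dot z z < dot y y} else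
    {x | x ∈ E ∨ ∃ y ∈ E, ∃ z ∈ E, dot y z < 0 ∧ det y z ≠ 0 ∧ x = y + z}

lemma dot_add_self (v w) : dot (v + w) (v + w) = dot v v + dot w w + 2 * dot v w := by
  rw [dot_add_left, dot_add_right, dot_add_right, dot_comm w v]
  ring

lemma dot_neg_self (v) : dot (-v) (-v) = dot v v := by
  rw [dot_neg_left, dot_neg_right, neg_neg]

lemma parentSet_triangle {v w} (h : Unimodular v w) (hvw : 0 ≤ dot v w) :
    parentSet (triangle v w) = edge v w := by
  have h₁ := dot_self_pos h.left_ne_zero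
  have h₂ := dot_self_pos h.right_ne_zero
  have h₃ := dot_add_self v w
  rw [parentSet, if_pos (hasTriangle_triangle _ _)]
  ext z
  constructor
  · rintro ⟨hz, y, hy, hzy⟩
    have h₄ : dot y y ≤ dot (v + w) (v + w) := by
      rcases hy with rfl | rfl | rfl | rfl | rfl | rfl <;> (try rw [dot_neg_self]) <;> omega
    rcases hz with rfl | rfl | rfl | rfl | rfl | rfl
    any_goals simp [mem_edge]
    all_goals
      (try rw [dot_neg_self] at hzy)
      omega
  · intro hz
    refine ⟨edge_subset_triangle _ _ hz, v + w, by simp [mem_triangle], ?_⟩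
    rcases hz with rfl | rfl | rfl | rfl <;> (try rw [dot_neg_self]) <;> omega

lemma parentSet_edge {v w} (h : Unimodular v w) (hvw : dot v w < 0) :
    parentSet (edge v w) = triangle v w := by
  rw [parentSet, if_neg (not_hasTriangle_edge h)]
  have h₀ : det v w ≠ 0 := by
    rcases h with h | h <;> rw [h] <;> decide
  ext x
  constructor
  · rintro (hx | ⟨y, hy, z, hz, h₁, h₂, rfl⟩)
    · exact edge_subset_triangle _ _ hx
    · have h₃ := dot_comm w v
      rcases hy with rfl | rfl | rfl | rfl <;> rcases hz with rfl | rfl | rfl | rfl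
      all_goals
        first
        | exfalso
          simp [det_neg_left, det_neg_right, det_self] at h₂
          done
        | exfalso
          simp only [dot_neg_left, dot_neg_right] at h₁
          omega
        | simp only [mem_triangle, neg_add, add_comm, true_or, or_true]
  · rintro (rfl | rfl | rfl | rfl | rfl | rfl)
    iterate 4 exact Or.inl (by simp [mem_edge])
    · exact Or.inr ⟨v, by simp [mem_edge], w, by simp [mem_edge], hvw, h₀, rfl⟩
    · refine Or.inr ⟨-v, by simp [mem_edge], -w, by simp [mem_edge], ?_, ?_, by abel⟩
      · rwa [dot_neg_left, dot_neg_right, neg_neg]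
      · rwa [det_neg_left, det_neg_right, neg_neg]

open Classical in
/-- The height of a system is measured by the length of its longest vector. -/
noncomputable def heightSet (E : Set (Fin 2 → ℤ)) : ℤ :=
  2 * sSup ((fun z => dot z z) '' E) + if HasTriangle E then 0 else 1

lemma heightSet_edge {v w} (h : Unimodular v w) :
    heightSet (edge v w) = 2 * max (dot v v) (dot w w) + 1 := by
  have : IsGreatest ((fun z => dot z z) '' edge v w) (max (dot v v) (dot w w)) := by
    constructor
    · rcases max_choice (dot v v) (dot w w) with h | h <;> rw [h]
      exacts [⟨v, by simp [mem_edge], rfl⟩, ⟨w, by simp [mem_edge], rfl⟩]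
    · rintro _ ⟨z, (rfl | rfl | rfl | rfl), rfl⟩ <;> simp [dot_neg_self]
  rw [heightSet, if_neg (not_hasTriangle_edge h), this.csSup_eq]

lemma heightSet_triangle_of_nonneg {v w} (h : Unimodular v w) (hvw : 0 ≤ dot v w) :
    heightSet (triangle v w) = 2 * (dot v v + dot w w + 2 * dot v w) := by
  have h₁ := dot_self_pos h.left_ne_zero
  have h₂ := dot_self_pos h.right_ne_zero
  have : IsGreatest ((fun z => dot z z) '' triangle v w) (dot v v + dot w w + 2 * dot v w) := by
    constructor
    · exact ⟨v + w, by simp [mem_triangle], dot_add_self _ _⟩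
    · rintro _ ⟨z, (rfl | rfl | rfl | rfl | rfl | rfl), rfl⟩ <;>
        simp only [dot_neg_self, dot_add_self] <;> omega
  rw [heightSet, if_pos (hasTriangle_triangle _ _), this.csSup_eq, add_zero]

lemma heightSet_triangle_of_neg {v w} (h : Unimodular v w) (hvw : dot v w < 0) :
    heightSet (triangle v w) = 2 * max (dot v v) (dot w w) := by
  have h₁ := dot_self_pos h.left_ne_zero
  have h₂ := dot_self_pos h.right_ne_zero
  have h₃ := lagrange v w
  rw [h.det_sq] at h₃
  have h₄ : dot v v ≤ -dot v w ∨ dot w w ≤ -dot v w := by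
    by_contra! h₅
    nlinarith
  have : IsGreatest ((fun z => dot z z) '' triangle v w) (max (dot v v) (dot w w)) := by
    constructor
    · rcases max_choice (dot v v) (dot w w) with h | h <;> rw [h]
      exacts [⟨v, by simp [mem_triangle], rfl⟩, ⟨w, by simp [mem_triangle], rfl⟩]
    · rintro _ ⟨z, (rfl | rfl | rfl | rfl | rfl | rfl), rfl⟩ <;>
        simp only [dot_neg_self, dot_add_self] <;> omega
  rw [heightSet, if_pos (hasTriangle_triangle _ _), this.csSup_eq, add_zero]

/-- The first basis vector. -/
def e₁ : Fin 2 → ℤ := ![1, 0]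

/-- The second basis vector. -/
def e₂ : Fin 2 → ℤ := ![0, 1]

lemma unimodular_e₁_e₂ : Unimodular e₁ e₂ := Or.inl (by simp [det, e₁, e₂])

lemma mem_edge_e₁_e₂ {v} (h : dot v v = 1) : v ∈ edge e₁ e₂ := by
  simp only [dot] at h
  have h₀ : v 0 ≤ 1 := by nlinarith [mul_self_nonneg (v 0), mul_self_nonneg (v 1)]
  have h₁ : -1 ≤ v 0 := by nlinarith [mul_self_nonneg (v 0), mul_self_nonneg (v 1)]
  have h₂ : v 1 ≤ 1 := by nlinarith [mul_self_nonneg (v 0), mul_self_nonneg (v 1)]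
  have h₃ : -1 ≤ v 1 := by nlinarith [mul_self_nonneg (v 0), mul_self_nonneg (v 1)]
  have hv : v = ![v 0, v 1] := by
    ext i
    fin_cases i <;> rfl
  rw [mem_edge, hv]
  generalize v 0 = a at *
  generalize v 1 = b at *
  interval_cases a <;> interval_cases b <;> simp [e₁, e₂] at h ⊢

lemma edge_eq_root {v w} (h : Unimodular v w) (hvw : dot v w = 0) : edge v w = edge e₁ e₂ := by
  have h₃ := lagrange v w
  rw [h.det_sq, hvw] at h₃
  have h₁ := dot_self_pos h.left_ne_zero
  have h₂ := dot_self_pos h.right_ne_zero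
  have h₄ : dot v v = 1 := by nlinarith
  have h₅ : dot w w = 1 := by nlinarith
  exact ((isUnimodularSystem_edge unimodular_e₁_e₂).eq_edge
    (not_hasTriangle_edge unimodular_e₁_e₂) h (mem_edge_e₁_e₂ h₄) (mem_edge_e₁_e₂ h₅)).symm

lemma dot_eq_zero_of_edge_eq_root {v w} (h : Unimodular v w) (hvw : edge v w = edge e₁ e₂) :
    dot v w = 0 := by
  have h₁ : v ∈ edge e₁ e₂ := by
    rw [← hvw]
    simp [mem_edge]
  have h₂ : w ∈ edge e₁ e₂ := by
    rw [← hvw]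
    simp [mem_edge]
  rcases h₁ with rfl | rfl | rfl | rfl <;> rcases h₂ with rfl | rfl | rfl | rfl <;>
    simp [Unimodular, dot, det, e₁, e₂] at h ⊢

/-- In a triangle there is a pair of vectors which do not make an obtuse angle, and whose sum
belongs to the triangle. -/
lemma exists_triangle_eq {v w} (h : Unimodular v w) : ∃ v' w', Unimodular v' w' ∧ 0 ≤ dot v' w' ∧
    triangle v' w' = triangle v w := by
  rcases le_or_gt 0 (dot v w) with h₁ | h₁
  · exact ⟨v, w, h, h₁, rfl⟩
  rcases le_or_gt 0 (dot v (-(v + w))) with h₂ | h₂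
  · exact ⟨v, -(v + w), h.add_right.neg_right, h₂, triangle_rotate _ _⟩
  rcases le_or_gt 0 (dot w (-(w + v))) with h₃ | h₃
  · exact ⟨w, -(w + v), h.symm.add_right.neg_right, h₃, (triangle_rotate _ _).trans
      (triangle_swap _ _)⟩
  exfalso
  have h₄ := lagrange v w
  rw [h.det_sq] at h₄
  rw [dot_neg_right, dot_add_right] at h₂ h₃
  rw [dot_comm w v] at h₃
  nlinarith

lemma exists_eq (E : IR 2) : ∃ v w, Unimodular v w ∧
    ((E.1 = edge v w ∧ dot v w ≤ 0) ∨ (E.1 = triangle v w ∧ 0 ≤ dot v w)) := by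
  have hE := isUnimodularSystem E
  obtain ⟨v, hv, w, hw, h⟩ := hE.exists_unimodular
  rcases hE.eq_edge_or_triangle h hv hw with h₁ | h₁ | h₁
  · rcases le_total (dot v w) 0 with h₂ | h₂
    · exact ⟨v, w, h, Or.inl ⟨h₁, h₂⟩⟩
    · exact ⟨v, -w, h.neg_right, Or.inl ⟨h₁.trans (edge_neg_right _ _).symm, by
        rw [dot_neg_right]
        omega⟩⟩
  · obtain ⟨v', w', h₂, h₃, h₄⟩ := exists_triangle_eq h
    exact ⟨v', w', h₂, Or.inr ⟨h₁.trans h₄.symm, h₃⟩⟩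
  · obtain ⟨v', w', h₂, h₃, h₄⟩ := exists_triangle_eq h.neg_right
    exact ⟨v', w', h₂, Or.inr ⟨h₁.trans h₄.symm, h₃⟩⟩

/-- An edge as an element of `IR 2`. -/
def edgeIR {v w} (h : Unimodular v w) : IR 2 :=
  ⟨edge v w, (isUnimodularSystem_iff _).1 (isUnimodularSystem_edge h)⟩

/-- A triangle as an element of `IR 2`. -/
def triangleIR {v w} (h : Unimodular v w) : IR 2 :=
  ⟨triangle v w, (isUnimodularSystem_iff _).1 (isUnimodularSystem_triangle h)⟩

lemma edge_ssubset_triangle {v w} (h : Unimodular v w) : edge v w ⊂ triangle v w :=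
  (edge_subset_triangle v w).ssubset_of_ne fun h' =>
    not_hasTriangle_edge h (h' ▸ hasTriangle_triangle v w)

lemma exists_of_lt {E F : IR 2} (hEF : E < F) :
    ∃ v w, Unimodular v w ∧ E.1 = edge v w ∧ F.1 = triangle v w := by
  have hsub : E.1 ⊆ F.1 := hEF.le
  have hne : F.1 ≠ E.1 := fun h => hEF.ne (Subtype.ext h.symm)
  have hE := isUnimodularSystem E
  have hF := isUnimodularSystem F
  obtain ⟨v, hv, w, hw, h⟩ := hE.exists_unimodular
  have h₁ : E.1 = edge v w := by
    refine hE.eq_edge ?_ h hv hw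
    intro h₂
    rcases hE.eq_edge_or_triangle h hv hw with h₁ | h₁ | h₁
    · exact not_hasTriangle_edge h (h₁ ▸ h₂)
    · have h₃ : v + w ∈ E.1 := by simp [h₁, mem_triangle]
      exact hne ((hF.eq_triangle h (hsub hv) (hsub hw) (hsub h₃)).trans h₁.symm)
    · have h₃ : v + -w ∈ E.1 := by simp [h₁, mem_triangle]
      exact hne ((hF.eq_triangle h.neg_right (hsub hv) (hsub ((hE.neg_mem_iff _).1 hw))
        (hsub h₃)).trans h₁.symm)
  rcases hF.eq_edge_or_triangle h (hsub hv) (hsub hw) with h₂ | h₂ | h₂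
  · exact absurd (h₂.trans h₁.symm) hne
  · exact ⟨v, w, h, h₁, h₂⟩
  · exact ⟨v, -w, h.neg_right, h₁.trans (edge_neg_right _ _).symm, h₂⟩

open Classical in
/-- The next system on the way to the system of the vectors of length one. -/
noncomputable def parent (E : IR 2) : IR 2 :=
  if h : ∃ F : IR 2, F.1 = parentSet E.1 then h.choose else E

lemma parent_eq {E F : IR 2} (h : parentSet E.1 = F.1) : parent E = F := by
  have h' : ∃ F : IR 2, F.1 = parentSet E.1 := ⟨F, h.symm⟩
  rw [parent, dif_pos h']
  exact Subtype.ext (h'.choose_spec.trans h)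

/-- The poset `IR 2` is a rooted tree. -/
noncomputable def rootedTreePoset : RootedTreePoset (IR 2) where
  root := edgeIR unimodular_e₁_e₂
  parent := parent
  height E := (heightSet E.1).toNat
  not_chain x y z hxy hyz := by
    obtain ⟨v, w, h, -, h₁⟩ := exists_of_lt hxy
    obtain ⟨v', w', h', h₁', -⟩ := exists_of_lt hyz
    exact not_hasTriangle_edge h' (h₁' ▸ h₁ ▸ hasTriangle_triangle v w)
  parent_lt_or_lt x hx := by
    obtain ⟨v, w, h, ⟨h₁, h₂⟩ | ⟨h₁, h₂⟩⟩ := exists_eq x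
    · rcases h₂.eq_or_lt with h₂ | h₂
      · exact absurd (Subtype.ext (h₁.trans (edge_eq_root h h₂))) hx
      · have : parent x = triangleIR h := parent_eq (h₁ ▸ parentSet_edge h h₂)
        rw [this]
        right
        change x.1 ⊂ triangle v w
        rw [h₁]
        exact edge_ssubset_triangle h
    · have : parent x = edgeIR h := parent_eq (h₁ ▸ parentSet_triangle h h₂)
      rw [this]
      left
      change edge v w ⊂ x.1
      rw [h₁]
      exact edge_ssubset_triangle h
  height_lt x hx := by
    obtain ⟨v, w, h, ⟨h₁, h₂⟩ | ⟨h₁, h₂⟩⟩ := exists_eq x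
    · rcases h₂.eq_or_lt with h₂ | h₂
      · exact absurd (Subtype.ext (h₁.trans (edge_eq_root h h₂))) hx
      · have : parent x = triangleIR h := parent_eq (h₁ ▸ parentSet_edge h h₂)
        rw [this, h₁]
        change (heightSet (triangle v w)).toNat < _
        rw [heightSet_triangle_of_neg h h₂, heightSet_edge h]
        have := dot_self_nonneg v
        omega
    · have : parent x = edgeIR h := parent_eq (h₁ ▸ parentSet_triangle h h₂)
      rw [this, h₁]
      change (heightSet (edge v w)).toNat < _
      rw [heightSet_triangle_of_nonneg h h₂, heightSet_edge h]
      have h₃ := dot_self_pos h.left_ne_zero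
      have h₄ := dot_self_pos h.right_ne_zero
      omega
  eq_parent x y hxy := by
    obtain ⟨v, w, h, h₁, h₂⟩ := exists_of_lt hxy
    rcases le_or_gt 0 (dot v w) with h₃ | h₃
    · right
      refine ⟨?_, (parent_eq ?_).symm⟩
      · rintro rfl
        have h₄ : edge e₁ e₂ = triangle v w := h₂
        exact not_hasTriangle_edge unimodular_e₁_e₂ (h₄ ▸ hasTriangle_triangle v w)
      · rw [h₁, h₂, parentSet_triangle h h₃]
    · left
      refine ⟨?_, (parent_eq ?_).symm⟩
      · rintro rfl
        exact h₃.ne (dot_eq_zero_of_edge_eq_root h h₁.symm)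
      · rw [h₁, h₂, parentSet_edge h h₃]

lemma infinite_IR : Infinite (IR 2) := by
  have h : ∀ n : ℕ, Unimodular e₁ ![(n : ℤ), 1] := fun n => Or.inl (by simp [det, e₁])
  refine Infinite.of_injective (fun n => edgeIR (h n)) fun n m hnm => ?_
  have h₁ : ![(n : ℤ), 1] ∈ edge e₁ ![(m : ℤ), 1] := by
    rw [← show edge e₁ ![(n : ℤ), 1] = edge e₁ ![(m : ℤ), 1] from congr_arg Subtype.val hnm]
    simp [mem_edge]
  simpa [mem_edge, e₁] using h₁

end Farey

namespace RootedTreePoset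

variable {P : Type u} [PartialOrder P] (T : RootedTreePoset P)

lemma adj_parent {x : P} (hx : x ≠ T.root) : (comparabilityGraph P).Adj x (T.parent x) :=
  (T.parent_lt_or_lt x hx).symm

lemma eq_parent_of_adj {x y : P} (h : (comparabilityGraph P).Adj x y) :
    (x ≠ T.root ∧ y = T.parent x) ∨ (y ≠ T.root ∧ x = T.parent y) :=
  h.elim (T.eq_parent x y) fun h => (T.eq_parent y x h).symm

lemma reachable_root (x : P) : (comparabilityGraph P).Reachable x T.root := by
  induction hn : T.height x using Nat.strong_induction_on generalizing x with
  | _ n ih =>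
    by_cases hx : x = T.root
    · rw [hx]
    · exact (T.adj_parent hx).reachable.trans (ih _ (hn ▸ T.height_lt x hx) _ rfl)

/-- The relation of being a descendant. -/
def Descendant : P → P → Prop :=
  Relation.ReflTransGen fun x y => y ≠ T.root ∧ x = T.parent y

lemma height_le_of_descendant {x y : P} (h : T.Descendant x y) : T.height x ≤ T.height y := by
  induction h with
  | refl => exact le_rfl
  | tail _ hy ih => exact ih.trans (hy.2 ▸ (T.height_lt _ hy.1).le)

lemma isBridge_parent {x : P} (hx : x ≠ T.root) :
    (comparabilityGraph P).IsBridge s(x, T.parent x) := by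
  rw [SimpleGraph.isBridge_iff]
  rintro ⟨p⟩
  have key : ∀ {y z} (_ : (comparabilityGraph P \ SimpleGraph.fromEdgeSet {s(x, T.parent x)}).Walk y z),
      T.Descendant x y → T.Descendant x z := by
    intro y z p
    induction p with
    | nil => exact id
    | @cons y y' z h _ ih =>
      intro hy
      apply ih
      rw [SimpleGraph.sdiff_adj, SimpleGraph.fromEdgeSet_adj] at h
      rcases T.eq_parent_of_adj h.1 with ⟨h₁, rfl⟩ | ⟨h₁, rfl⟩
      · rcases Relation.ReflTransGen.cases_tail hy with rfl | ⟨b, hb, -, rfl⟩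
        · exact absurd ⟨rfl, h.1.ne⟩ h.2
        · exact hb
      · exact hy.tail ⟨h₁, rfl⟩
  exact (T.height_lt x hx).not_ge (T.height_le_of_descendant (key p Relation.ReflTransGen.refl))

theorem isTree (T : RootedTreePoset P) : (comparabilityGraph P).IsTree where
  connected :=
    { preconnected := fun x y => (T.reachable_root x).trans (T.reachable_root y).symm
      nonempty := ⟨T.root⟩ }
  isAcyclic := by
    rw [SimpleGraph.isAcyclic_iff_forall_adj_isBridge]
    intro x y h
    rcases T.eq_parent_of_adj h with ⟨hx, rfl⟩ | ⟨hx, rfl⟩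
    · exact T.isBridge_parent hx
    · rw [Sym2.eq_swap]
      exact T.isBridge_parent hx

end RootedTreePoset

namespace Farey

/-- The action of the integral matrices on the vectors in the plane. -/
def act (g : GL (Fin 2) ℤ) (v : Fin 2 → ℤ) : Fin 2 → ℤ := (g : Matrix (Fin 2) (Fin 2) ℤ).mulVec v

lemma act_one (v) : act 1 v = v := Matrix.one_mulVec v

lemma act_mul (g h : GL (Fin 2) ℤ) (v) : act (g * h) v = act g (act h v) :=
  (Matrix.mulVec_mulVec _ _ _).symm

lemma act_inv_act (g : GL (Fin 2) ℤ) (v) : act g⁻¹ (act g v) = v := by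
  rw [← act_mul, inv_mul_cancel, act_one]

lemma act_add (g : GL (Fin 2) ℤ) (v w) : act g (v + w) = act g v + act g w :=
  Matrix.mulVec_add _ _ _

lemma act_neg (g : GL (Fin 2) ℤ) (v) : act g (-v) = -act g v := Matrix.mulVec_neg _ _

lemma act_zero (g : GL (Fin 2) ℤ) : act g 0 = 0 := Matrix.mulVec_zero _

lemma act_zsmul (g : GL (Fin 2) ℤ) (a : ℤ) (v) : act g (a • v) = a • act g v :=
  Matrix.mulVec_smul _ _ _

lemma act_injective (g : GL (Fin 2) ℤ) : Function.Injective (act g) :=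
  Function.LeftInverse.injective (act_inv_act g)

lemma det_act (g : GL (Fin 2) ℤ) (v w) :
    det (act g v) (act g w) = (g : Matrix (Fin 2) (Fin 2) ℤ).det * det v w := by
  simp only [det, act, Matrix.mulVec, dotProduct, Fin.sum_univ_two, Matrix.det_fin_two]
  ring

lemma Unimodular.act {v w} (h : Unimodular v w) (g : GL (Fin 2) ℤ) :
    Unimodular (act g v) (act g w) := by
  have h₁ : IsUnit (g : Matrix (Fin 2) (Fin 2) ℤ).det :=
    (Matrix.isUnit_iff_isUnit_det _).1 g.isUnit
  rw [Unimodular, det_act]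
  rcases Int.isUnit_iff.1 h₁ with h₁ | h₁ <;> rcases h with h | h <;> rw [h₁, h] <;> simp

lemma IsUnimodularSystem.image {E : Set (Fin 2 → ℤ)} (hE : IsUnimodularSystem E)
    (g : GL (Fin 2) ℤ) : IsUnimodularSystem (Farey.act g '' E) where
  zero_notMem := by
    rintro ⟨x, hx, h⟩
    rw [← act_zero g] at h
    exact hE.zero_notMem (act_injective g h ▸ hx)
  neg_mem_iff := by
    have : ∀ x ∈ Farey.act g '' E, -x ∈ Farey.act g '' E := by
      rintro _ ⟨x, hx, rfl⟩
      exact ⟨-x, (hE.neg_mem_iff x).1 hx, act_neg _ _⟩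
    exact fun x => ⟨this x, fun h => neg_neg x ▸ this _ h⟩
  unimodular := by
    rintro _ ⟨v, hv, rfl⟩ _ ⟨w, hw, rfl⟩
    refine (hE.unimodular v hv w hw).imp (fun h => ?_) fun h => h.act g
    rw [det_act, h, mul_zero]
  exists_unimodular := by
    obtain ⟨v, hv, w, hw, h⟩ := hE.exists_unimodular
    exact ⟨_, ⟨v, hv, rfl⟩, _, ⟨w, hw, rfl⟩, h.act g⟩

/-- The image of a system under an integral matrix. -/
def actIR (g : GL (Fin 2) ℤ) (E : IR 2) : IR 2 :=
  ⟨act g '' E.1, (isUnimodularSystem_iff _).1 ((isUnimodularSystem E).image g)⟩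

lemma actIR_one (E) : actIR 1 E = E := by
  refine Subtype.ext ?_
  simp only [actIR, act_one, Set.image_id']

lemma actIR_mul (g h : GL (Fin 2) ℤ) (E) : actIR (g * h) E = actIR g (actIR h E) := by
  refine Subtype.ext ?_
  simp only [actIR, act_mul, Set.image_image]

lemma actIR_mono (g : GL (Fin 2) ℤ) : Monotone (actIR g) := fun _ _ h => Set.image_mono h

/-- The action of the integral matrices on the poset `IR 2`. -/
def actionIR : GL (Fin 2) ℤ →* (IR 2 ≃o IR 2) where
  toFun g :=
    { toFun := actIR g
      invFun := actIR g⁻¹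
      left_inv := fun E => by rw [← actIR_mul, inv_mul_cancel, actIR_one]
      right_inv := fun E => by rw [← actIR_mul, mul_inv_cancel, actIR_one]
      map_rel_iff' := fun {E F} => by
        refine ⟨fun h => ?_, fun h => actIR_mono g h⟩
        have h' : actIR g E ≤ actIR g F := h
        have := actIR_mono g⁻¹ h'
        rwa [← actIR_mul, ← actIR_mul, inv_mul_cancel, actIR_one, actIR_one] at this }
  map_one' := by
    exact RelIso.ext fun E => actIR_one E
  map_mul' g h := by
    exact RelIso.ext fun E => actIR_mul g h E

end Farey

open Farey

/-- A finite family of vectors in the plane, indexed by a set with a free involution, which is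
unimodular. -/
structure VectorConfig where
  /-- the index set -/
  carrier : Type u
  finite : Finite carrier
  /-- the free involution -/
  bar : carrier → carrier
  bar_bar : ∀ e, bar (bar e) = e
  bar_ne : ∀ e, bar e ≠ e
  /-- the family of vectors -/
  vec : carrier → Fin 2 → ℤ
  vec_bar : ∀ e, vec (bar e) = -vec e
  det_cases : ∀ e f, det (vec e) (vec f) = 0 ∨ Unimodular (vec e) (vec f)
  exists_unimodular : ∃ e f, Unimodular (vec e) (vec f)

namespace VectorConfig

variable (X : VectorConfig.{u})

/-- The signed circuits of a configuration of vectors. -/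
def IsCircuit (C : Set X.carrier) : Prop :=
  (∃ e, X.vec e = 0 ∧ C = {e}) ∨
  (∃ e f, X.vec e ≠ 0 ∧ f ≠ X.bar e ∧ X.vec e + X.vec f = 0 ∧ C = {e, f}) ∨
  ∃ e f g, det (X.vec e) (X.vec f) ≠ 0 ∧ X.vec e + X.vec f + X.vec g = 0 ∧ C = {e, f, g}

variable {X}

lemma det_trichotomy (e f) : det (X.vec e) (X.vec f) = 0 ∨ det (X.vec e) (X.vec f) = 1 ∨
    det (X.vec e) (X.vec f) = -1 := X.det_cases e f

lemma unimodular_of_ne {e f} (h : det (X.vec e) (X.vec f) ≠ 0) : Unimodular (X.vec e) (X.vec f) :=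
  (X.det_cases e f).resolve_left h

lemma vec_ne_zero_of_det {e f} (h : det (X.vec e) (X.vec f) ≠ 0) : X.vec e ≠ 0 :=
  (unimodular_of_ne h).left_ne_zero

lemma det_of_add_eq_zero {u v w : Fin 2 → ℤ} (h : u + v + w = 0) :
    det v w = det u v ∧ det w u = det u v := by
  obtain rfl : w = -(u + v) := by
    rw [← sub_eq_zero, ← h]
    abel
  simp only [det_neg_left, det_neg_right, det_add_left, det_add_right, det_self]
  have := det_swap u v
  omega

lemma isCircuit_singleton {e} (h : X.vec e = 0) : X.IsCircuit {e} := Or.inl ⟨e, h, rfl⟩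

lemma isCircuit_pair {e f} (h : X.vec e ≠ 0) (h' : f ≠ X.bar e) (h'' : X.vec e + X.vec f = 0) :
    X.IsCircuit {e, f} := Or.inr (Or.inl ⟨e, f, h, h', h'', rfl⟩)

lemma isCircuit_triple {e f g} (h : det (X.vec e) (X.vec f) ≠ 0)
    (h' : X.vec e + X.vec f + X.vec g = 0) : X.IsCircuit {e, f, g} :=
  Or.inr (Or.inr ⟨e, f, g, h, h', rfl⟩)

/-- A circuit seen from one of its points. -/
lemma IsCircuit.cases_of_mem {C} (hC : X.IsCircuit C) {e} (he : e ∈ C) :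
    (X.vec e = 0 ∧ C = {e}) ∨
    (∃ f, X.vec e ≠ 0 ∧ f ≠ X.bar e ∧ X.vec e + X.vec f = 0 ∧ C = {e, f}) ∨
    ∃ f g, det (X.vec e) (X.vec f) ≠ 0 ∧ X.vec e + X.vec f + X.vec g = 0 ∧ C = {e, f, g} := by
  rcases hC with ⟨x, hx, rfl⟩ | ⟨x, y, hx, hy, hxy, rfl⟩ | ⟨x, y, z, hx, hxy, rfl⟩
  · obtain rfl : e = x := he
    exact Or.inl ⟨hx, rfl⟩
  · right; left
    rcases he with rfl | rfl
    · exact ⟨y, hx, hy, hxy, rfl⟩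
    · refine ⟨x, fun h => hx ?_, fun h => hy ?_, (add_comm _ _).trans hxy, Set.pair_comm _ _⟩
      · rwa [h, add_zero] at hxy
      · rw [h, X.bar_bar]
  · right; right
    obtain ⟨h₁, h₂⟩ := det_of_add_eq_zero hxy
    rcases he with rfl | rfl | rfl
    · exact ⟨y, z, hx, hxy, rfl⟩
    · refine ⟨z, x, h₁ ▸ hx, ?_, ?_⟩
      · rw [← hxy]
        abel
      · rw [Set.insert_comm, Set.pair_comm x]
    · refine ⟨x, y, h₂ ▸ hx, ?_, ?_⟩
      · rw [← hxy]
        abel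
      · rw [Set.pair_comm y, Set.insert_comm]

lemma IsCircuit.nonempty {C} (hC : X.IsCircuit C) : C.Nonempty := by
  rcases hC with ⟨x, hx, rfl⟩ | ⟨x, y, hx, hy, hxy, rfl⟩ | ⟨x, y, z, hx, hxy, rfl⟩ <;>
    exact ⟨x, by simp⟩

lemma IsCircuit.bar {C} (hC : X.IsCircuit C) : X.IsCircuit (X.bar '' C) := by
  rcases hC with ⟨x, hx, rfl⟩ | ⟨x, y, hx, hy, hxy, rfl⟩ | ⟨x, y, z, hx, hxy, rfl⟩
  · rw [Set.image_singleton]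
    exact isCircuit_singleton (by rw [X.vec_bar, hx, neg_zero])
  · rw [Set.image_pair]
    refine isCircuit_pair ?_ ?_ ?_
    · rwa [X.vec_bar, neg_ne_zero]
    · exact fun h => hy (by rw [← X.bar_bar y, h, X.bar_bar])
    · rw [X.vec_bar, X.vec_bar, ← neg_add, hxy, neg_zero]
  · rw [Set.image_insert_eq, Set.image_pair]
    refine isCircuit_triple ?_ ?_
    · rwa [X.vec_bar, X.vec_bar, det_neg_left, det_neg_right, neg_neg]
    · rw [X.vec_bar, X.vec_bar, X.vec_bar, ← neg_add, ← neg_add, hxy, neg_zero]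

lemma bar_injective : Function.Injective X.bar := Function.Involutive.injective X.bar_bar

lemma IsCircuit.bar_notMem {C} (hC : X.IsCircuit C) {e} (he : e ∈ C) : X.bar e ∉ C := by
  rcases hC.cases_of_mem he with ⟨h, rfl⟩ | ⟨f, h₁, h₂, h₃, rfl⟩ | ⟨f, g, h₁, h₂, rfl⟩
  · exact X.bar_ne e
  · rintro (h | h)
    exacts [X.bar_ne e h, h₂ h.symm]
  · rintro (h | h | h)
    · exact X.bar_ne e h
    · rw [← h, X.vec_bar, det_neg_right, det_self, neg_zero] at h₁
      exact h₁ rfl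
    · rw [← h, X.vec_bar, add_right_comm, add_neg_cancel, zero_add] at h₂
      rw [h₂, det_zero_right] at h₁
      exact h₁ rfl

lemma mem_bar_image {C : Set X.carrier} {e} : e ∈ X.bar '' C ↔ X.bar e ∈ C :=
  ⟨by rintro ⟨f, hf, rfl⟩; rwa [X.bar_bar], fun h => ⟨_, h, X.bar_bar e⟩⟩

lemma bar_image_bar_image (C : Set X.carrier) : X.bar '' (X.bar '' C) = C := by
  ext e
  rw [mem_bar_image, mem_bar_image, X.bar_bar]

lemma vec_eq_of_vec_add_eq {e f g h k} (h₁ : det (X.vec e) (X.vec f) ≠ 0)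
    (h₂ : X.vec e + X.vec f + X.vec g = 0) (h₃ : det (X.vec e) (X.vec h) ≠ 0)
    (h₄ : X.vec e + X.vec h + X.vec k = 0) :
    (X.vec f = X.vec h ∧ X.vec g = X.vec k) ∨ (X.vec f = X.vec k ∧ X.vec g = X.vec h) := by
  have hg : X.vec g = -(X.vec e + X.vec f) := by
    rw [← sub_eq_zero, ← h₂]
    abel
  have hk : X.vec k = -(X.vec e + X.vec h) := by
    rw [← sub_eq_zero, ← h₄]
    abel
  have hu := unimodular_of_ne h₁
  have hh := hu.exists_eq (X.vec h)
  have d₁ := det_trichotomy e f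
  have d₂ := det_trichotomy e h
  have d₃ := det_trichotomy h f
  have d₄ := det_trichotomy k f
  have d₅ := det_trichotomy g h
  have d₆ := det_trichotomy g k
  have s₁ := det_swap (X.vec h) (X.vec f)
  have s₂ := det_swap (X.vec e) (X.vec f)
  rw [hg] at d₅ d₆
  rw [hk] at d₄ d₆
  simp only [det_neg_left, det_neg_right, det_add_left, det_add_right, det_self] at d₄ d₅ d₆
  have key : (det (X.vec h) (X.vec f) = 0 ∧ det (X.vec e) (X.vec h) = det (X.vec e) (X.vec f)) ∨
      (det (X.vec h) (X.vec f) = -det (X.vec e) (X.vec f) ∧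
        det (X.vec e) (X.vec h) = -det (X.vec e) (X.vec f)) := by omega
  rcases key with ⟨k₁, k₂⟩ | ⟨k₁, k₂⟩
  · left
    rw [k₁, k₂, hu.det_mul_self, mul_zero, zero_smul, one_smul, zero_add] at hh
    exact ⟨hh.symm, by rw [hg, hk, hh]⟩
  · right
    rw [k₁, k₂, mul_neg, hu.det_mul_self, neg_smul, neg_smul, one_smul, one_smul] at hh
    constructor
    · rw [hk, hh]
      abel
    · rw [hg, hh]
      abel

lemma eq_zero_of_add_self {v : Fin 2 → ℤ} (h : v + v = 0) : v = 0 := by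
  ext i
  have := congr_fun h i
  simp only [Pi.add_apply, Pi.zero_apply] at this ⊢
  omega

lemma ne_of_det {e f} (h : det (X.vec e) (X.vec f) ≠ 0) : f ≠ e := fun h' =>
  h (by rw [h', det_self])

lemma ne_of_add_eq_zero {e f} (h : X.vec e ≠ 0) (h' : X.vec e + X.vec f = 0) : f ≠ e :=
  fun h'' => h (eq_zero_of_add_self (h'' ▸ h'))

lemma det_third {e f g} (h : det (X.vec e) (X.vec f) ≠ 0)
    (h' : X.vec e + X.vec f + X.vec g = 0) :
    det (X.vec e) (X.vec g) ≠ 0 ∧ det (X.vec f) (X.vec g) ≠ 0 := by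
  obtain ⟨h₁, h₂⟩ := det_of_add_eq_zero h'
  rw [h₁, det_swap, h₂]
  exact ⟨neg_ne_zero.2 h, h⟩

/-- The circuits satisfy the elimination axiom. -/
lemma IsCircuit.elimination {C₁ C₂} (h₁ : X.IsCircuit C₁) (h₂ : X.IsCircuit C₂) (hne : C₁ ≠ C₂)
    {e} (he₁ : e ∈ C₁) (he₂ : e ∈ C₂) :
    ∃ C₃, X.IsCircuit C₃ ∧ C₃ ⊆ (C₁ \ {e}) ∪ X.bar '' (C₂ \ {e}) := by
  have pair : ∀ f g, f ∈ C₁ → f ≠ e → g ∈ C₂ → g ≠ e → f ≠ g → X.vec f ≠ 0 → X.vec f = X.vec g →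
      ∃ C₃, X.IsCircuit C₃ ∧ C₃ ⊆ (C₁ \ {e}) ∪ X.bar '' (C₂ \ {e}) := by
    intro f g hf hfe hg hge hfg hf₀ hv
    refine ⟨{f, X.bar g}, isCircuit_pair hf₀ (fun h => hfg (X.bar_injective h).symm) ?_, ?_⟩
    · rw [X.vec_bar, hv, add_neg_cancel]
    · rintro x (rfl | rfl)
      exacts [Or.inl ⟨hf, hfe⟩, Or.inr ⟨g, ⟨hg, hge⟩, rfl⟩]
  rcases h₁.cases_of_mem he₁ with ⟨a₁, rfl⟩ | ⟨f, a₁, a₂, a₃, rfl⟩ | ⟨f, g, a₁, a₂, rfl⟩ <;>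
  rcases h₂.cases_of_mem he₂ with ⟨b₁, rfl⟩ | ⟨h, b₁, b₂, b₃, rfl⟩ | ⟨h, k, b₁, b₂, rfl⟩
  · exact absurd rfl hne
  · exact absurd a₁ b₁
  · exact absurd a₁ (vec_ne_zero_of_det b₁)
  · exact absurd b₁ a₁
  · have hfh : f ≠ h := by
      rintro rfl
      exact hne rfl
    have hv : X.vec f = X.vec h := by
      rw [eq_neg_of_add_eq_zero_right a₃, eq_neg_of_add_eq_zero_right b₃]
    refine pair f h (by simp) (ne_of_add_eq_zero a₁ a₃) (by simp) (ne_of_add_eq_zero b₁ b₃) hfh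
      ?_ hv
    rwa [eq_neg_of_add_eq_zero_right a₃, neg_ne_zero]
  · have hv := eq_neg_of_add_eq_zero_right a₃
    refine ⟨{f, X.bar h, X.bar k}, isCircuit_triple ?_ ?_, ?_⟩
    · rwa [hv, X.vec_bar, det_neg_left, det_neg_right, neg_neg]
    · rw [hv, X.vec_bar, X.vec_bar, ← neg_add, ← neg_add, b₂, neg_zero]
    · rintro x (rfl | rfl | rfl)
      · exact Or.inl ⟨by simp, ne_of_add_eq_zero a₁ a₃⟩
      · exact Or.inr ⟨h, ⟨by simp, ne_of_det b₁⟩, rfl⟩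
      · exact Or.inr ⟨k, ⟨by simp, ne_of_det (det_third b₁ b₂).1⟩, rfl⟩
  · exact absurd b₁ (vec_ne_zero_of_det a₁)
  · have hv := eq_neg_of_add_eq_zero_right b₃
    refine ⟨{f, g, X.bar h}, isCircuit_triple (det_third a₁ a₂).2 ?_, ?_⟩
    · rw [X.vec_bar, hv, neg_neg, ← a₂]
      abel
    · rintro x (rfl | rfl | rfl)
      · exact Or.inl ⟨by simp, ne_of_det a₁⟩
      · exact Or.inl ⟨by simp, ne_of_det (det_third a₁ a₂).1⟩
      · exact Or.inr ⟨h, ⟨by simp, ne_of_add_eq_zero b₁ b₃⟩, rfl⟩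
  · have hf : f ∈ ({e, f, g} : Set X.carrier) := by simp
    have hg : g ∈ ({e, f, g} : Set X.carrier) := by simp
    have hh : h ∈ ({e, h, k} : Set X.carrier) := by simp
    have hk : k ∈ ({e, h, k} : Set X.carrier) := by simp
    have hf' := ne_of_det a₁
    have hg' := ne_of_det (det_third a₁ a₂).1
    have hh' := ne_of_det b₁
    have hk' := ne_of_det (det_third b₁ b₂).1
    have hf₀ := vec_ne_zero_of_det (det_third a₁ a₂).2
    have hg₀ := (unimodular_of_ne (det_third a₁ a₂).1).right_ne_zero
    rcases vec_eq_of_vec_add_eq a₁ a₂ b₁ b₂ with ⟨h₁, h₂⟩ | ⟨h₁, h₂⟩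
    · by_cases hfh : f = h
      · have hgk : g ≠ k := by
          rintro rfl
          exact hne (by rw [hfh])
        exact pair g k hg hg' hk hk' hgk hg₀ h₂
      · exact pair f h hf hf' hh hh' hfh hf₀ h₁
    · by_cases hfk : f = k
      · have hgh : g ≠ h := by
          rintro rfl
          exact hne (by rw [hfk, Set.pair_comm])
        exact pair g h hg hg' hh hh' hgh hg₀ h₂
      · exact pair f k hf hf' hk hk' hfk hf₀ h₁

lemma IsCircuit.eq_of_subset_of_mem {C₁ C₂} (h₁ : X.IsCircuit C₁) (h₂ : X.IsCircuit C₂)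
    (hs : C₁ ⊆ C₂ ∪ X.bar '' C₂) {e} (he₁ : e ∈ C₁) (he₂ : e ∈ C₂) : C₁ = C₂ := by
  have hmem : ∀ f ∈ C₁, f ∈ C₂ ∨ ∃ f' ∈ C₂, f = X.bar f' := fun f hf =>
    (hs hf).imp_right fun ⟨f', h, h'⟩ => ⟨f', h, h'.symm⟩
  rcases h₁.cases_of_mem he₁ with ⟨a₁, rfl⟩ | ⟨f, a₁, a₂, a₃, rfl⟩ | ⟨f, g, a₁, a₂, rfl⟩ <;>
  rcases h₂.cases_of_mem he₂ with ⟨b₁, rfl⟩ | ⟨h, b₁, b₂, b₃, rfl⟩ | ⟨h, k, b₁, b₂, rfl⟩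
  · rfl
  · exact absurd a₁ b₁
  · exact absurd a₁ (vec_ne_zero_of_det b₁)
  · exact absurd b₁ a₁
  · have hfe := ne_of_add_eq_zero a₁ a₃
    rcases hmem f (by simp) with (rfl | rfl) | ⟨x, rfl | rfl, rfl⟩
    · exact absurd rfl hfe
    · rfl
    · exact absurd rfl a₂
    · have := eq_neg_of_add_eq_zero_right b₃
      rw [X.vec_bar, this, neg_neg] at a₃
      exact absurd (eq_zero_of_add_self a₃) a₁
  · have hv := eq_neg_of_add_eq_zero_right a₃
    have hfe := ne_of_add_eq_zero a₁ a₃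
    have b₃ := (det_third b₁ b₂).1
    rcases hmem f (by simp) with (rfl | rfl | rfl) | ⟨x, rfl | rfl | rfl, rfl⟩
    · exact absurd rfl hfe
    · simp [hv, det_neg_right, det_self] at b₁
    · simp [hv, det_neg_right, det_self] at b₃
    · exact absurd rfl a₂
    · rw [X.vec_bar, neg_inj] at hv
      simp [hv, det_self] at b₁
    · rw [X.vec_bar, neg_inj] at hv
      simp [hv, det_self] at b₃
  · exact absurd b₁ (vec_ne_zero_of_det a₁)
  · have hv := eq_neg_of_add_eq_zero_right b₃
    rcases hmem f (by simp) with (rfl | rfl) | ⟨x, rfl | rfl, rfl⟩ <;>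
      simp [X.vec_bar, hv, det_neg_right, det_self] at a₁
  · have c₁ := (det_third a₁ a₂).1
    have c₂ := (det_third a₁ a₂).2
    have b₃ := (det_third b₁ b₂).1
    have b₄ := (det_third b₁ b₂).2
    have e₁ := congr_arg (det (X.vec e)) a₂
    have e₂ := congr_arg (det (X.vec e)) b₂
    have e₃ := congr_arg (det (X.vec h)) a₂
    have e₄ := congr_arg (det (X.vec h)) b₂
    have s := det_swap (X.vec e) (X.vec h)
    rcases hmem f (by simp) with (rfl | rfl | rfl) | ⟨x, rfl | rfl | rfl, rfl⟩ <;>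
    rcases hmem g (by simp) with (rfl | rfl | rfl) | ⟨y, rfl | rfl | rfl, rfl⟩
    all_goals
      first
      | rfl
      | exact congr_arg _ (Set.pair_comm _ _)
      | exfalso
        simp only [X.vec_bar, det_add_right, det_neg_right, det_neg_left, det_self,
          det_zero_right] at *
        omega

/-- A circuit contained, up to signs, in another one is equal to it, up to signs. -/
lemma IsCircuit.eq_or_eq_bar {C₁ C₂} (h₁ : X.IsCircuit C₁) (h₂ : X.IsCircuit C₂)
    (h : C₁ ⊆ C₂ ∪ X.bar '' C₂) : C₁ = C₂ ∨ C₁ = X.bar '' C₂ := by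
  obtain ⟨e, he⟩ := h₁.nonempty
  rcases h he with he' | he'
  · exact Or.inl (h₁.eq_of_subset_of_mem h₂ h he he')
  · refine Or.inr (h₁.eq_of_subset_of_mem h₂.bar ?_ he he')
    rwa [bar_image_bar_image, Set.union_comm]

variable (X) in
/-- The freely oriented matroid of a configuration of vectors. -/
def toMatroid : FreelyOrientedMatroid.{u} where
  carrier := X.carrier
  finite := X.finite
  bar := X.bar
  bar_bar := X.bar_bar
  bar_ne := X.bar_ne
  circuits := {C | X.IsCircuit C}
  nonempty_of_circuit _ hC := hC.nonempty
  disjoint_bar C hC := by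
    rw [Set.disjoint_right]
    rintro _ ⟨e, he, rfl⟩
    exact hC.bar_notMem he
  bar_mem_circuits _ hC := hC.bar
  eq_or_eq_bar _ h₁ _ h₂ h := h₁.eq_or_eq_bar h₂ h
  elimination _ h₁ _ h₂ hne _ he := h₁.elimination h₂ hne he.1 he.2

lemma finite_set (C : Set X.carrier) : C.Finite :=
  have := X.finite
  C.toFinite

lemma IsCircuit.finsum_eq_zero {C} (hC : X.IsCircuit C) : ∑ᶠ e ∈ C, X.vec e = 0 := by
  rcases hC with ⟨x, hx, rfl⟩ | ⟨x, y, hx, hy, hxy, rfl⟩ | ⟨x, y, z, hx, hxy, rfl⟩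
  · rwa [finsum_mem_singleton]
  · rwa [finsum_mem_pair (ne_of_add_eq_zero hx hxy).symm]
  · have h₁ := ne_of_det hx
    have h₂ := ne_of_det (det_third hx hxy).1
    have h₃ := ne_of_det (det_third hx hxy).2
    rw [finsum_mem_insert _ (by simp [h₁.symm, h₂.symm]) (Set.toFinite _), finsum_mem_pair h₃.symm,
      ← add_assoc, hxy]

lemma exists_det_ne_zero {e} (he : X.vec e ≠ 0) : ∃ f, det (X.vec e) (X.vec f) ≠ 0 := by
  obtain ⟨a, b, h⟩ := X.exists_unimodular
  by_contra! h'
  have := h.exists_eq (X.vec e)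
  rw [h' b, det_swap (X.vec e) (X.vec a), h' a] at this
  simp at this
  exact he this

lemma vec_eq_or_neg_of_det_eq_zero {e f} (h : det (X.vec e) (X.vec f) = 0) (he : X.vec e ≠ 0)
    (hf : X.vec f ≠ 0) : X.vec f = X.vec e ∨ X.vec f = -X.vec e := by
  obtain ⟨w, hw⟩ := exists_det_ne_zero he
  have hu := unimodular_of_ne hw
  have h₁ := hu.exists_eq (X.vec f)
  rw [h, mul_zero, zero_smul, add_zero] at h₁
  rcases det_trichotomy f w with h₂ | h₂ | h₂
  · rw [h₂, mul_zero, zero_smul] at h₁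
    exact absurd h₁ hf
  · rcases hu with h₃ | h₃ <;> rw [h₂, h₃] at h₁ <;> simp at h₁ <;> simp [h₁]
  · rcases hu with h₃ | h₃ <;> rw [h₂, h₃] at h₁ <;> simp at h₁ <;> simp [h₁]

/-- Two elements with linearly dependent vectors carry a circuit. -/
lemma exists_isCircuit_of_det_eq_zero {a b} (h : det (X.vec a) (X.vec b) = 0) (h₁ : b ≠ a)
    (h₂ : b ≠ X.bar a) : ∃ C, X.IsCircuit C ∧ C ⊆ {a, b} ∪ X.bar '' {a, b} := by
  by_cases ha : X.vec a = 0
  · exact ⟨_, isCircuit_singleton ha, by simp⟩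
  by_cases hb : X.vec b = 0
  · exact ⟨_, isCircuit_singleton hb, by simp⟩
  rcases vec_eq_or_neg_of_det_eq_zero h ha hb with h₃ | h₃
  · refine ⟨_, isCircuit_pair (e := a) (f := X.bar b) ha (fun h => h₁ (bar_injective h)) ?_, ?_⟩
    · rw [X.vec_bar, h₃, add_neg_cancel]
    · rintro x (rfl | rfl)
      exacts [Or.inl (by simp), Or.inr ⟨b, by simp⟩]
  · exact ⟨_, isCircuit_pair ha h₂ (by rw [h₃, add_neg_cancel]), Set.subset_union_left⟩

lemma mem_pair_union_bar {a b x} : x ∈ {a, b} ∪ X.bar '' {a, b} ↔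
    x = a ∨ x = b ∨ x = X.bar a ∨ x = X.bar b := by
  simp [Set.image_pair]
  tauto

/-- Two elements with linearly independent vectors carry no circuit. -/
lemma not_isCircuit_of_det_ne_zero {a b} (h : det (X.vec a) (X.vec b) ≠ 0) {C}
    (hC : X.IsCircuit C) : ¬ C ⊆ {a, b} ∪ X.bar '' {a, b} := by
  intro hs
  have hmem := fun x hx => mem_pair_union_bar.1 (hs (a := x) hx)
  have ha := vec_ne_zero_of_det h
  have hb := (unimodular_of_ne h).right_ne_zero
  have h' : det (X.vec b) (X.vec a) ≠ 0 := by rwa [det_swap, neg_ne_zero]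
  rcases hC with ⟨x, hx, rfl⟩ | ⟨x, y, hx, hy, hxy, rfl⟩ | ⟨x, y, z, hx, hxy, rfl⟩
  · rcases hmem x rfl with rfl | rfl | rfl | rfl <;> simp [X.vec_bar, ha, hb] at hx
  · have h₁ := ne_of_add_eq_zero hx hxy
    have h₂ : det (X.vec x) (X.vec y) = 0 := by
      rw [eq_neg_of_add_eq_zero_right hxy, det_neg_right, det_self, neg_zero]
    rcases hmem x (by simp) with rfl | rfl | rfl | rfl <;>
    rcases hmem y (by simp) with rfl | rfl | rfl | rfl <;>
    simp [X.vec_bar, X.bar_bar, det_neg_right, det_neg_left, h, h'] at h₁ h₂ hy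
  · obtain ⟨h₁, h₂⟩ := det_third hx hxy
    rcases hmem x (by simp) with rfl | rfl | rfl | rfl <;>
    rcases hmem y (by simp) with rfl | rfl | rfl | rfl <;>
    (try simp [X.vec_bar, det_neg_right, det_neg_left, det_self] at hx) <;>
    rcases hmem z (by simp) with rfl | rfl | rfl | rfl <;>
    simp [X.vec_bar, det_neg_right, det_neg_left, det_self] at h₁ h₂

lemma exists_vec_eq_mul (a : X.carrier) {ε : ℤ} (hε : ε = 1 ∨ ε = -1) :
    ∃ y, (y = a ∨ y = X.bar a) ∧ X.vec y = ε • X.vec a := by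
  rcases hε with rfl | rfl
  · exact ⟨a, Or.inl rfl, (one_smul _ _).symm⟩
  · exact ⟨X.bar a, Or.inr rfl, by rw [X.vec_bar, neg_smul, one_smul]⟩

/-- Any element together with two elements with linearly independent vectors carries a circuit. -/
lemma exists_isCircuit_mem {a b} (h : det (X.vec a) (X.vec b) ≠ 0) {x}
    (hx : x ∉ {a, b} ∪ X.bar '' {a, b}) : ∃ C, X.IsCircuit C ∧ x ∈ C ∧
      C ⊆ insert x ({a, b} ∪ X.bar '' {a, b}) := by
  have hu := unimodular_of_ne h
  have h₀ : ∃ α β : ℤ, (α = 0 ∨ α = 1 ∨ α = -1) ∧ (β = 0 ∨ β = 1 ∨ β = -1) ∧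
      X.vec x = α • X.vec a + β • X.vec b := by
    refine ⟨_, _, ?_, ?_, hu.exists_eq (X.vec x)⟩
    · have h₂ := det_trichotomy x b
      unfold Unimodular at hu
      rcases hu with h | h <;> rcases h₂ with h₂ | h₂ | h₂ <;> rw [h, h₂] <;> simp
    · have h₂ := det_trichotomy a x
      unfold Unimodular at hu
      rcases hu with h | h <;> rcases h₂ with h₂ | h₂ | h₂ <;> rw [h, h₂] <;> simp
  have hne : ∀ y, y ∈ ({a, b} ∪ X.bar '' {a, b} : Set X.carrier) → y ≠ x ∧ y ≠ X.bar x := by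
    refine fun y hy => ⟨fun h => hx (h ▸ hy), fun h => hx ?_⟩
    have h' : x = X.bar y := by rw [h, X.bar_bar]
    rw [mem_pair_union_bar] at hy ⊢
    rcases hy with rfl | rfl | rfl | rfl <;> simp [h', X.bar_bar]
  obtain ⟨α, β, hα, hβ, hv⟩ := h₀
  rcases eq_or_ne α 0 with rfl | hα'
  · rcases eq_or_ne β 0 with rfl | hβ'
    · exact ⟨{x}, isCircuit_singleton (by simp [hv]), rfl, by simp⟩
    · obtain ⟨y, hy, hy'⟩ := exists_vec_eq_mul b (ε := -β) (by omega)
      have hy₁ : y ∈ ({a, b} ∪ X.bar '' {a, b} : Set X.carrier) := by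
        rw [mem_pair_union_bar]
        tauto
      refine ⟨{x, y}, isCircuit_pair ?_ (hne y hy₁).2 ?_, by simp, ?_⟩
      · rw [hv, zero_smul, zero_add]
        exact smul_ne_zero hβ' hu.right_ne_zero
      · simp [hv, hy']
      · rintro z (rfl | rfl)
        exacts [Or.inl rfl, Or.inr hy₁]
  · obtain ⟨z, hz, hz'⟩ := exists_vec_eq_mul a (ε := -α) (by omega)
    have hz₁ : z ∈ ({a, b} ∪ X.bar '' {a, b} : Set X.carrier) := by
      rw [mem_pair_union_bar]
      tauto
    rcases eq_or_ne β 0 with rfl | hβ'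
    · refine ⟨{x, z}, isCircuit_pair ?_ (hne z hz₁).2 ?_, by simp, ?_⟩
      · rw [hv, zero_smul, add_zero]
        exact smul_ne_zero hα' hu.left_ne_zero
      · simp [hv, hz']
      · rintro z (rfl | rfl)
        exacts [Or.inl rfl, Or.inr hz₁]
    · obtain ⟨y, hy, hy'⟩ := exists_vec_eq_mul b (ε := -β) (by omega)
      have hy₁ : y ∈ ({a, b} ∪ X.bar '' {a, b} : Set X.carrier) := by
        rw [mem_pair_union_bar]
        tauto
      refine ⟨{x, y, z}, isCircuit_triple ?_ ?_, by simp, ?_⟩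
      · rw [hv, hy', det_add_left, det_smul_left, det_smul_right, det_smul_left, det_smul_right,
          det_self]
        simp [hα', hβ', h]
      · rw [hv, hy', hz', neg_smul, neg_smul]
        abel
      · rintro z (rfl | rfl | rfl)
        exacts [Or.inl rfl, Or.inr hy₁, Or.inr hz₁]

lemma pair_disjoint_bar {a b} (h : det (X.vec a) (X.vec b) ≠ 0) :
    Disjoint {a, b} (X.bar '' {a, b}) := by
  rw [Set.image_pair, Set.disjoint_left]
  have h₁ : b ≠ X.bar a := by
    rintro rfl
    simp [X.vec_bar, det_neg_right, det_self] at h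
  have h₂ : a ≠ X.bar b := by
    rintro rfl
    simp [X.vec_bar, det_neg_left, det_self] at h
  rintro x (rfl | rfl) (h | h)
  exacts [X.bar_ne _ h.symm, h₂ h, h₁ h, X.bar_ne _ h.symm]

lemma indep_pair {a b} (h : det (X.vec a) (X.vec b) ≠ 0) : X.toMatroid.Indep {a, b} :=
  ⟨pair_disjoint_bar h, fun _ hC => not_isCircuit_of_det_ne_zero h hC⟩

lemma det_ne_zero_of_indep {A : Set X.carrier} (hA : X.toMatroid.Indep A) {a b} (ha : a ∈ A)
    (hb : b ∈ A) (hab : b ≠ a) : det (X.vec a) (X.vec b) ≠ 0 := by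
  intro h
  have h₂ : b ≠ X.bar a := by
    rintro rfl
    exact Set.disjoint_left.1 hA.1 hb ⟨a, ha, rfl⟩
  obtain ⟨C, hC, hs⟩ := exists_isCircuit_of_det_eq_zero h hab h₂
  have h₃ : {a, b} ⊆ A := Set.pair_subset ha hb
  exact hA.2 C hC (hs.trans (Set.union_subset_union h₃ (Set.image_mono h₃)))

lemma eq_pair_of_indep {A : Set X.carrier} (hA : X.toMatroid.Indep A) {a b} (ha : a ∈ A)
    (hb : b ∈ A) (h : det (X.vec a) (X.vec b) ≠ 0) : A = {a, b} := by
  have h₃ : {a, b} ⊆ A := Set.pair_subset ha hb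
  have h₄ := Set.union_subset_union h₃ (Set.image_mono (f := X.bar) h₃)
  refine h₃.antisymm' fun x hx => ?_
  by_contra hx'
  have hx'' : x ∉ {a, b} ∪ X.bar '' {a, b} := by
    rintro (h | h)
    · exact hx' h
    · exact Set.disjoint_left.1 hA.1 hx (Set.image_mono h₃ h)
  obtain ⟨C, hC, -, hs⟩ := exists_isCircuit_mem h hx''
  refine hA.2 C hC (hs.trans ?_)
  rintro y (rfl | hy)
  exacts [Or.inl hx, h₄ hy]

lemma exists_subset_of_indep {A : Set X.carrier} (hA : X.toMatroid.Indep A) :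
    ∃ a b, det (X.vec a) (X.vec b) ≠ 0 ∧ A ⊆ {a, b} := by
  rcases A.eq_empty_or_nonempty with rfl | ⟨a, ha⟩
  · obtain ⟨a, b, h⟩ := X.exists_unimodular
    refine ⟨a, b, ?_, Set.empty_subset _⟩
    rcases h with h | h <;> rw [h] <;> decide
  · by_cases h : ∃ b ∈ A, b ≠ a
    · obtain ⟨b, hb, hab⟩ := h
      have h₁ := det_ne_zero_of_indep hA ha hb hab
      exact ⟨a, b, h₁, (eq_pair_of_indep hA ha hb h₁).subset⟩
    · push Not at h
      have h₁ : X.vec a ≠ 0 := fun h₁ => hA.2 _ (isCircuit_singleton h₁) (by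
        rintro x rfl
        exact Or.inl ha)
      obtain ⟨b, hb⟩ := exists_det_ne_zero h₁
      exact ⟨a, b, hb, fun x hx => Or.inl (h x hx)⟩

lemma isBasis_iff {A : Set X.carrier} :
    X.toMatroid.IsBasis A ↔ ∃ a b, det (X.vec a) (X.vec b) ≠ 0 ∧ A = {a, b} := by
  constructor
  · intro h
    obtain ⟨a, b, hab, hs⟩ := exists_subset_of_indep h.1
    exact ⟨a, b, hab, hs.antisymm (h.2 (indep_pair hab) hs)⟩
  · rintro ⟨a, b, h, rfl⟩
    exact ⟨indep_pair h, fun A hA hs =>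
      (eq_pair_of_indep hA (hs (Or.inl rfl)) (hs (Or.inr rfl)) h).subset⟩

lemma hasRank_toMatroid : X.toMatroid.HasRank 2 := by
  obtain ⟨a, b, h⟩ := X.exists_unimodular
  have h₁ : det (X.vec a) (X.vec b) ≠ 0 := by
    rcases h with h | h <;> rw [h] <;> decide
  exact ⟨{a, b}, isBasis_iff.2 ⟨a, b, h₁, rfl⟩, Set.ncard_pair (ne_of_det h₁).symm⟩

end VectorConfig

namespace Farey

/-- The vectors with integral coordinates among those with real coordinates. -/
def toReal : (Fin 2 → ℤ) →+ (Fin 2 → ℝ) where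
  toFun v i := v i
  map_zero' := by
    ext
    simp
  map_add' v w := by
    ext
    simp

lemma toReal_neg (v) : toReal (-v) = -toReal v := map_neg _ _

lemma det_toReal (v w : Fin 2 → ℤ) : (Pi.basisFun ℝ (Fin 2)).det ![toReal v, toReal w] = det v w := by
  rw [Pi.basisFun_det]
  change Matrix.det (Matrix.of ![toReal v, toReal w]) = _
  rw [Matrix.det_fin_two]
  simp [toReal, det]

lemma linearIndependent_toReal {v w : Fin 2 → ℤ} (h : det v w ≠ 0) :
    LinearIndependent ℝ ![toReal v, toReal w] := by
  have h' : IsUnit ((Pi.basisFun ℝ (Fin 2)).det ![toReal v, toReal w]) := by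
    rw [det_toReal]
    exact (Int.cast_ne_zero.2 h).isUnit
  exact ((Module.Basis.is_basis_iff_det _).2 h').1

lemma span_toReal {v w : Fin 2 → ℤ} (h : det v w ≠ 0) :
    Submodule.span ℝ (Set.range ![toReal v, toReal w]) = ⊤ := by
  have h' : IsUnit ((Pi.basisFun ℝ (Fin 2)).det ![toReal v, toReal w]) := by
    rw [det_toReal]
    exact (Int.cast_ne_zero.2 h).isUnit
  exact ((Module.Basis.is_basis_iff_det _).2 h').2

end Farey

namespace VectorConfig

variable {X Y : VectorConfig.{u}}

lemma abs_det_eq_one {a b} (h : det (X.vec a) (X.vec b) ≠ 0) :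
    |(det (X.vec a) (X.vec b) : ℝ)| = 1 := by
  rcases unimodular_of_ne h with h | h <;> simp [h]

lemma toReal_vec_add_bar (e : X.carrier) : toReal (X.vec e) + toReal (X.vec (X.bar e)) = 0 := by
  rw [X.vec_bar, toReal_neg, add_neg_cancel]

lemma IsCircuit.finsum_toReal_eq_zero {C} (hC : X.IsCircuit C) :
    ∑ᶠ e ∈ C, (1 : ℝ) • toReal (X.vec e) = 0 := by
  simp only [one_smul]
  rw [← AddMonoidHom.map_finsum_mem _ _ (finite_set C), hC.finsum_eq_zero, map_zero]

lemma isUnipotent_toMatroid : X.toMatroid.IsUnipotent fun e => toReal (X.vec e) := by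
  refine ⟨⟨toReal_vec_add_bar, fun C hC => ⟨fun _ => 1, fun _ _ => one_pos,
    IsCircuit.finsum_toReal_eq_zero hC⟩, fun A hA => ?_, ?_⟩, ?_⟩
  · obtain ⟨a, b, h, hs⟩ := exists_subset_of_indep hA
    refine LinearIndepOn.mono ?_ hs
    refine (LinearIndepOn.pair_iff _ (ne_of_det h).symm).2 ?_
    exact LinearIndependent.pair_iff.1 (linearIndependent_toReal h)
  · obtain ⟨a, b, h⟩ := X.exists_unimodular
    have h₁ : det (X.vec a) (X.vec b) ≠ 0 := by
      rcases h with h | h <;> rw [h] <;> decide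
    rw [eq_top_iff, ← span_toReal h₁]
    refine Submodule.span_mono ?_
    rw [Matrix.range_cons_cons_empty]
    rintro x (rfl | rfl)
    exacts [⟨a, rfl⟩, ⟨b, rfl⟩]
  · have key : ∀ (n : ℕ) (b : Fin n → X.carrier), Function.Injective b →
        X.toMatroid.IsBasis (Set.range b) → n = 2 := by
      intro n b hb hb'
      obtain ⟨x, y, h, hxy⟩ := isBasis_iff.1 hb'
      have h₁ : (Set.range b).ncard = ({x, y} : Set X.carrier).ncard := congr_arg Set.ncard hxy
      rw [Set.ncard_pair (ne_of_det h).symm, ← Set.image_univ, Set.ncard_image_of_injective _ hb,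
        Set.ncard_univ, Nat.card_eq_fintype_card, Fintype.card_fin] at h₁
      exact h₁
    intro n ω b b' hb hb' h h'
    obtain rfl := key n b hb h
    have key' : ∀ (b : Fin 2 → X.carrier), Function.Injective b →
        X.toMatroid.IsBasis (Set.range b) →
        |ω (fun i => toReal (X.vec (b i)))| = |ω (Pi.basisFun ℝ (Fin 2))| := by
      intro b hb hb'
      have h₁ : det (X.vec (b 0)) (X.vec (b 1)) ≠ 0 :=
        det_ne_zero_of_indep hb'.1 ⟨0, rfl⟩ ⟨1, rfl⟩ (fun h => by simpa using hb h)
      have h₂ : (fun i => toReal (X.vec (b i))) = ![toReal (X.vec (b 0)), toReal (X.vec (b 1))] := by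
        ext i
        fin_cases i <;> rfl
      rw [ω.eq_smul_basis_det (Pi.basisFun ℝ (Fin 2)), AlternatingMap.smul_apply, h₂, det_toReal,
        smul_eq_mul, abs_mul, abs_det_eq_one h₁, AlternatingMap.smul_apply, Module.Basis.det_self]
      simp
    exact (key' b hb h).trans (key' b' hb' h').symm

lemma isRegular_toMatroid : X.toMatroid.IsRegular :=
  ⟨_, _, _, _, isUnipotent_toMatroid⟩

/-- The integral matrices as additive maps. -/
def actHom (g : GL (Fin 2) ℤ) : (Fin 2 → ℤ) →+ (Fin 2 → ℤ) where
  toFun := act g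
  map_zero' := act_zero g
  map_add' := act_add g

/-- A morphism of configurations is an equivariant injection which is induced by an integral
matrix. -/
@[ext]
structure Hom (X Y : VectorConfig.{u}) where
  /-- the underlying map -/
  toFun : X.carrier → Y.carrier
  /-- the integral matrix -/
  mat : GL (Fin 2) ℤ
  injective : Function.Injective toFun
  map_bar : ∀ e, toFun (X.bar e) = Y.bar (toFun e)
  vec_map : ∀ e, Y.vec (toFun e) = act mat (X.vec e)

instance : Category.{u} VectorConfig.{u} where
  Hom X Y := Hom X Y
  id X := ⟨id, 1, Function.injective_id, fun _ => rfl, fun _ => (act_one _).symm⟩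
  comp f g := ⟨g.toFun ∘ f.toFun, g.mat * f.mat, g.injective.comp f.injective,
    fun e => by simp [f.map_bar, g.map_bar],
    fun e => by rw [act_mul, ← f.vec_map, ← g.vec_map]; rfl⟩
  id_comp f := Hom.ext rfl (mul_one _)
  comp_id f := Hom.ext rfl (one_mul _)
  assoc f g h := Hom.ext rfl (mul_assoc _ _ _).symm

lemma act_eq_zero_iff (g : GL (Fin 2) ℤ) (v) : act g v = 0 ↔ v = 0 := by
  rw [← act_zero g, (act_injective g).eq_iff, act_zero]

lemma det_act_ne_zero_iff (g : GL (Fin 2) ℤ) (v w) : det (act g v) (act g w) ≠ 0 ↔ det v w ≠ 0 := by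
  have h₁ : (g : Matrix (Fin 2) (Fin 2) ℤ).det ≠ 0 :=
    ((Matrix.isUnit_iff_isUnit_det _).1 g.isUnit).ne_zero
  simp [det_act, h₁]

lemma isCircuit_image_iff (f : Hom X Y) (C : Set X.carrier) :
    Y.IsCircuit (f.toFun '' C) ↔ X.IsCircuit C := by
  constructor
  · intro h
    have hinj := f.injective.image_injective
    rcases h with ⟨x, hx, h⟩ | ⟨x, y, hx, hy, hxy, h⟩ | ⟨x, y, z, hx, hxy, h⟩
    · obtain ⟨x, -, rfl⟩ : x ∈ f.toFun '' C := by rw [h]; simp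
      obtain rfl : C = {x} := hinj (by rw [h, Set.image_singleton])
      refine isCircuit_singleton ?_
      rwa [f.vec_map, act_eq_zero_iff] at hx
    · obtain ⟨x, -, rfl⟩ : x ∈ f.toFun '' C := by rw [h]; simp
      obtain ⟨y, -, rfl⟩ : y ∈ f.toFun '' C := by rw [h]; simp
      obtain rfl : C = {x, y} := hinj (by rw [h, Set.image_pair])
      rw [f.vec_map, Ne, act_eq_zero_iff] at hx
      rw [f.vec_map, f.vec_map, ← act_add, act_eq_zero_iff] at hxy
      exact isCircuit_pair hx (fun h => hy (by rw [h, f.map_bar])) hxy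
    · obtain ⟨x, -, rfl⟩ : x ∈ f.toFun '' C := by rw [h]; simp
      obtain ⟨y, -, rfl⟩ : y ∈ f.toFun '' C := by rw [h]; simp
      obtain ⟨z, -, rfl⟩ : z ∈ f.toFun '' C := by rw [h]; simp
      obtain rfl : C = {x, y, z} := hinj (by rw [h, Set.image_insert_eq, Set.image_pair])
      rw [f.vec_map, f.vec_map, det_act_ne_zero_iff] at hx
      rw [f.vec_map, f.vec_map, f.vec_map, ← act_add, ← act_add, act_eq_zero_iff] at hxy
      exact isCircuit_triple hx hxy
  · rintro (⟨x, hx, rfl⟩ | ⟨x, y, hx, hy, hxy, rfl⟩ | ⟨x, y, z, hx, hxy, rfl⟩)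
    · rw [Set.image_singleton]
      exact isCircuit_singleton (by rw [f.vec_map, hx, act_zero])
    · rw [Set.image_pair]
      refine isCircuit_pair ?_ (fun h => hy ?_) ?_
      · rwa [f.vec_map, Ne, act_eq_zero_iff]
      · exact f.injective (by rw [h, f.map_bar])
      · rw [f.vec_map, f.vec_map, ← act_add, hxy, act_zero]
    · rw [Set.image_insert_eq, Set.image_pair]
      refine isCircuit_triple ?_ ?_
      · rwa [f.vec_map, f.vec_map, det_act_ne_zero_iff]
      · rw [f.vec_map, f.vec_map, f.vec_map, ← act_add, ← act_add, hxy, act_zero]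

/-- The matrix with given columns. -/
noncomputable def matrixOfBasis {v w : Fin 2 → ℤ} (h : Unimodular v w) : GL (Fin 2) ℤ :=
  Matrix.GeneralLinearGroup.mk'' !![v 0, w 0; v 1, w 1] (by
    rw [Matrix.det_fin_two_of, Int.isUnit_iff, mul_comm (w 0)]
    exact h)

lemma matrixOfBasis_act_e₁ {v w} (h : Unimodular v w) : act (matrixOfBasis h) e₁ = v := by
  change Matrix.mulVec !![v 0, w 0; v 1, w 1] e₁ = v
  ext i
  fin_cases i <;> simp [e₁, Matrix.mulVec, dotProduct]

lemma matrixOfBasis_act_e₂ {v w} (h : Unimodular v w) : act (matrixOfBasis h) e₂ = w := by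
  change Matrix.mulVec !![v 0, w 0; v 1, w 1] e₂ = w
  ext i
  fin_cases i <;> simp [e₂, Matrix.mulVec, dotProduct]

/-- The matrix sending a basis to another one. -/
lemma exists_act_eq {v w v' w' : Fin 2 → ℤ} (h : Unimodular v w) (h' : Unimodular v' w') :
    ∃ g : GL (Fin 2) ℤ, act g v = v' ∧ act g w = w' := by
  refine ⟨matrixOfBasis h' * (matrixOfBasis h)⁻¹, ?_, ?_⟩
  · have := congr_arg (act (matrixOfBasis h)⁻¹) (matrixOfBasis_act_e₁ h)
    rw [act_inv_act] at this
    rw [act_mul, ← this, matrixOfBasis_act_e₁]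
  · have := congr_arg (act (matrixOfBasis h)⁻¹) (matrixOfBasis_act_e₂ h)
    rw [act_inv_act] at this
    rw [act_mul, ← this, matrixOfBasis_act_e₂]

lemma eq_of_act_eq {v w} (h : Unimodular v w) {g g' : GL (Fin 2) ℤ} (hv : act g v = act g' v)
    (hw : act g w = act g' w) : g = g' := by
  have : ∀ z, act g z = act g' z := fun z => by
    rw [h.exists_eq z, act_add, act_add, act_zsmul, act_zsmul, act_zsmul, act_zsmul, hv, hw]
  exact Units.ext (Matrix.mulVec_injective (funext this))

/-- Morphisms of the matroids of configurations are induced by integral matrices. -/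
lemma exists_act_eq_vec (f : FreelyOrientedMatroid.Hom X.toMatroid Y.toMatroid) :
    ∃ g : GL (Fin 2) ℤ, ∀ e : X.carrier, Y.vec (f.toFun e) = act g (X.vec e) := by
  let F : X.carrier → Y.carrier := f.toFun
  have hF : Function.Injective F := f.injective
  have hbar : ∀ e, F (X.bar e) = Y.bar (F e) := f.map_bar
  have hcirc : ∀ C, Y.IsCircuit (F '' C) ↔ X.IsCircuit C := f.image_mem_circuits_iff
  obtain ⟨a, b, hab⟩ := X.exists_unimodular
  have h₀ : det (X.vec a) (X.vec b) ≠ 0 := by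
    rcases hab with h | h <;> rw [h] <;> decide
  have him : F '' ({a, b} ∪ X.bar '' {a, b}) = {F a, F b} ∪ Y.bar '' {F a, F b} := by
    simp only [Set.image_union, Set.image_pair, hbar]
  have h₁ : det (Y.vec (F a)) (Y.vec (F b)) ≠ 0 := by
    intro h
    obtain ⟨C, hC, hs⟩ := exists_isCircuit_of_det_eq_zero h (fun h => ne_of_det h₀ (hF h))
      (fun h => Set.disjoint_left.1 (pair_disjoint_bar h₀) (show b ∈ {a, b} by simp)
        (by rw [hF (h.trans (hbar a).symm)]; simp))
    rw [← him] at hs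
    obtain ⟨C, hs', rfl⟩ := Set.subset_image_iff.1 hs
    exact not_isCircuit_of_det_ne_zero h₀ ((hcirc C).1 hC) hs'
  obtain ⟨g, hga, hgb⟩ := exists_act_eq hab (unimodular_of_ne h₁)
  have hmem : ∀ e ∈ ({a, b} ∪ X.bar '' {a, b} : Set X.carrier),
      Y.vec (F e) = act g (X.vec e) := by
    intro e he
    rw [mem_pair_union_bar] at he
    rcases he with rfl | rfl | rfl | rfl
    · exact hga.symm
    · exact hgb.symm
    · rw [hbar, Y.vec_bar, X.vec_bar, act_neg, hga]
    · rw [hbar, Y.vec_bar, X.vec_bar, act_neg, hgb]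
  refine ⟨g, fun e => ?_⟩
  by_cases he : e ∈ ({a, b} ∪ X.bar '' {a, b} : Set X.carrier)
  · exact hmem e he
  obtain ⟨C, hC, heC, hs⟩ := exists_isCircuit_mem h₀ he
  have s₁ : ∑ᶠ x ∈ C, Y.vec (F x) = 0 := by
    rw [← finsum_mem_image hF.injOn]
    exact ((hcirc C).2 hC).finsum_eq_zero
  have s₂ : ∑ᶠ x ∈ C, act g (X.vec x) = 0 := by
    have := (actHom g).map_finsum_mem X.vec (finite_set C)
    rw [hC.finsum_eq_zero, map_zero] at this
    exact this.symm
  have s₃ : ∑ᶠ x ∈ C, (Y.vec (F x) - act g (X.vec x)) = 0 := by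
    rw [finsum_mem_sub_distrib _ _ (finite_set C), s₁, s₂, sub_zero]
  have s₄ : ∑ᶠ x ∈ C, (Y.vec (F x) - act g (X.vec x)) = Y.vec (F e) - act g (X.vec e) := by
    rw [← finsum_mem_singleton (f := fun x => Y.vec (F x) - act g (X.vec x)) (a := e)]
    refine finsum_mem_inter_support_eq' _ _ _ fun x hx => ⟨fun hxC => ?_, fun h => h ▸ heC⟩
    rcases hs hxC with h | h
    · exact h
    · exact absurd (sub_eq_zero.2 (hmem x h)) hx
  exact sub_eq_zero.1 (s₄.symm.trans s₃)

/-- The matroid of a configuration of vectors, as a functor. -/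
def matroidFunctor : VectorConfig.{u} ⥤ RegularMatroidCat.{u} 2 where
  obj X := ⟨X.toMatroid, hasRank_toMatroid, isRegular_toMatroid⟩
  map f := ⟨⟨f.toFun, f.injective, f.map_bar, isCircuit_image_iff f⟩⟩

instance : matroidFunctor.{u}.Faithful where
  map_injective {X Y f g} h := by
    have h₁ : f.toFun = g.toFun :=
      congr_arg (fun f => FreelyOrientedMatroid.Hom.toFun (InducedCategory.Hom.hom f)) h
    refine Hom.ext h₁ ?_
    obtain ⟨a, b, hab⟩ := X.exists_unimodular
    refine eq_of_act_eq hab ?_ ?_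
    · rw [← f.vec_map, ← g.vec_map, h₁]
    · rw [← f.vec_map, ← g.vec_map, h₁]

instance : matroidFunctor.{u}.Full where
  map_surjective {X Y} f := by
    obtain ⟨g, hg⟩ := exists_act_eq_vec f.hom
    exact ⟨⟨f.hom.toFun, g, f.hom.injective, f.hom.map_bar, hg⟩, rfl⟩

end VectorConfig

namespace FreelyOrientedMatroid

variable {M : FreelyOrientedMatroid.{u}}

lemma bar_mem_image {C : Set M.carrier} {e} : M.bar e ∈ M.bar '' C ↔ e ∈ C :=
  (Function.Involutive.injective M.bar_bar).mem_set_image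

lemma bar_notMem_of_circuit {C} (hC : C ∈ M.circuits) {e} (he : e ∈ C) : M.bar e ∉ C := fun h =>
  Set.disjoint_left.1 (M.disjoint_bar C hC) h (bar_mem_image.2 he)

section

variable {V : Type v} [AddCommGroup V] [Module ℝ V] {ρ : M.carrier → V}

lemma IsRepresentation.map_bar (h : M.IsRepresentation ρ) (e) : ρ (M.bar e) = -ρ e :=
  eq_neg_of_add_eq_zero_right (h.add_bar e)

lemma IsRepresentation.map_bar_mem_iff (h : M.IsRepresentation ρ) {W : Submodule ℝ V} (e) :
    ρ (M.bar e) ∈ W ↔ ρ e ∈ W := by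
  rw [h.map_bar, neg_mem_iff]

/-- A circuit provides a linear relation. -/
lemma IsRepresentation.mem_of_circuit (h : M.IsRepresentation ρ) {C} (hC : C ∈ M.circuits) {x}
    (hx : x ∈ C) {W : Submodule ℝ V} (hW : ∀ y ∈ C, y ≠ x → ρ y ∈ W) : ρ x ∈ W := by
  have := M.finite
  obtain ⟨a, ha, hs⟩ := h.circuit C hC
  have hx' : x ∉ C \ {x} := fun h => h.2 rfl
  rw [← Set.insert_sdiff_self_of_mem hx, finsum_mem_insert _ hx' (Set.toFinite _)] at hs
  have h₁ : ∑ᶠ y ∈ C \ {x}, a y • ρ y ∈ W :=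
    finsum_mem_induction (· ∈ W) W.zero_mem (fun _ _ => W.add_mem)
      fun y hy => W.smul_mem _ (hW y hy.1 hy.2)
  rw [eq_neg_of_add_eq_zero_right hs, neg_mem_iff] at h₁
  exact (W.smul_mem_iff (ha x hx).ne').1 h₁

/-- A basis of the matroid spans. -/
lemma IsRepresentation.span_image_eq_top (h : M.IsRepresentation ρ) {B} (hB : M.IsBasis B) :
    Submodule.span ℝ (ρ '' B) = ⊤ := by
  set W := Submodule.span ℝ (ρ '' B)
  have hB₁ : ∀ e ∈ B ∪ M.bar '' B, ρ e ∈ W := by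
    rintro _ (he | ⟨e, he, rfl⟩)
    · exact Submodule.subset_span ⟨_, he, rfl⟩
    · rw [h.map_bar_mem_iff]
      exact Submodule.subset_span ⟨_, he, rfl⟩
  rw [eq_top_iff, ← h.span, Submodule.span_le]
  rintro _ ⟨e, rfl⟩
  by_cases he : e ∈ B ∪ M.bar '' B
  · exact hB₁ e he
  simp only [Set.mem_union, not_or] at he
  have h₁ : ¬ M.Indep (insert e B) := fun h' =>
    he.1 (hB.2 h' (Set.subset_insert _ _) (Set.mem_insert _ _))
  have h₂ : Disjoint (insert e B) (M.bar '' insert e B) := by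
    rw [Set.image_insert_eq, Set.disjoint_insert_left, Set.disjoint_insert_right]
    refine ⟨?_, fun h => he.2 ⟨_, h, M.bar_bar e⟩, hB.1.1⟩
    rintro (h | h)
    exacts [M.bar_ne e h.symm, he.2 h]
  obtain ⟨C, hC, hs⟩ : ∃ C ∈ M.circuits, C ⊆ insert e B ∪ M.bar '' insert e B := by
    by_contra! h'
    exact h₁ ⟨h₂, h'⟩
  have h₃ : ∃ x ∈ C, x = e ∨ x = M.bar e := by
    by_contra! h'
    refine hB.1.2 C hC fun y hy => ?_
    obtain ⟨h₄, h₅⟩ := h' y hy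
    rcases hs hy with (h | h) | h
    · exact absurd h h₄
    · exact Or.inl h
    · rw [Set.image_insert_eq] at h
      exact Or.inr (h.resolve_left h₅)
  obtain ⟨x, hx, hxe⟩ := h₃
  have h₄ : ρ x ∈ W := by
    refine h.mem_of_circuit hC hx fun y hy hyx => hB₁ y ?_
    have hyx' : y ≠ M.bar x := fun h => bar_notMem_of_circuit hC hx (h ▸ hy)
    have h₆ : y ≠ e ∧ y ≠ M.bar e := by
      rcases hxe with rfl | rfl
      · exact ⟨hyx, hyx'⟩
      · rw [M.bar_bar] at hyx'
        exact ⟨hyx', hyx⟩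
    rcases hs hy with (h | h) | h
    · exact absurd h h₆.1
    · exact Or.inl h
    · rw [Set.image_insert_eq] at h
      exact Or.inr (h.resolve_left h₆.2)
  rcases hxe with rfl | rfl
  · exact h₄
  · exact (h.map_bar_mem_iff e).1 h₄

/-- Two elements with linearly independent images, which span, form a basis. -/
lemma IsRepresentation.isBasis_pair (h : M.IsRepresentation ρ) {e f}
    (hef : LinearIndependent ℝ ![ρ e, ρ f]) (hs : Submodule.span ℝ {ρ e, ρ f} = ⊤) :
    M.IsBasis {e, f} := by
  have hfe : ρ f ∉ Submodule.span ℝ {ρ e} := fun h => by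
    obtain ⟨c, hc⟩ := Submodule.mem_span_singleton.1 h
    exact (LinearIndependent.pair_iff' (hef.ne_zero 0)).1 hef c hc
  have hef' : ρ e ∉ Submodule.span ℝ {ρ f} := fun h => by
    obtain ⟨c, hc⟩ := Submodule.mem_span_singleton.1 h
    have := LinearIndependent.pair_iff.1 hef 1 (-c) (by simp [hc])
    exact one_ne_zero this.1
  have hmem : ∀ x, x ∈ {e, f} ∪ M.bar '' {e, f} → (x = e ∨ x = M.bar e) ∨ x = f ∨ x = M.bar f := by
    intro x
    rw [Set.image_pair]
    rintro ((h | h) | (h | h)) <;> tauto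
  have hspan : ∀ x y, y = x ∨ y = M.bar x → ρ y ∈ Submodule.span ℝ {ρ x} := by
    rintro x y (rfl | rfl)
    · exact Submodule.mem_span_singleton_self _
    · rw [h.map_bar_mem_iff]
      exact Submodule.mem_span_singleton_self _
  have hcirc : ∀ C ∈ M.circuits, ∀ x x', (∀ y ∈ C, (y = x ∨ y = M.bar x) ∨ y = x' ∨ y = M.bar x') →
      ∀ y ∈ C, (y = x ∨ y = M.bar x) → ρ x ∈ Submodule.span ℝ {ρ x'} := by
    intro C hC x x' hC' y hy hyx
    have h₃ : ρ y ∈ Submodule.span ℝ {ρ x'} := by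
      refine h.mem_of_circuit hC hy fun z hz hzy => hspan _ _ ((hC' z hz).resolve_left ?_)
      have hzy' : z ≠ M.bar y := fun h => bar_notMem_of_circuit hC hy (h ▸ hz)
      rcases hyx with rfl | rfl
      · tauto
      · rw [M.bar_bar] at hzy'
        tauto
    rcases hyx with rfl | rfl
    · exact h₃
    · exact (h.map_bar_mem_iff x).1 h₃
  refine ⟨⟨?_, fun C hC hs => ?_⟩, fun A hA hs' x hx => ?_⟩
  · rw [Set.image_pair, Set.disjoint_left]
    rintro x (rfl | rfl) (h' | h')
    · exact M.bar_ne _ h'.symm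
    · exact hef' (hspan _ _ (Or.inr h'))
    · exact hfe (hspan _ _ (Or.inr h'))
    · exact M.bar_ne _ h'.symm
  · obtain ⟨x, hx⟩ := M.nonempty_of_circuit C hC
    rcases hmem x (hs hx) with h' | h'
    · exact hef' (hcirc C hC e f (fun y hy => hmem y (hs hy)) x hx h')
    · exact hfe (hcirc C hC f e (fun y hy => (hmem y (hs hy)).symm) x hx h')
  · by_contra hx'
    have h₃ := (h.indep A hA).mono (Set.insert_subset hx hs')
    rw [linearIndepOn_insert hx', Set.image_pair, hs] at h₃
    exact h₃.2 trivial

end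

/-- A regular matroid of rank two is represented by a unimodular family of vectors. -/
lemma exists_integral_representation (hr : M.HasRank 2) (hM : M.IsRegular) :
    ∃ χ : M.carrier → Fin 2 → ℤ, (∀ e, χ (M.bar e) = -χ e) ∧
      (∀ e f, det (χ e) (χ f) = 0 ∨ Unimodular (χ e) (χ f)) ∧
      (∃ e f, Unimodular (χ e) (χ f)) ∧
      (∀ C ∈ M.circuits, ∃ a : M.carrier → ℝ,
        (∀ e ∈ C, 0 < a e) ∧ ∑ᶠ e ∈ C, a e • toReal (χ e) = 0) ∧
      ∀ A, M.Indep A → LinearIndepOn ℝ (fun e => toReal (χ e)) A := by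
  have := M.finite
  obtain ⟨V, _, _, ρ, hρ, hvol⟩ := hM
  obtain ⟨B, hB, hB₂⟩ := hr
  obtain ⟨p, q, hpq, rfl⟩ := Set.ncard_eq_two.1 hB₂
  have hli : LinearIndependent ℝ ![ρ p, ρ q] :=
    LinearIndependent.pair_iff.2 ((LinearIndepOn.pair_iff _ hpq).1 (hρ.indep _ hB.1))
  have hsp : Submodule.span ℝ (Set.range ![ρ p, ρ q]) = ⊤ := by
    rw [Matrix.range_cons_cons_empty, ← Set.image_pair]
    exact hρ.span_image_eq_top hB
  let β := Module.Basis.mk hli hsp.ge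
  have hβ : (β : Fin 2 → V) = ![ρ p, ρ q] := Module.Basis.coe_mk _ _
  have hβ₀ : β.equivFun (ρ p) = ![1, 0] := by
    have := β.equivFun_self 0
    rw [hβ] at this
    ext i
    refine (this i).trans ?_
    fin_cases i <;> simp
  have hβ₁ : β.equivFun (ρ q) = ![0, 1] := by
    have := β.equivFun_self 1
    rw [hβ] at this
    ext i
    refine (this i).trans ?_
    fin_cases i <;> simp
  have hdet : ∀ x y : V, β.det ![x, y] =
      β.equivFun x 0 * β.equivFun y 1 - β.equivFun y 0 * β.equivFun x 1 := by
    intro x y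
    rw [Module.Basis.det_apply, Matrix.det_fin_two]
    rfl
  have hcases : ∀ e f, β.det ![ρ e, ρ f] = 0 ∨ |β.det ![ρ e, ρ f]| = 1 := by
    intro e f
    by_cases hef : LinearIndependent ℝ ![ρ e, ρ f]
    · right
      have hs : Submodule.span ℝ {ρ e, ρ f} = ⊤ := by
        rw [← Matrix.range_cons_cons_empty _ _ ![]]
        have : FiniteDimensional ℝ V := β.finiteDimensional_of_finite
        refine hef.span_eq_top_of_card_eq_finrank ?_
        rw [Module.finrank_eq_card_basis β]
      have h₁ := hρ.isBasis_pair hef hs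
      have inj : ∀ {a b : M.carrier}, a ≠ b → Function.Injective ![a, b] := by
        intro a b hab i j
        fin_cases i <;> fin_cases j <;> simp [hab, hab.symm]
      have hne : e ≠ f := by
        rintro rfl
        have := hef.injective (a₁ := 0) (a₂ := 1) rfl
        simp at this
      have h₂ := hvol 2 β.det ![e, f] ![p, q] (inj hne) (inj hpq)
        (by rwa [Matrix.range_cons_cons_empty]) (by rwa [Matrix.range_cons_cons_empty])
      have h₃ : ∀ a b, (fun i => ρ (![a, b] i)) = ![ρ a, ρ b] := by
        intro a b
        ext i
        fin_cases i <;> rfl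
      rw [h₃, h₃, ← hβ, β.det_self, abs_one] at h₂
      exact h₂
    · exact Or.inl (AlternatingMap.map_linearDependent _ _ hef)
  have hint : ∀ x : ℝ, (x = 0 ∨ |x| = 1) → ∃ n : ℤ, (n : ℝ) = x := by
    rintro x (rfl | h)
    · exact ⟨0, by simp⟩
    · rcases (abs_eq zero_le_one).1 h with rfl | rfl
      exacts [⟨1, by simp⟩, ⟨-1, by simp⟩]
  have hex : ∀ e, ∃ v : Fin 2 → ℤ, toReal v = β.equivFun (ρ e) := by
    intro e
    have h₀ := hcases e q
    have h₁ := hcases p e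
    rw [hdet, hβ₁] at h₀
    rw [hdet, hβ₀] at h₁
    obtain ⟨m, hm⟩ := hint _ h₀
    obtain ⟨n, hn⟩ := hint _ h₁
    refine ⟨![m, n], ?_⟩
    ext i
    fin_cases i
    · simpa [toReal] using hm
    · simpa [toReal] using hn
  choose χ hχ using hex
  have hdet' : ∀ e f, (det (χ e) (χ f) : ℝ) = β.det ![ρ e, ρ f] := by
    intro e f
    rw [hdet, ← hχ, ← hχ]
    simp [toReal, det, mul_comm]
  have hinj : Function.Injective toReal := by
    intro v w h
    ext i
    exact Int.cast_injective (congr_fun h i)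
  refine ⟨χ, fun e => hinj ?_, fun e f => ?_, ⟨p, q, ?_⟩, fun C hC => ?_, fun A hA => ?_⟩
  · rw [toReal_neg, hχ, hχ, hρ.map_bar, map_neg]
  · refine (hcases e f).imp (fun h => ?_) fun h => ?_
    · rw [← hdet'] at h
      exact_mod_cast h
    · rw [← hdet', abs_eq zero_le_one] at h
      refine h.imp (fun h => ?_) fun h => ?_ <;> exact_mod_cast h
  · left
    have := hdet' p q
    rw [← hβ, β.det_self] at this
    exact_mod_cast this
  · obtain ⟨a, ha, hs⟩ := hρ.circuit C hC
    refine ⟨a, ha, ?_⟩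
    have h₁ := AddMonoidHom.map_finsum_mem (fun e => a e • ρ e)
      (β.equivFun : V →ₗ[ℝ] Fin 2 → ℝ).toAddMonoidHom (Set.toFinite C)
    rw [hs, map_zero] at h₁
    rw [h₁]
    refine finsum_congr fun e => finsum_congr fun _ => ?_
    rw [hχ]
    exact (map_smul β.equivFun (a e) (ρ e)).symm
  · have h₁ : (fun e => toReal (χ e)) = β.equivFun ∘ ρ := funext hχ
    rw [h₁]
    exact LinearIndependent.map' (hρ.indep A hA) (β.equivFun : V →ₗ[ℝ] Fin 2 → ℝ)
      (LinearEquiv.ker β.equivFun)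

/-- The proper subsets of circuits are independent. -/
lemma indep_of_ssubset {A C : Set M.carrier} (hC : C ∈ M.circuits) (h : A ⊂ C) : M.Indep A := by
  have hA := (Set.union_subset_union h.1 (Set.image_mono (f := M.bar) h.1))
  refine ⟨(M.disjoint_bar C hC).mono h.1 (Set.image_mono h.1), fun C' hC' hs => h.2 fun x hx => ?_⟩
  have hx' := Set.disjoint_left.1 (M.disjoint_bar C hC)
  rcases M.eq_or_eq_bar _ hC' _ hC (hs.trans hA) with rfl | rfl
  · exact (hs hx).resolve_right fun h' => hx' hx (Set.image_mono h.1 h')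
  · exact bar_mem_image.1 ((hs (bar_mem_image.2 hx)).resolve_left fun h' =>
      hx' (h.1 h') (bar_mem_image.2 hx))

end FreelyOrientedMatroid

namespace VectorConfig

variable {X : VectorConfig.{u}}

lemma not_linearIndepOn_pair {e f} (h : det (X.vec e) (X.vec f) = 0) (hef : e ≠ f) :
    ¬ LinearIndepOn ℝ (fun e => toReal (X.vec e)) {e, f} := by
  intro h'
  have h₁ : X.vec e ≠ 0 := fun h => h'.ne_zero (show e ∈ {e, f} by simp) (by simp [h])
  have h₂ : X.vec f ≠ 0 := fun h => h'.ne_zero (show f ∈ {e, f} by simp) (by simp [h])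
  rw [LinearIndepOn.pair_iff _ hef] at h'
  rcases vec_eq_or_neg_of_det_eq_zero h h₁ h₂ with h₃ | h₃
  · simpa using h' 1 (-1) (by simp [h₃])
  · simpa using h' 1 1 (by simp [h₃])

lemma not_linearIndepOn_triple {e f g} (h : det (X.vec e) (X.vec f) ≠ 0) (he : g ≠ e)
    (hf : g ≠ f) : ¬ LinearIndepOn ℝ (fun e => toReal (X.vec e)) {e, f, g} := by
  intro h'
  have h₁ : ({e, f, g} : Set X.carrier) = insert g {e, f} := by
    rw [Set.pair_comm f, Set.insert_comm]
  have h₂ := span_toReal h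
  rw [Matrix.range_cons_cons_empty] at h₂
  rw [h₁, linearIndepOn_insert (by simp [he, hf]), Set.image_pair, h₂] at h'
  exact h'.2 trivial

lemma IsCircuit.not_linearIndepOn {C} (hC : X.IsCircuit C) :
    ¬ LinearIndepOn ℝ (fun e => toReal (X.vec e)) C := by
  rcases hC with ⟨x, hx, rfl⟩ | ⟨x, y, hx, hy, hxy, rfl⟩ | ⟨x, y, z, hx, hxy, rfl⟩
  · exact fun h => h.ne_zero rfl (by simp [hx])
  · refine not_linearIndepOn_pair ?_ (ne_of_add_eq_zero hx hxy).symm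
    rw [eq_neg_of_add_eq_zero_right hxy, det_neg_right, det_self, neg_zero]
  · obtain ⟨h₁, h₂⟩ := det_third hx hxy
    exact not_linearIndepOn_triple hx (ne_of_det h₁) (ne_of_det h₂)

/-- A positive relation whose proper subsets are linearly independent is a circuit. -/
lemma isCircuit_of_relation {C : Set X.carrier} (hne : C.Nonempty) (hbar : ∀ e ∈ C, X.bar e ∉ C)
    {a : X.carrier → ℝ} (ha : ∀ e ∈ C, 0 < a e) (hs : ∑ᶠ e ∈ C, a e • toReal (X.vec e) = 0)
    (hlin : ∀ A ⊂ C, LinearIndepOn ℝ (fun e => toReal (X.vec e)) A) : X.IsCircuit C := by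
  obtain ⟨x, hx⟩ := hne
  have hinj : ∀ v : Fin 2 → ℤ, toReal v = 0 → v = 0 := by
    intro v hv
    ext i
    have h : (v i : ℝ) = 0 := congr_fun hv i
    exact_mod_cast h
  by_cases h₁ : C = {x}
  · subst h₁
    rw [finsum_mem_singleton, smul_eq_zero] at hs
    exact isCircuit_singleton (hinj _ (hs.resolve_left (ha x rfl).ne'))
  obtain ⟨y, hy, hyx⟩ : ∃ y ∈ C, y ≠ x := by
    by_contra! h
    exact h₁ (Set.eq_singleton_iff_unique_mem.2 ⟨hx, h⟩)
  by_cases h₂ : C = {x, y}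
  · have hx₀ : X.vec x ≠ 0 := fun h =>
      (hlin {x} (h₂ ▸ (Set.ssubset_iff_of_subset (by simp)).2 ⟨y, by simp, hyx⟩)).ne_zero rfl
        (by simp [h])
    have hy₀ : X.vec y ≠ 0 := fun h =>
      (hlin {y} (h₂ ▸ (Set.ssubset_iff_of_subset (by simp)).2 ⟨x, by simp, hyx.symm⟩)).ne_zero rfl
        (by simp [h])
    have hax := ha x hx
    have hay := ha y hy
    have hb : y ≠ X.bar x := fun h => hbar x hx (h ▸ hy)
    rw [h₂, finsum_mem_pair hyx.symm] at hs
    have hd : det (X.vec x) (X.vec y) = 0 := by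
      by_contra h
      exact hax.ne' (LinearIndependent.pair_iff.1 (linearIndependent_toReal h) _ _ hs).1
    rw [h₂]
    refine isCircuit_pair hx₀ hb ?_
    rcases vec_eq_or_neg_of_det_eq_zero hd hx₀ hy₀ with h | h
    · rw [h, ← add_smul, smul_eq_zero] at hs
      exact absurd (hinj _ (hs.resolve_left (by positivity))) hx₀
    · rw [h, add_neg_cancel]
  obtain ⟨z, hz, hzx, hzy⟩ : ∃ z ∈ C, z ≠ x ∧ z ≠ y := by
    by_contra! h
    refine h₂ (Set.Subset.antisymm (fun z hz => ?_) (Set.pair_subset hx hy))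
    by_cases hzx : z = x
    exacts [Or.inl hzx, Or.inr (h z hz hzx)]
  have hdet : ∀ {e f g}, e ∈ C → f ∈ C → g ∈ C → e ≠ f → g ≠ e → g ≠ f →
      det (X.vec e) (X.vec f) ≠ 0 := fun {e f g} he hf hg hef hge hgf h =>
    not_linearIndepOn_pair h hef (hlin _ ((Set.ssubset_iff_of_subset (Set.pair_subset he hf)).2
      ⟨g, hg, by simp [hge, hgf]⟩))
  have hxy := hdet hx hy hz hyx.symm hzx hzy
  have hxz := hdet hx hz hy hzx.symm hyx hzy.symm
  have hzy' := hdet hz hy hx hzy hzx.symm hyx.symm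
  have hC : C = {x, y, z} := by
    have hsub : {x, y, z} ⊆ C := Set.insert_subset hx (Set.pair_subset hy hz)
    by_contra h
    exact not_linearIndepOn_triple hxy hzx hzy (hlin _ (hsub.ssubset_of_ne (Ne.symm h)))
  have hax := ha x hx
  have hay := ha y hy
  have haz := ha z hz
  rw [hC, finsum_mem_insert _ (by simp [hyx.symm, hzx.symm]) (Set.toFinite _),
    finsum_mem_pair hzy.symm] at hs
  have hv := (unimodular_of_ne hxy).exists_eq (X.vec z)
  have hα : det (X.vec x) (X.vec y) * det (X.vec z) (X.vec y) = 1 ∨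
      det (X.vec x) (X.vec y) * det (X.vec z) (X.vec y) = -1 := by
    rcases unimodular_of_ne hxy with h | h <;> rcases unimodular_of_ne hzy' with h' | h' <;>
      simp [h, h']
  have hβ : det (X.vec x) (X.vec y) * det (X.vec x) (X.vec z) = 1 ∨
      det (X.vec x) (X.vec y) * det (X.vec x) (X.vec z) = -1 := by
    rcases unimodular_of_ne hxy with h | h <;> rcases unimodular_of_ne hxz with h' | h' <;>
      simp [h, h']
  generalize det (X.vec x) (X.vec y) * det (X.vec z) (X.vec y) = α at hα hv
  generalize det (X.vec x) (X.vec y) * det (X.vec x) (X.vec z) = β at hβ hv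
  have hzsmul : ∀ (n : ℤ) v, toReal (n • v) = (n : ℝ) • toReal v := by
    intro n v
    ext i
    simp [toReal]
  have hs' : (a x + a z * α) • toReal (X.vec x) + (a y + a z * β) • toReal (X.vec y) = 0 := by
    rw [← hs, hv, map_add, hzsmul, hzsmul]
    module
  obtain ⟨h₃, h₄⟩ := LinearIndependent.pair_iff.1 (linearIndependent_toReal hxy) _ _ hs'
  rw [hC]
  refine isCircuit_triple hxy ?_
  obtain rfl : α = -1 := hα.resolve_left fun h => by
    rw [h] at h₃
    push_cast at h₃
    linarith
  obtain rfl : β = -1 := hβ.resolve_left fun h => by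
    rw [h] at h₄
    push_cast at h₄
    linarith
  rw [hv]
  module

/-- Every regular freely oriented matroid of rank two is the matroid of a configuration of
vectors. -/
lemma exists_toMatroid_eq {M : FreelyOrientedMatroid.{u}} (hr : M.HasRank 2) (hM : M.IsRegular) :
    ∃ X : VectorConfig.{u}, X.toMatroid = M := by
  obtain ⟨χ, h₁, h₂, h₃, h₄, h₅⟩ := FreelyOrientedMatroid.exists_integral_representation hr hM
  let X : VectorConfig.{u} := ⟨M.carrier, M.finite, M.bar, M.bar_bar, M.bar_ne, χ, h₁, h₂, h₃⟩
  have key : ∀ C ∈ M.circuits, X.IsCircuit C := by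
    intro C hC
    obtain ⟨a, ha, hs⟩ := h₄ C hC
    exact isCircuit_of_relation (X := X) (M.nonempty_of_circuit C hC)
      (fun e he => FreelyOrientedMatroid.bar_notMem_of_circuit hC he) ha hs
      fun A hA => h₅ A (FreelyOrientedMatroid.indep_of_ssubset hC hA)
  have key' : ∀ C, X.IsCircuit C → C ∈ M.circuits := by
    intro C hC
    have hC₁ : ¬ M.Indep C := fun h => hC.not_linearIndepOn (h₅ C h)
    have hC₂ : Disjoint C (M.bar '' C) := by
      rw [Set.disjoint_right]
      rintro _ ⟨e, he, rfl⟩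
      exact hC.bar_notMem he
    obtain ⟨C', hC', hs⟩ : ∃ C' ∈ M.circuits, C' ⊆ C ∪ M.bar '' C := by
      by_contra! h
      exact hC₁ ⟨hC₂, h⟩
    rcases (key C' hC').eq_or_eq_bar hC hs with h | h
    · exact h ▸ hC'
    · have h₆ : M.bar '' C' = C := by
        rw [h]
        exact bar_image_bar_image (X := X) C
      exact h₆ ▸ M.bar_mem_circuits C' hC'
  refine ⟨X, ?_⟩
  have h₆ : {C | X.IsCircuit C} = M.circuits := Set.ext fun C => ⟨key' C, key C⟩
  cases M
  simp only [toMatroid, FreelyOrientedMatroid.mk.injEq, heq_eq_eq]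
  exact ⟨rfl, rfl, h₆⟩

instance : matroidFunctor.{u}.EssSurj where
  mem_essImage N := by
    obtain ⟨X, h⟩ := exists_toMatroid_eq N.property.1 N.property.2
    exact ⟨X, ⟨eqToIso (ObjectProperty.FullSubcategory.ext h)⟩⟩

instance : matroidFunctor.{u}.IsEquivalence where

end VectorConfig

namespace Farey

lemma IsUnimodularSystem.finite {E : Set (Fin 2 → ℤ)} (hE : IsUnimodularSystem E) : E.Finite := by
  obtain ⟨v, hv, w, hw, h⟩ := hE.exists_unimodular
  rcases hE.eq_edge_or_triangle h hv hw with h | h | h <;> rw [h] <;>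
    simp only [edge, triangle, Set.finite_insert, Set.finite_singleton]

lemma ne_neg_self {v : Fin 2 → ℤ} (hv : v ≠ 0) : -v ≠ v := fun h =>
  hv (self_eq_neg.1 h.symm)

end Farey

namespace VectorConfig

/-- The nonzero vectors of a configuration. -/
def support (X : VectorConfig.{u}) : IR 2 :=
  ⟨{v | v ≠ 0 ∧ ∃ x, X.vec x = v}, (isUnimodularSystem_iff _).1
    { zero_notMem := fun h => h.1 rfl
      neg_mem_iff := by
        have : ∀ v : Fin 2 → ℤ, (v ≠ 0 ∧ ∃ x, X.vec x = v) → -v ≠ 0 ∧ ∃ x, X.vec x = -v := by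
          rintro _ ⟨h, x, rfl⟩
          exact ⟨neg_ne_zero.2 h, X.bar x, X.vec_bar x⟩
        exact fun v => ⟨this v, fun h => neg_neg v ▸ this _ h⟩
      unimodular := by
        rintro _ ⟨-, x, rfl⟩ _ ⟨-, y, rfl⟩
        exact X.det_cases x y
      exists_unimodular := by
        obtain ⟨x, y, h⟩ := X.exists_unimodular
        exact ⟨_, ⟨h.left_ne_zero, x, rfl⟩, _, ⟨h.right_ne_zero, y, rfl⟩, h⟩ }⟩

/-- The functor sending a configuration to the set of its nonzero vectors. -/
def supportFunctor : VectorConfig.{u} ⥤ Orb actionIR where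
  obj X := ⟨X.support⟩
  map {X Y} f := ⟨f.mat, by
    rintro _ ⟨_, ⟨h, x, rfl⟩, rfl⟩
    exact ⟨fun h' => h ((act_eq_zero_iff _ _).1 h'), f.toFun x, f.vec_map x⟩⟩
  map_id _ := rfl
  map_comp _ _ := rfl

/-- The tautological configuration attached to a set of vectors. -/
def tautological (E : IR 2) : VectorConfig.{u} where
  carrier := ULift.{u} E.1
  finite := by
    have := (isUnimodularSystem E).finite.to_subtype
    infer_instance
  bar x := ⟨-x.down.1, (E.2.2.1 _).1 x.down.2⟩
  bar_bar _ := ULift.ext _ _ (Subtype.ext (neg_neg _))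
  bar_ne x h := ne_neg_self (fun h' => E.2.1 (Set.mem_of_eq_of_mem h'.symm x.down.2))
    (congr_arg (fun y : ULift.{u} E.1 => y.down.1) h)
  vec x := x.down.1
  vec_bar _ := rfl
  det_cases x y := (isUnimodularSystem E).unimodular _ x.down.2 _ y.down.2
  exists_unimodular := by
    obtain ⟨v, hv, w, hw, h⟩ := (isUnimodularSystem E).exists_unimodular
    exact ⟨⟨v, hv⟩, ⟨w, hw⟩, h⟩

/-- The functor sending a set of vectors to the tautological configuration. -/
def tautologicalFunctor : Orb actionIR ⥤ VectorConfig.{u} where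
  obj E := tautological E.pt
  map {_ F} g :=
    { toFun := fun x => ⟨act g.1 x.down.1, g.2 ⟨_, x.down.2, rfl⟩⟩
      mat := g.1
      injective := fun _ _ h => ULift.ext _ _ (Subtype.ext (act_injective g.1
        (congr_arg (fun y : ULift.{u} F.pt.1 => y.down.1) h)))
      map_bar := fun _ => ULift.ext _ _ (Subtype.ext (act_neg _ _))
      vec_map := fun _ => rfl }
  map_id _ := Hom.ext (funext fun _ => ULift.ext _ _ (Subtype.ext (act_one _))) rfl
  map_comp _ _ := Hom.ext (funext fun _ => ULift.ext _ _ (Subtype.ext (act_mul _ _ _))) rfl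

/-- The disjoint union of a configuration and of the tautological configuration of its nonzero
vectors. -/
def sum (X : VectorConfig.{u}) : VectorConfig.{u} where
  carrier := X.carrier ⊕ (tautological.{u} X.support).carrier
  finite := by
    have := X.finite
    have := (tautological.{u} X.support).finite
    infer_instance
  bar := Sum.map X.bar (tautological X.support).bar
  bar_bar := by
    rintro (x | x)
    exacts [congr_arg Sum.inl (X.bar_bar x), congr_arg Sum.inr ((tautological _).bar_bar x)]
  bar_ne := by
    rintro (x | x) h
    exacts [X.bar_ne x (Sum.inl_injective h), (tautological _).bar_ne x (Sum.inr_injective h)]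
  vec := Sum.elim X.vec (tautological X.support).vec
  vec_bar := by
    rintro (x | x)
    exacts [X.vec_bar x, rfl]
  det_cases := by
    have : ∀ x, ∃ y, Sum.elim X.vec (tautological.{u} X.support).vec x = X.vec y := by
      rintro (x | ⟨_, _, x, rfl⟩)
      exacts [⟨x, rfl⟩, ⟨x, rfl⟩]
    intro x y
    obtain ⟨x', hx⟩ := this x
    obtain ⟨y', hy⟩ := this y
    rw [hx, hy]
    exact X.det_cases x' y'
  exists_unimodular := by
    obtain ⟨x, y, h⟩ := X.exists_unimodular
    exact ⟨Sum.inl x, Sum.inl y, h⟩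

/-- The functoriality of the disjoint union. -/
def sumFunctor : VectorConfig.{u} ⥤ VectorConfig.{u} where
  obj X := X.sum
  map {X Y} f :=
    { toFun := Sum.map f.toFun
        (Hom.toFun ((supportFunctor ⋙ tautologicalFunctor).map f))
      mat := f.mat
      injective := f.injective.sumMap
        (Hom.injective ((supportFunctor ⋙ tautologicalFunctor).map f))
      map_bar := by
        rintro (x | x)
        · exact congr_arg Sum.inl (f.map_bar x)
        · exact congr_arg Sum.inr
            (Hom.map_bar ((supportFunctor ⋙ tautologicalFunctor).map f) x)
      vec_map := by
        rintro (x | x)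
        exacts [f.vec_map x, rfl] }
  map_id X := Hom.ext (by
    funext x
    rcases x with x | x
    · rfl
    · exact congr_arg Sum.inr (congr_fun (congr_arg Hom.toFun
        ((supportFunctor ⋙ tautologicalFunctor).map_id X)) x)) rfl
  map_comp f g := Hom.ext (by
    funext x
    rcases x with x | x
    · rfl
    · exact congr_arg Sum.inr (congr_fun (congr_arg Hom.toFun
        ((supportFunctor ⋙ tautologicalFunctor).map_comp f g)) x)) rfl

/-- The inclusion of the configuration. -/
def inlSum : 𝟭 VectorConfig.{u} ⟶ sumFunctor where
  app _ := ⟨Sum.inl, 1, Sum.inl_injective, fun _ => rfl, fun _ => (act_one _).symm⟩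
  naturality _ _ _ := Hom.ext rfl ((one_mul _).trans (mul_one _).symm)

/-- The inclusion of the tautological configuration. -/
def inrSum : supportFunctor.{u} ⋙ tautologicalFunctor.{u} ⟶ sumFunctor where
  app _ := ⟨Sum.inr, 1, Sum.inr_injective, fun _ => rfl, fun _ => (act_one _).symm⟩
  naturality _ _ _ := Hom.ext rfl ((one_mul _).trans (mul_one _).symm)

/-- The vectors of the tautological configuration. -/
def supportTautological : tautologicalFunctor.{u} ⋙ supportFunctor.{u} ⟶ 𝟭 (Orb actionIR) where
  app _ := ⟨1, by
    rw [map_one]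
    rintro _ ⟨-, x, rfl⟩
    exact x.down.2⟩
  naturality _ _ _ := Subtype.ext ((one_mul _).trans (mul_one _).symm)

section

attribute [local instance] uliftCategory

lemma nonempty_homeomorph_uLift (C : Type u) [Category.{v} C] :
    Nonempty (classifyingSpace C ≃ₜ classifyingSpace (ULiftHom.{w} (ULift.{w'} C))) :=
  SSet.nonempty_homeomorph_of_equiv (fun _ =>
    { toFun := fun x => (x : ComposableArrows C _) ⋙ ULift.upFunctor ⋙ ULiftHom.up
      invFun := fun x => (x : ComposableArrows (ULiftHom.{w} (ULift.{w'} C)) _) ⋙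
        ULiftHom.down ⋙ ULift.downFunctor
      left_inv := fun _ => rfl
      right_inv := fun _ => rfl }) fun _ _ => rfl

/-- The category of configurations and the homotopy orbit category of `IR 2` have the same
classifying space. -/
theorem nonempty_homotopyEquiv_orb :
    Nonempty (classifyingSpace VectorConfig.{u} ≃ₕ classifyingSpace (Orb actionIR)) := by
  obtain ⟨h⟩ := nonempty_homeomorph_uLift.{0, 0, u, u + 1} (Orb actionIR)
  let e : Orb actionIR ≌ ULiftHom.{u} (ULift.{u + 1} (Orb actionIR)) :=
    ULiftHomULiftCategory.equiv _
  refine ⟨ContinuousMap.HomotopyEquiv.trans ?_ h.symm.toHomotopyEquiv⟩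
  refine classifyingHomotopyEquiv (supportFunctor ⋙ e.functor) (e.inverse ⋙ tautologicalFunctor)
    ?_ ?_
  · have α : (supportFunctor ⋙ e.functor) ⋙ (e.inverse ⋙ tautologicalFunctor) ⟶ sumFunctor.{u} :=
      Functor.whiskerRight (Functor.whiskerLeft supportFunctor e.unitInv) tautologicalFunctor ≫
        inrSum
    exact (classifyingMap_homotopic α).trans (classifyingMap_homotopic inlSum).symm
  · have α : (e.inverse ⋙ tautologicalFunctor.{u}) ⋙ (supportFunctor ⋙ e.functor) ⟶ 𝟭 _ :=
      Functor.whiskerRight (Functor.whiskerLeft e.inverse supportTautological) e.functor ≫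
        e.counit
    exact classifyingMap_homotopic α

end

/-- The classifying space of the category of regular matroids of rank two. -/
theorem nonempty_homotopyEquiv_regularMatroidCat :
    Nonempty (classifyingSpace (RegularMatroidCat.{u} 2) ≃ₕ
      classifyingSpace (SingleObj (GL (Fin 2) ℤ))) := by
  obtain ⟨h₁⟩ := nonempty_homotopyEquiv_orb.{u}
  obtain ⟨h₂⟩ := Orb.nonempty_homotopyEquiv actionIR rootedTreePoset
  exact ⟨(matroidFunctor.asEquivalence.classifyingHomotopyEquiv.symm.trans h₁).trans h₂⟩

end VectorConfig

/-- `|IR(2,ℤ)|` is contractible; it is an infinite tree: the order complex of `IR(2,ℤ)` has no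
simplices of dimension at least two, infinitely many vertices, and its graph is a tree. Moreover
`BR(2,ℤ)` is homotopy equivalent to `BGL(2,ℤ)`. -/
theorem mainTheorem5 :
    ContractibleSpace (classifyingSpace (IR 2)) ∧
    ((¬ ∃ E₁ E₂ E₃ : IR 2, E₁ < E₂ ∧ E₂ < E₃) ∧
      Infinite (IR 2) ∧ (comparabilityGraph (IR 2)).IsTree) ∧
    Nonempty (classifyingSpace (RegularMatroidCat.{u} 2) ≃ₕ
      classifyingSpace (SingleObj (GL (Fin 2) ℤ))) := by
  refine ⟨Farey.rootedTreePoset.contractibleSpace, ⟨?_, Farey.infinite_IR,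
    Farey.rootedTreePoset.isTree⟩, VectorConfig.nonempty_homotopyEquiv_regularMatroidCat⟩
  rintro ⟨E₁, E₂, E₃, h, h'⟩
  exact Farey.rootedTreePoset.not_chain _ _ _ h h'
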